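/- Let $G=(V,E)$ be a finite directed graph, $E\subseteq V\times V$, with $n=|V|$ and $m=|E|$, and let $\mathcal W\subseteq\mathbb R$. For weights $w\colon E\to\mathbb R$, the pair $(G,w)$ is consistent if no cycle (closed path) of $G$ has negative total weight; $\mathbb S_{G,\mathcal W}$ is the set of all $w\colon E\to\mathcal W$ such that $(G,w)$ is consistent. For $\phi\colon V\to\mathbb R$ put $w_\phi(x,y)=w(x,y)+\phi(y)-\phi(x)$; $\phi$ is feasible for $w$ if $w_\phi\ge 0$ on $E$. For $e=(u,v)\in E$ and $c\in\mathcal W$, let $w'=w[e\leftarrow c]$ be the weights that agree with $w$ except that $w'(e)=c$. Consider the unit-cost random access machine that has registers and arrays of natural numbers (to be copied, added, subtracted, compared, and used as array indices) and registers and arrays of real numbers (to be copied, added, subtracted and compared). There is a single program for this machine with the following property. Suppose that its memory stores $G$ as a list of its edges in an arbitrary order, weights $w\in\mathbb S_{G,\mathcal W}$, a potential $\phi$ that is feasible for $w$, an edge $e=(u,v)\in E$ (by its position in the list) and a number $c\in\mathcal W$, and is arbitrary otherwise. Then the program halts after at most $$O(m+n\log n)$$ steps, where the implied constant does not depend on $G,\mathcal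 W,w,\phi,e,c$ or the rest of the memory, and it correctly answers whether $w'\in\mathbb S_{G,\mathcal W}$. If $w'\in\mathbb S_{G,\mathcal W}$ ("accept"), then on halting the memory stores $G$, the weights $w'$ and the potential $$\phi'(x)=\phi(x)+\max\{0,\,-w'_\phi(u,v)-D(x)\},$$ where $D(x)\in[0,\infty]$ is the length of a shortest path from $v$ to $x$ with respect to $w_\phi$ ($\infty$ if there is none), and $\phi'$ is feasible for $w'$. If $w'\notin\mathbb S_{G,\mathcal W}$ ("reject"), then on halting the memory stores $G$, $w$ and $\phi$ as before. Hence the test can be repeated for any sequence of updates. -/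

import Mathlib

/-! ### Weighted directed graphs, consistency and potentials -/

namespace NegWeights

/-- The edge set `E ⊆ V × V` of a directed graph (loops allowed, no parallel edges). -/
abbrev Edge {V : Type*} (G : Digraph V) : Type _ := {p : V × V // G.Adj p.1 p.2}

/-- Paths from `a` to `b`: sequences of vertices, repetitions allowed, with consecutive vertices
joined by edges. -/
inductive Path {V : Type*} (G : Digraph V) : V → V → Type _
  | single (a : V) : Path G a a
  | cons {a b d : V} (h : G.Adj a b) (P : Path G b d) : Path G a d

/-- The weight `w(P)`, the sum of the weights of the edges of the path. -/
def Path.weight {V : Type*} {G : Digraph V} (w : Edge G → ℝ) : {a b : V} → Path G a b → ℝ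
  | _, _, .single _ => 0
  | _, _, .cons (a := a) (b := b) h P => w ⟨(a, b), h⟩ + P.weight w

/-- `(G, w)` is consistent: no cycle (path from a vertex to itself) has negative weight. -/
def Consistent {V : Type*} (G : Digraph V) (w : Edge G → ℝ) : Prop :=
  ∀ (a : V) (P : Path G a a), 0 ≤ P.weight w

/-- The set `𝕊_{G,W}` of the consistent edge weights with values in `W`. -/
def ConsistentWeights {V : Type*} (G : Digraph V) (W : Set ℝ) : Set (Edge G → ℝ) :=
  {w | (∀ e, w e ∈ W) ∧ Consistent G w}

/-- The potential weight `w_φ(u,v) = w(u,v) + φ(v) - φ(u)`. -/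
def potWeight {V : Type*} {G : Digraph V} (w : Edge G → ℝ) (φ : V → ℝ) : Edge G → ℝ :=
  fun e => w e + φ e.1.2 - φ e.1.1

/-- `φ` is a feasible potential for `(G, w)`. -/
def Feasible {V : Type*} (G : Digraph V) (w : Edge G → ℝ) (φ : V → ℝ) : Prop :=
  ∀ e : Edge G, 0 ≤ potWeight w φ e

open Classical in
/-- The weights `w[e ← c]`. -/
noncomputable def updateWeight {V : Type*} {G : Digraph V} (w : Edge G → ℝ) (e : Edge G) (c : ℝ) :
    Edge G → ℝ :=
  Function.update w e c

/-- The distance from `a` to `b` under the edge weights `w` (`⊤` if there is no path). -/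
noncomputable def dist {V : Type*} (G : Digraph V) (w : Edge G → ℝ) (a b : V) : EReal :=
  ⨅ P : Path G a b, ((P.weight w : ℝ) : EReal)

/-- The potential `φ'(x) = φ(x) + max {0, -w'_φ(u,v) - D(x)}`, where `e = (u,v)`, `w' = w[e ← c]`
and `D(x)` is the distance from `v` to `x` under `w_φ`. If `φ` is feasible for `w`, then `D(x)` is
in `[0, ∞]`, so the maximum is a real number (`0` if `x` is not reachable from `v`). -/
noncomputable def raisedPotential {V : Type*} (G : Digraph V) (w : Edge G → ℝ) (φ : V → ℝ)
    (e : Edge G) (c : ℝ) : V → ℝ :=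
  fun x => φ x + (max 0 (((-potWeight (updateWeight w e c) φ e : ℝ) : EReal)
    - dist G (potWeight w φ) e.1.2 x)).toReal

/-! ### A random access machine with real numbers

The machine has registers and arrays holding natural numbers (counters, indices), and registers and
arrays holding real numbers. A program is a finite term, so it names finitely many of them. Natural
numbers can be added, subtracted and compared, and they address arrays. Real numbers can only be
copied, added, subtracted and compared. -/

/-- A memory state. Arrays are given by their name and an index. -/
structure Mem where
  nat : ℕ → ℕ
  real : ℕ → ℝ
  natArr : ℕ → ℕ → ℕ
  realArr : ℕ → ℕ → ℝ

/-- Elementary instructions; all arguments are names of registers or arrays, except for the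
constant `k`. -/
inductive Instr
  /-- no operation -/
  | skip
  /-- `x := k` -/
  | natConst (x k : ℕ)
  /-- `x := y` -/
  | natCopy (x y : ℕ)
  /-- `x := y + z` -/
  | natAdd (x y z : ℕ)
  /-- `x := y - z`, truncated at `0` -/
  | natSub (x y z : ℕ)
  /-- `x := A[y]` -/
  | natLoad (x A y : ℕ)
  /-- `A[y] := x` -/
  | natStore (A y x : ℕ)
  /-- `r := p` -/
  | realCopy (r p : ℕ)
  /-- `r := p + q` -/
  | realAdd (r p q : ℕ)
  /-- `r := p - q` -/
  | realSub (r p q : ℕ)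
  /-- `r := F[y]` -/
  | realLoad (r F y : ℕ)
  /-- `F[y] := r` -/
  | realStore (F y r : ℕ)

/-- The effect of an instruction. -/
noncomputable def Instr.run : Instr → Mem → Mem
  | skip, s => s
  | natConst x k, s => { s with nat := Function.update s.nat x k }
  | natCopy x y, s => { s with nat := Function.update s.nat x (s.nat y) }
  | natAdd x y z, s => { s with nat := Function.update s.nat x (s.nat y + s.nat z) }
  | natSub x y z, s => { s with nat := Function.update s.nat x (s.nat y - s.nat z) }
  | natLoad x A y, s => { s with nat := Function.update s.nat x (s.natArr A (s.nat y)) }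
  | natStore A y x, s =>
      { s with natArr := Function.update s.natArr A
                (Function.update (s.natArr A) (s.nat y) (s.nat x)) }
  | realCopy r p, s => { s with real := Function.update s.real r (s.real p) }
  | realAdd r p q, s => { s with real := Function.update s.real r (s.real p + s.real q) }
  | realSub r p q, s => { s with real := Function.update s.real r (s.real p - s.real q) }
  | realLoad r F y, s => { s with real := Function.update s.real r (s.realArr F (s.nat y)) }
  | realStore F y r, s =>
      { s with realArr := Function.update s.realArr F
                (Function.update (s.realArr F) (s.nat y) (s.real r)) }

/-- Tests comparing two registers. -/
inductive Test
  | natLt (x y : ℕ)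
  | natLe (x y : ℕ)
  | natEq (x y : ℕ)
  | natNe (x y : ℕ)
  | realLt (r p : ℕ)
  | realLe (r p : ℕ)

/-- The truth value of a test. -/
def Test.Holds : Test → Mem → Prop
  | natLt x y, s => s.nat x < s.nat y
  | natLe x y, s => s.nat x ≤ s.nat y
  | natEq x y, s => s.nat x = s.nat y
  | natNe x y, s => s.nat x ≠ s.nat y
  | realLt r p, s => s.real r < s.real p
  | realLe r p, s => s.real r ≤ s.real p

/-- Programs. -/
inductive Prog
  | instr (i : Instr)
  | seq (P Q : Prog)
  | ite (b : Test) (P Q : Prog)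
  | loop (b : Test) (P : Prog)

/-- `Exec P s s' t`: started in `s`, the program `P` halts in `s'` after exactly `t` steps. Every
execution of an elementary instruction and every evaluation of a test is one step; `loop b P`
repeats `P` while `b` holds. -/
inductive Exec : Prog → Mem → Mem → ℕ → Prop
  | instr (i : Instr) (s : Mem) : Exec (.instr i) s (i.run s) 1
  | seq {P Q : Prog} {s s' s'' : Mem} {t t' : ℕ} :
      Exec P s s' t → Exec Q s' s'' t' → Exec (.seq P Q) s s'' (t + t')
  | iteTrue {b : Test} {P Q : Prog} {s s' : Mem} {t : ℕ} :
      b.Holds s → Exec P s s' t → Exec (.ite b P Q) s s' (t + 1)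
  | iteFalse {b : Test} {P Q : Prog} {s s' : Mem} {t : ℕ} :
      ¬ b.Holds s → Exec Q s s' t → Exec (.ite b P Q) s s' (t + 1)
  | loopTrue {b : Test} {P : Prog} {s s' s'' : Mem} {t t' : ℕ} :
      b.Holds s → Exec P s s' t → Exec (.loop b P) s' s'' t' →
        Exec (.loop b P) s s'' (t + t' + 1)
  | loopFalse {b : Test} {P : Prog} {s : Mem} :
      ¬ b.Holds s → Exec (.loop b P) s s 1

/-- The memory state `s` stores the graph `G` on the vertices `0, …, n-1` as the list of its edges
in the order `ord`, together with the weights `w` and the potential `φ`. All other registers and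
cells are arbitrary. -/
structure Stores {n m : ℕ} (G : Digraph (Fin n)) (ord : Fin m ≃ Edge G) (w : Edge G → ℝ)
    (φ : Fin n → ℝ) (s : Mem) : Prop where
  numVertices : s.nat 0 = n
  numEdges : s.nat 1 = m
  source : ∀ i : Fin m, s.natArr 0 i = (ord i).1.1
  target : ∀ i : Fin m, s.natArr 1 i = (ord i).1.2
  weight : ∀ i : Fin m, s.realArr 0 i = w (ord i)
  potential : ∀ x : Fin n, s.realArr 1 x = φ x

/-- The memory state `s` holds the query `(e, c)`: the index of the edge `e` and the real `c`. -/
structure HoldsQuery {n m : ℕ} {G : Digraph (Fin n)} (ord : Fin m ≃ Edge G) (e : Edge G) (c : ℝ)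
    (s : Mem) : Prop where
  edge : s.nat 2 = ord.symm e
  newWeight : s.real 0 = c

/-- The answer of a check: the content of an output register (`1`: accept, `0`: reject). -/
def Mem.answer (s : Mem) : ℕ := s.nat 3

end NegWeights

/-!
The weight of a cycle does not change if `w` is replaced by `w_φ`, and `w_φ ≥ 0`. So after the
update of `e = (u, v)` every negative cycle passes through `e`, and there is one if and only if
the `w_φ`-distance `D u` from `v` to `u` is less than `L = -w'_φ(e)`. If `D u < L`, the part of
a path from `v` to `u` of length less than `L` after its last use of `e` closes a negative cycle
with `e` (`not_consistent_update`). If not, then the raised potential `φ + max 0 (L - D)` is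
feasible for `w'` by the triangle inequality for `D` (`Stores.feasible_raisedPotential`), and a
feasible potential implies consistency. So it suffices to compute `D` by Dijkstra's algorithm with
the nonnegative lengths `w_φ` in time `O(m + n log n)`.

The time bound needs a heap in which lowering a key takes constant amortized time. It is a hollow
heap. To lower the key of a vertex, `Heap.push` creates a new root with the new key, which takes
over all but the two children of highest rank of the old node; the old node stays in place and
becomes hollow. Before a minimum is extracted, hollow roots are destroyed and full roots of equal
rank are linked until all the ranks are different (`consolidateStep`). A node of rank `r` always
has children of ranks `r - 1` and `r - 2`, and `2 ^ (r / 2)` exceeds the sum of this quantity over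
the two children by at most `1`. So `2 ^ (r / 2)` is at most the number of nodes for a root of
rank `r` (`Heap.Inv.two_pow_rank_le`), and there are `O(log m)` different ranks. There are at most
`m + 1` nodes, one for `v` and one for each relaxed edge. The potential counts the roots on the
stack twice, the roots in the table once and the hollow nodes three times; it pays for the
consolidation, which makes the extraction of a minimum cost `O(log m)` and the other operations
`O(1)`.

The programs are verified by a weakest precondition `WP` that speaks about the final state and the
exact number of steps, with `WP.loop` for amortized loops. The ghost values of the loops are the
set of the nodes that are alive and the structure of the forest (`Heap.Inv`), while the heap
itself is read off the memory (`Mem.heap`).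
-/

namespace NegWeights

/-! ### Programs with running times -/

/-- Started in `s`, the program `P` halts, and its final state and its number of steps
satisfy `Q`. -/
def WP (P : Prog) (s : Mem) (Q : Mem → ℕ → Prop) : Prop :=
  ∃ s' t, Exec P s s' t ∧ Q s' t

/-- A straight-line program. It ends with a `skip`, which costs one step. -/
def Prog.block : List Instr → Prog
  | [] => .instr .skip
  | i :: l => .seq (.instr i) (Prog.block l)

theorem WP.mono {P : Prog} {s : Mem} {Q R : Mem → ℕ → Prop} (h : WP P s Q)
    (hQR : ∀ s' t, Q s' t → R s' t) : WP P s R := by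
  obtain ⟨s', t, h₁, h₂⟩ := h
  exact ⟨s', t, h₁, hQR _ _ h₂⟩

theorem WP.block (l : List Instr) (s : Mem) {Q : Mem → ℕ → Prop}
    (h : Q (l.foldl (fun s i => i.run s) s) (l.length + 1)) : WP (.block l) s Q := by
  refine ⟨_, _, ?_, h⟩
  clear h
  induction l generalizing s with
  | nil => exact .instr .skip s
  | cons i l ih =>
    have := Exec.seq (.instr i s) (ih (i.run s))
    simpa [Prog.block, add_comm, add_assoc] using this

theorem WP.seq {P₁ P₂ : Prog} {s : Mem} {Q : Mem → ℕ → Prop}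
    (h : WP P₁ s fun s' t => WP P₂ s' fun s'' t' => Q s'' (t + t')) : WP (.seq P₁ P₂) s Q := by
  obtain ⟨s', t, h₁, s'', t', h₂, h₃⟩ := h
  exact ⟨s'', t + t', .seq h₁ h₂, h₃⟩

theorem WP.ite {b : Test} {P₁ P₂ : Prog} {s : Mem} {Q : Mem → ℕ → Prop}
    (h₁ : b.Holds s → WP P₁ s fun s' t => Q s' (t + 1))
    (h₂ : ¬ b.Holds s → WP P₂ s fun s' t => Q s' (t + 1)) : WP (.ite b P₁ P₂) s Q := by
  by_cases hb : b.Holds s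
  · obtain ⟨s', t, h, h'⟩ := h₁ hb
    exact ⟨s', t + 1, .iteTrue hb h, h'⟩
  · obtain ⟨s', t, h, h'⟩ := h₂ hb
    exact ⟨s', t + 1, .iteFalse hb h, h'⟩

/-- Amortized analysis of a loop. The invariant `I` may refer to a ghost value in `α`, whose
potential `μ` pays for each iteration, so that the loop terminates as well. -/
theorem WP.loop {α : Type*} {b : Test} {P : Prog} (I : α → Mem → Prop) (μ : α → ℕ)
    (step : ∀ a s, I a s → b.Holds s →
      WP P s fun s' t => ∃ a', I a' s' ∧ t + 1 + μ a' ≤ μ a)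
    {a : α} {s : Mem} (h : I a s) :
    WP (.loop b P) s fun s' t => ∃ a', I a' s' ∧ ¬ b.Holds s' ∧ t + μ a' ≤ μ a + 1 := by
  generalize hk : μ a = k
  induction k using Nat.strong_induction_on generalizing a s with
  | _ k ih =>
    by_cases hb : b.Holds s
    · obtain ⟨s', t, h₁, a', h₂, h₃⟩ := step a s h hb
      obtain ⟨s'', t', h₄, a'', h₅, h₆, h₇⟩ := ih (μ a') (by omega) h₂ rfl
      exact ⟨s'', _, .loopTrue hb h₁ h₄, a'', h₅, h₆, by omega⟩
    · exact ⟨s, 1, .loopFalse hb, a, h, hb, by omega⟩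

/-! ### Hollow heaps -/

/-- The memory of the heap. Its nodes are numbered from `1` to `size`, and `0` stands for
"no node". -/
structure Heap where
  /-- the number of nodes created so far -/
  size : ℕ
  /-- the current node of a vertex, `0` if the vertex has not been discovered -/
  node : ℕ → ℕ
  /-- the vertex that a node was created for -/
  item : ℕ → ℕ
  rank : ℕ → ℕ
  /-- the child of the highest rank -/
  child : ℕ → ℕ
  /-- the sibling whose rank is one less -/
  next : ℕ → ℕ
  /-- the roots that have been sorted by their ranks -/
  table : ℕ → ℕ
  /-- the stack of the other roots -/
  stack : ℕ → ℕ
  /-- the height of the stack -/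
  sp : ℕ
  key : ℕ → ℝ

/-- The place of a node in the forest: an entry of the stack or of the table, or the child of rank
`i` of the node `x`. -/
inductive Place
  | stack (j : ℕ)
  | table (r : ℕ)
  | kid (x i : ℕ)

namespace Heap

/-- A node is full if it is the current node of its vertex, otherwise it is hollow. -/
def Full (H : Heap) (x : ℕ) : Prop := H.node (H.item x) = x

/-- `x` is alive and has a child of rank `i`. A full node of rank `r` has children of all ranks
below `r`, a hollow one only those of ranks `r - 1` and `r - 2`. -/
def HasKid (H : Heap) (F : Finset ℕ) (x i : ℕ) : Prop :=
  x ∈ F ∧ i < H.rank x ∧ (H.Full x ∨ H.rank x ≤ i + 2)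

/-- The heap is a forest, in heap order, on the set `F` of the nodes that are alive: `kid x i` is
the child of rank `i` of `x`, and `loc` gives the unique place of a node in the forest. There are
`n` vertices, and the ranks of the table are below `B`. -/
structure Inv (n B : ℕ) (H : Heap) (F : Finset ℕ) (kid : ℕ → ℕ → ℕ) (loc : ℕ → Place) :
    Prop where
  pos : ∀ x ∈ F, 0 < x ∧ x ≤ H.size
  stack_mem : ∀ j < H.sp, H.stack j ∈ F ∧ loc (H.stack j) = .stack j
  table_mem : ∀ r < B, H.table r ≠ 0 → H.table r ∈ F ∧ loc (H.table r) = .table r ∧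
    H.rank (H.table r) = r ∧ H.Full (H.table r)
  kid_mem : ∀ x i, H.HasKid F x i → kid x i ∈ F ∧ loc (kid x i) = .kid x i ∧
    H.rank (kid x i) = i ∧ H.key x ≤ H.key (kid x i)
  loc_stack : ∀ y ∈ F, ∀ j, loc y = .stack j → j < H.sp ∧ H.stack j = y
  loc_table : ∀ y ∈ F, ∀ r, loc y = .table r → r < B ∧ H.table r = y
  loc_kid : ∀ y ∈ F, ∀ x i, loc y = .kid x i → H.HasKid F x i ∧ kid x i = y
  child_eq : ∀ x ∈ F, 0 < H.rank x → H.child x = kid x (H.rank x - 1)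
  next_eq : ∀ x i, H.HasKid F x i → H.HasKid F x (i + 1) → H.next (kid x (i + 1)) = kid x i
  item_lt : ∀ x ∈ F, H.item x < n
  node_spec : ∀ v < n, H.node v ≠ 0 → H.item (H.node v) = v ∧ H.node v ≤ H.size
  rank_zero : H.rank 0 = 0

variable {n B : ℕ} {H : Heap} {F : Finset ℕ} {kid : ℕ → ℕ → ℕ} {loc : ℕ → Place}

/-- Every node has a root above it, whose key is at most its own. -/
theorem Inv.exists_root (h : H.Inv n B F kid loc) {y : ℕ} (hy : y ∈ F) :
    ∃ z ∈ F, H.key z ≤ H.key y ∧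
      ((∃ j < H.sp, H.stack j = z) ∨ ∃ r < B, H.table r ≠ 0 ∧ H.table r = z) := by
  classical
  -- A node of maximal rank with a key that small has no parent.
  obtain ⟨z, hz, hmax⟩ := (F.filter fun z => H.key z ≤ H.key y).exists_max_image H.rank
    ⟨y, by simp [hy]⟩
  rw [Finset.mem_filter] at hz
  refine ⟨z, hz.1, hz.2, ?_⟩
  cases hl : loc z with
  | stack j => exact .inl ⟨j, h.loc_stack z hz.1 j hl⟩
  | table r =>
    have := h.loc_table z hz.1 r hl
    exact .inr ⟨r, this.1, by have := h.pos z hz.1; omega, this.2⟩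
  | kid x i =>
    obtain ⟨h₁, rfl⟩ := h.loc_kid z hz.1 x i hl
    have h₂ := h.kid_mem x i h₁
    have := hmax x (by simpa using ⟨h₁.1, h₂.2.2.2.trans hz.2⟩)
    have := h₁.2.1
    omega

theorem Inv.card_le (h : H.Inv n B F kid loc) : F.card ≤ H.size := by
  have : F ⊆ Finset.Icc 1 H.size := fun x hx => by
    have := h.pos x hx
    simp; omega
  simpa using Finset.card_le_card this

/-- The recursion behind the rank bound: `2 ^ (r / 2)` is the weight of a node of rank `r`. -/
theorem two_pow_half_le (r : ℕ) :
    2 ^ (r / 2) ≤ 1 + ∑ i ∈ Finset.Ico (r - 2) r, 2 ^ (i / 2) := by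
  rcases lt_or_ge r 2 with hr | hr
  · have : r / 2 = 0 := by omega
    simp [this]
  · obtain ⟨k, rfl⟩ := Nat.exists_eq_add_of_le' hr
    rw [Finset.sum_Ico_succ_top (by omega), Nat.add_sub_cancel, Nat.Ico_succ_singleton,
      Finset.sum_singleton]
    have h₁ : (k + 2) / 2 = k / 2 + 1 := by omega
    have h₂ : 2 ^ (k / 2) ≤ 2 ^ ((k + 1) / 2) := Nat.pow_le_pow_right (by omega) (by omega)
    rw [h₁, pow_succ]
    omega

/-- The rank of a root is logarithmic in the number of nodes. This needs only the two children of
highest rank, which hollow nodes keep: the weight `2 ^ (r / 2)` of a node of rank `r` exceeds the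
weights of these two by at most `1`, and the sum over all nodes telescopes. -/
theorem Inv.two_pow_rank_le (h : H.Inv n B F kid loc) {z : ℕ} (hz : z ∈ F)
    (hroot : ∀ x i, loc z ≠ .kid x i) : 2 ^ (H.rank z / 2) ≤ H.size := by
  classical
  refine le_trans ?_ h.card_le
  let T : Finset (Σ _ : ℕ, ℕ) := F.sigma fun x => Finset.Ico (H.rank x - 2) (H.rank x)
  have hT : ∀ p ∈ T, H.HasKid F p.1 p.2 := fun p hp => by
    simp only [T, Finset.mem_sigma, Finset.mem_Ico] at hp
    exact ⟨hp.1, hp.2.2, .inr (by omega)⟩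
  have hinj : Set.InjOn (fun p : Σ _ : ℕ, ℕ => kid p.1 p.2) T := by
    rintro ⟨x, i⟩ hp ⟨y, j⟩ hq hpq
    have h₁ := (h.kid_mem _ _ (hT _ hp)).2.1
    have h₂ := (h.kid_mem _ _ (hT _ hq)).2.1
    simp only at hpq h₁ h₂
    rw [hpq, h₂] at h₁
    cases h₁
    rfl
  have h₁ : ∑ x ∈ F, 2 ^ (H.rank x / 2)
      ≤ F.card + ∑ x ∈ F, ∑ i ∈ Finset.Ico (H.rank x - 2) (H.rank x), 2 ^ (i / 2) := by
    rw [Finset.card_eq_sum_ones, ← Finset.sum_add_distrib]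
    exact Finset.sum_le_sum fun x _ => two_pow_half_le _
  have h₂ : ∑ x ∈ F, ∑ i ∈ Finset.Ico (H.rank x - 2) (H.rank x), 2 ^ (i / 2)
      ≤ ∑ y ∈ F.erase z, 2 ^ (H.rank y / 2) := by
    rw [Finset.sum_sigma']
    calc ∑ p ∈ T, 2 ^ (p.2 / 2) = ∑ p ∈ T, 2 ^ (H.rank (kid p.1 p.2) / 2) :=
          Finset.sum_congr rfl fun p hp => by rw [(h.kid_mem _ _ (hT p hp)).2.2.1]
      _ = ∑ y ∈ T.image fun p => kid p.1 p.2, 2 ^ (H.rank y / 2) :=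
          (Finset.sum_image (f := fun y => 2 ^ (H.rank y / 2)) hinj).symm
      _ ≤ _ := by
          refine Finset.sum_le_sum_of_subset fun y hy => ?_
          obtain ⟨p, hp, rfl⟩ := Finset.mem_image.1 hy
          have := h.kid_mem _ _ (hT p hp)
          exact Finset.mem_erase.2 ⟨fun he => hroot _ _ (he ▸ this.2.1), this.1⟩
  have h₃ := Finset.add_sum_erase F (fun x => 2 ^ (H.rank x / 2)) hz
  omega

/-- The node on top of the stack. -/
def top (H : Heap) : ℕ := H.stack (H.sp - 1)

/-- Move the top of the stack into the table. -/
def place (H : Heap) : Heap :=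
  { H with table := Function.update H.table (H.rank H.top) H.top, sp := H.sp - 1 }

/-- Make `b` a child of `a`, where one of them is on top of the stack and the other is in the
table, both with rank `r`. Then `a` is on top of the stack. -/
def link (H : Heap) (r a b : ℕ) : Heap :=
  { H with
    next := Function.update H.next b (H.child a)
    child := Function.update H.child a b
    rank := Function.update H.rank a (r + 1)
    table := Function.update H.table r 0
    stack := Function.update H.stack (H.sp - 1) a }

/-- Replace the top of the stack by its `k` children of highest rank. -/
def dismantle (H : Heap) (k : ℕ) : Heap :=
  { H with
    sp := H.sp - 1 + k
    stack := fun j => if H.sp - 1 ≤ j ∧ j < H.sp - 1 + k then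
      H.next^[j - (H.sp - 1)] (H.child H.top) else H.stack j }

/-- Move the entry of rank `r` from the table to the top of the stack. -/
def unplaceTop (H : Heap) (r : ℕ) : Heap :=
  { H with
    stack := Function.update H.stack H.sp (H.table r)
    sp := H.sp + 1
    table := Function.update H.table r 0 }

/-- Move the entry of rank `r` from the table to the stack, below the top. -/
def unplaceBelow (H : Heap) (r : ℕ) : Heap :=
  { H with
    stack := Function.update (Function.update H.stack H.sp H.top) (H.sp - 1) (H.table r)
    sp := H.sp + 1
    table := Function.update H.table r 0 }

/-- Create a new current node with key `d` for the vertex `y`. It inherits all but two of the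
children of the old node, which becomes hollow. For a vertex without a node the formulas apply to
the node `0`, which has rank `0`. The new `child` is junk unless the new rank is positive. -/
def push (H : Heap) (y : ℕ) (d : ℝ) : Heap :=
  { H with
    size := H.size + 1
    node := Function.update H.node y (H.size + 1)
    item := Function.update H.item (H.size + 1) y
    rank := Function.update H.rank (H.size + 1) (H.rank (H.node y) - 2)
    child := Function.update H.child (H.size + 1) (H.next (H.next (H.child (H.node y))))
    key := Function.update H.key (H.size + 1) d
    stack := Function.update H.stack H.sp (H.size + 1)
    sp := H.sp + 1 }

theorem Inv.place (h : H.Inv n B F kid loc) (hsp : 0 < H.sp) (hB : H.rank H.top < B)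
    (hfull : H.Full H.top) (h0 : H.table (H.rank H.top) = 0) :
    ∃ loc', H.place.Inv n B F kid loc' := by
  classical
  obtain ⟨p, hp⟩ : ∃ p, H.sp = p + 1 := ⟨H.sp - 1, by omega⟩
  have ht := h.stack_mem p (by omega)
  have htop : H.top = H.stack p := by simp [Heap.top, hp]
  rw [htop] at hB hfull h0
  have hplace : H.place = { H with
      table := Function.update H.table (H.rank (H.stack p)) (H.stack p), sp := p } := by
    simp [Heap.place, htop, hp]
  rw [hplace]
  refine ⟨Function.update loc (H.stack p) (.table (H.rank (H.stack p))), ?_⟩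
  generalize hx : H.stack p = x at *
  refine ⟨h.pos, ?_, ?_, ?_, ?_, ?_, ?_, h.child_eq, h.next_eq, h.item_lt, h.node_spec,
    h.rank_zero⟩
  · intro j (hj : j < p)
    have := h.stack_mem j (by omega)
    have hne : H.stack j ≠ x := fun he => by grind
    simpa [hne] using this
  · intro r hr hne
    by_cases hrx : r = H.rank x
    · subst hrx
      simpa [Full] using ⟨ht.1, hfull⟩
    · simp only [Function.update_of_ne hrx] at hne ⊢
      have := h.table_mem r hr hne
      have hne : H.table r ≠ x := fun he => by grind
      simpa [hne, Full] using this
  · intro y i hy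
    have := h.kid_mem y i hy
    have hne : kid y i ≠ x := fun he => by grind
    simpa [hne] using this
  · intro y hy j hj
    have := h.loc_stack y hy j
    simp only [Function.update_apply] at *
    grind
  · intro y hy j hj
    have := h.loc_table y hy j
    have := h.pos y hy
    simp only [Function.update_apply] at *
    grind
  · intro y hy a i hj
    have := h.loc_kid y hy a i
    simp only [Function.update_apply] at *
    grind [HasKid, Full]

theorem Inv.unplaceTop (h : H.Inv n B F kid loc) {r : ℕ} (hr : r < B) (h0 : H.table r ≠ 0) :
    ∃ loc', (H.unplaceTop r).Inv n B F kid loc' := by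
  classical
  have ht := h.table_mem r hr h0
  refine ⟨Function.update loc (H.table r) (.stack H.sp), ?_⟩
  refine ⟨h.pos, ?_, ?_, ?_, ?_, ?_, ?_, h.child_eq, h.next_eq, h.item_lt, h.node_spec,
    h.rank_zero⟩
  · intro j (hj : j < H.sp + 1)
    by_cases hjs : j = H.sp
    · simpa [Heap.unplaceTop, hjs] using ht.1
    · have h₁ := h.stack_mem j (by omega)
      have h₂ : H.stack j ≠ H.table r := fun he => by grind
      simpa [Heap.unplaceTop, hjs, h₂] using h₁
  · intro r' hr' hne
    by_cases hrr : r' = r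
    · simp [hrr, Heap.unplaceTop] at hne
    · simp only [Heap.unplaceTop, Function.update_of_ne hrr] at hne ⊢
      have h₁ := h.table_mem r' hr' hne
      have h₂ : H.table r' ≠ H.table r := fun he => by grind
      simpa [h₂, Full] using h₁
  · intro x i hxi
    have h₁ := h.kid_mem x i hxi
    have h₂ : kid x i ≠ H.table r := fun he => by grind
    simpa [Heap.unplaceTop, h₂] using h₁
  · intro y hy j hj
    have h₁ := h.loc_stack y hy j
    simp only [Heap.unplaceTop, Function.update_apply] at *
    grind
  · intro y hy r' hr'
    have h₁ := h.loc_table y hy r'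
    simp only [Heap.unplaceTop, Function.update_apply] at *
    grind
  · intro y hy x i hxi
    have h₁ := h.loc_kid y hy x i
    by_cases hyr : y = H.table r
    · simp [hyr] at hxi
    · rw [Function.update_of_ne hyr] at hxi
      exact h₁ hxi

theorem Inv.unplaceBelow (h : H.Inv n B F kid loc) {r : ℕ} (hsp : 0 < H.sp) (hr : r < B)
    (h0 : H.table r ≠ 0) : ∃ loc', (H.unplaceBelow r).Inv n B F kid loc' := by
  classical
  obtain ⟨p, hp⟩ : ∃ p, H.sp = p + 1 := ⟨H.sp - 1, by omega⟩
  have ht := h.table_mem r hr h0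
  have hs := h.stack_mem p (by omega)
  have hH : H.unplaceBelow r = { H with
      stack := Function.update (Function.update H.stack (p + 1) (H.stack p)) p (H.table r)
      sp := p + 2
      table := Function.update H.table r 0 } := by
    simp [Heap.unplaceBelow, Heap.top, hp]
  have hne : H.stack p ≠ H.table r := fun he => by grind
  rw [hH]
  refine ⟨Function.update (Function.update loc (H.table r) (.stack p)) (H.stack p)
    (.stack (p + 1)), ?_⟩
  refine ⟨h.pos, ?_, ?_, ?_, ?_, ?_, ?_, h.child_eq, h.next_eq, h.item_lt, h.node_spec,
    h.rank_zero⟩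
  · intro j (hj : j < p + 2)
    by_cases hjs : j = p + 1
    · simpa [hjs] using hs.1
    · by_cases hjp : j = p
      · simpa [hjp, hne.symm] using ht.1
      · have h₁ := h.stack_mem j (by omega)
        have h₂ : H.stack j ≠ H.table r := fun he => by grind
        have h₃ : H.stack j ≠ H.stack p := fun he => by grind
        simpa [hjs, hjp, h₂, h₃] using h₁
  · intro r' hr' hne
    by_cases hrr : r' = r
    · simp [hrr] at hne
    · simp only [Function.update_of_ne hrr] at hne ⊢
      have h₁ := h.table_mem r' hr' hne
      have h₂ : H.table r' ≠ H.table r := fun he => by grind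
      have h₃ : H.table r' ≠ H.stack p := fun he => by grind
      simpa [h₂, h₃, Full] using h₁
  · intro x i hxi
    have h₁ := h.kid_mem x i hxi
    have h₂ : kid x i ≠ H.table r := fun he => by grind
    have h₃ : kid x i ≠ H.stack p := fun he => by grind
    simpa [h₂, h₃] using h₁
  · intro y hy j hj
    have h₁ := h.loc_stack y hy j
    simp only [Function.update_apply] at *
    grind
  · intro y hy r' hr'
    have h₁ := h.loc_table y hy r'
    simp only [Function.update_apply] at *
    grind
  · intro y hy x i hxi
    have h₁ := h.loc_kid y hy x i
    by_cases hyp : y = H.stack p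
    · simp [hyp] at hxi
    · by_cases hyr : y = H.table r
      · simp [hyr, hne.symm] at hxi
      · rw [Function.update_of_ne hyp, Function.update_of_ne hyr] at hxi
        exact h₁ hxi

theorem Inv.link (h : H.Inv n B F kid loc) {r a b : ℕ} (hsp : 0 < H.sp) (hr : r < B)
    (hab : (a = H.top ∧ b = H.table r) ∨ (b = H.top ∧ a = H.table r)) (hrank : H.rank H.top = r)
    (hfull : H.Full H.top) (h0 : H.table r ≠ 0) (hkey : H.key a ≤ H.key b) :
    ∃ kid' loc', (H.link r a b).Inv n B F kid' loc' := by
  classical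
  obtain ⟨p, hp⟩ : ∃ p, H.sp = p + 1 := ⟨H.sp - 1, by omega⟩
  have ht := h.stack_mem p (by omega)
  have ht₂ := h.table_mem r hr h0
  have htop : H.top = H.stack p := by simp [Heap.top, hp]
  rw [htop] at hab hrank hfull
  have hlink : H.link r a b = { H with
      next := Function.update H.next b (H.child a)
      child := Function.update H.child a b
      rank := Function.update H.rank a (r + 1)
      table := Function.update H.table r 0
      stack := Function.update H.stack p a } := by
    simp [Heap.link, hp]
  have hst : H.stack p ≠ H.table r := fun he => by
    have h₁ := ht.2
    rw [he, ht₂.2.1] at h₁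
    cases h₁
  have ha : a ∈ F ∧ H.rank a = r ∧ H.Full a ∧ (loc a = .stack p ∨ loc a = .table r) := by
    rcases hab with ⟨rfl, rfl⟩ | ⟨rfl, rfl⟩
    exacts [⟨ht.1, hrank, hfull, .inl ht.2⟩, ⟨ht₂.1, ht₂.2.2.1, ht₂.2.2.2, .inr ht₂.2.1⟩]
  have hb : b ∈ F ∧ H.rank b = r ∧ H.Full b ∧ (loc b = .stack p ∨ loc b = .table r) := by
    rcases hab with ⟨rfl, rfl⟩ | ⟨rfl, rfl⟩
    exacts [⟨ht₂.1, ht₂.2.2.1, ht₂.2.2.2, .inr ht₂.2.1⟩, ⟨ht.1, hrank, hfull, .inl ht.2⟩]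
  have hne : a ≠ b := by
    rcases hab with ⟨rfl, rfl⟩ | ⟨rfl, rfl⟩
    exacts [hst, hst.symm]
  have hloc : ∀ y ∈ F, y ≠ a → y ≠ b → loc y ≠ .stack p ∧ loc y ≠ .table r := by
    intro y hy h₁ h₂
    have h₃ := h.loc_stack y hy p
    have h₄ := h.loc_table y hy r
    grind
  obtain ⟨haF, har, haf, hal⟩ := ha
  obtain ⟨hbF, hbr, hbf, hbl⟩ := hb
  rw [hlink]
  refine ⟨fun x i => if x = a ∧ i = r then b else kid x i,
    fun y => if y = a then .stack p else if y = b then .kid a r else loc y, ?_⟩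
  -- The only new child is `b`, below `a`.
  have hkid : ∀ x i, HasKid { H with
      next := Function.update H.next b (H.child a)
      child := Function.update H.child a b
      rank := Function.update H.rank a (r + 1)
      table := Function.update H.table r 0
      stack := Function.update H.stack p a } F x i ↔ (x = a ∧ i = r) ∨ H.HasKid F x i := by
    intro x i
    by_cases hx : x = a
    · subst hx
      simp only [HasKid, Full, Function.update_self, har]
      unfold Full at haf
      grind
    · simp [HasKid, Full, hx]
  have hkidne : ∀ x i, H.HasKid F x i → ¬ (x = a ∧ i = r) ∧ kid x i ≠ a ∧ kid x i ≠ b := by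
    intro x i hxi
    have h₁ := h.kid_mem x i hxi
    refine ⟨fun he => ?_, fun he => ?_, fun he => ?_⟩
    · have := hxi.2.1
      rw [he.1, he.2] at this
      omega
    · rw [he] at h₁; grind
    · rw [he] at h₁; grind
  have hkid' : ∀ x i, H.HasKid F x i →
      (if x = a ∧ i = r then b else kid x i) = kid x i := by
    intro x i hxi
    exact if_neg (hkidne x i hxi).1
  refine ⟨h.pos, ?_, ?_, ?_, ?_, ?_, ?_, ?_, ?_, h.item_lt, h.node_spec, ?_⟩
  · intro j (hj : j < H.sp)
    by_cases hjp : j = p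
    · subst hjp
      simpa using haF
    · have h₁ := h.stack_mem j hj
      have h₂ : H.stack j ≠ a := fun he => by grind
      have h₃ : H.stack j ≠ b := fun he => by grind
      simpa [hjp, h₂, h₃] using h₁
  · intro r' hr' hne'
    by_cases hrr : r' = r
    · simp [hrr] at hne'
    · simp only [Function.update_of_ne hrr] at hne' ⊢
      have h₁ := h.table_mem r' hr' hne'
      have h₂ : H.table r' ≠ a := fun he => by grind
      have h₃ : H.table r' ≠ b := fun he => by grind
      simpa [h₂, h₃, Full] using h₁
  · intro x i hxi
    rcases (hkid x i).1 hxi with ⟨rfl, rfl⟩ | hxi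
    · simpa [hne.symm] using ⟨hbF, hbr, hkey⟩
    · have h₁ := h.kid_mem x i hxi
      rw [hkid' x i hxi]
      have h₂ := (hkidne x i hxi).2
      simpa [h₂.1, h₂.2] using h₁
  · intro y hy j hj
    have h₁ := h.loc_stack y hy j
    have h₂ := hloc y hy
    simp only [Function.update_apply]
    clear hkid hkid' hkidne hlink
    grind
  · intro y hy r' hr'
    have h₁ := h.loc_table y hy r'
    have h₂ := hloc y hy
    simp only [Function.update_apply]
    clear hkid hkid' hkidne hlink
    grind
  · intro y hy x i hxi
    rw [hkid]
    have h₁ := h.loc_kid y hy x i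
    have h₂ := hkid' x i
    clear hkid hkid' hkidne hlink
    grind
  · intro x hx hrx
    have h₁ := h.child_eq x hx
    simp only [Function.update_apply] at *
    clear hkid hkid' hkidne hlink
    grind
  · intro x i hi hi'
    rw [hkid] at hi hi'
    have h₁ := h.next_eq x i
    have h₂ := h.child_eq a haF
    have h₃ := hkid' x i
    have h₄ := hkidne x (i + 1)
    have h₅ := hkidne x i
    have h₆ := hkid' x (i + 1)
    have h₇ : H.HasKid F x i → i < H.rank x := fun h => h.2.1
    have h₈ : H.HasKid F x (i + 1) → i + 1 < H.rank x := fun h => h.2.1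
    clear hkid hkid' hkidne hloc hlink
    dsimp only
    rcases hi with ⟨rfl, rfl⟩ | hi
    · exfalso
      rcases hi' with ⟨-, hi'⟩ | hi'
      · omega
      · have := h₈ hi'
        omega
    · rw [h₃ hi]
      rcases hi' with ⟨rfl, rfl⟩ | hi'
      · simp only [Function.update_self, and_self, if_true]
        rw [h₂ (by omega), har]
        simp
      · rw [h₆ hi', Function.update_of_ne (h₄ hi').2.2, h₁ hi hi']
  · have h₁ : (0 : ℕ) ≠ a := fun he => by
      have := h.pos a haF
      omega
    simpa [h₁] using h.rank_zero

/-- The `next` pointers lead through the children by decreasing rank. -/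
theorem Inv.next_iterate (h : H.Inv n B F kid loc) {x k : ℕ} (hx : x ∈ F) (hk : k < H.rank x)
    (hfull : H.Full x ∨ k < 2) : H.next^[k] (H.child x) = kid x (H.rank x - 1 - k) := by
  induction k with
  | zero => simpa using h.child_eq x hx (by omega)
  | succ k ih =>
    rw [Function.iterate_succ_apply', ih (by omega) (hfull.imp_right (by omega))]
    have h₁ := h.next_eq x (H.rank x - 1 - (k + 1))
      ⟨hx, by omega, by rcases hfull with h | h; exacts [.inl h, .inr (by omega)]⟩
      ⟨hx, by omega, by rcases hfull with h | h; exacts [.inl h, .inr (by omega)]⟩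
    rwa [show H.rank x - 1 - (k + 1) + 1 = H.rank x - 1 - k by omega] at h₁

/-- Destroying a root turns all its children into roots, where a hollow node has at most two. -/
theorem Inv.dismantle (h : H.Inv n B F kid loc) {x k : ℕ} (hsp : 0 < H.sp) (hx : H.top = x)
    (hk : (H.Full x ∧ k = H.rank x) ∨ (¬ H.Full x ∧ k = min (H.rank x) 2)) :
    ∃ loc', (H.dismantle k).Inv n B (F.erase x) kid loc' := by
  classical
  obtain ⟨p, hp⟩ : ∃ p, H.sp = p + 1 := ⟨H.sp - 1, by omega⟩
  have ht := h.stack_mem p (by omega)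
  have hs : H.stack p = x := by rw [← hx]; simp [Heap.top, hp]
  rw [hs] at ht
  have hkid : ∀ i, H.HasKid F x i ↔ H.rank x - k ≤ i ∧ i < H.rank x := fun i => by
    unfold HasKid
    grind
  have hkid' : ∀ y i, (H.dismantle k).HasKid (F.erase x) y i ↔ y ≠ x ∧ H.HasKid F y i :=
    fun y i => by simp [HasKid, Heap.dismantle, Full, and_assoc]
  have hkidne : ∀ y i, H.HasKid F y i → kid y i ≠ x := fun y i hyi he => by
    have := h.kid_mem y i hyi
    grind
  have hstack : ∀ j < p + k, (H.dismantle k).stack j =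
      if j < p then H.stack j else kid x (H.rank x - 1 - (j - p)) := fun j hj => by
    simp only [Heap.dismantle, hp, Nat.add_sub_cancel, hx]
    by_cases hjp : j < p
    · simp [hjp]
    · rw [if_pos (by omega), if_neg hjp]
      refine h.next_iterate ht.1 (by omega) ?_
      rcases hk with ⟨hf, rfl⟩ | ⟨hf, rfl⟩
      exacts [.inl hf, .inr (by omega)]
  have hkr : k ≤ H.rank x := by omega
  refine ⟨fun y => match loc y with
    | .kid x' i => if x' = x then .stack (p + (H.rank x - 1 - i)) else .kid x' i
    | q => q, ?_⟩
  refine ⟨fun y hy => h.pos y (Finset.mem_of_mem_erase hy), ?_, ?_, ?_, ?_, ?_, ?_,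
    fun y hy => h.child_eq y (Finset.mem_of_mem_erase hy), ?_,
    fun y hy => h.item_lt y (Finset.mem_of_mem_erase hy), h.node_spec, h.rank_zero⟩
  · intro j hj
    replace hj : j < p + k := by simpa [Heap.dismantle, hp] using hj
    rw [hstack j hj]
    split_ifs with hjp
    · have h₁ := h.stack_mem j (by omega)
      have h₂ : H.stack j ≠ x := fun he => by
        rw [he, ht.2] at h₁
        have := h₁.2
        cases this
        omega
      exact ⟨Finset.mem_erase.2 ⟨h₂, h₁.1⟩, by simp [h₁.2]⟩
    · have h₁ := (hkid (H.rank x - 1 - (j - p))).2 (by omega)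
      have h₂ := h.kid_mem _ _ h₁
      refine ⟨Finset.mem_erase.2 ⟨hkidne _ _ h₁, h₂.1⟩, ?_⟩
      simp only [h₂.2.1, if_true]
      congr 1
      omega
  · intro r hr hne
    have h₁ := h.table_mem r hr hne
    have h₂ : H.table r ≠ x := fun he => by grind
    exact ⟨Finset.mem_erase.2 ⟨h₂, h₁.1⟩, by simp [Heap.dismantle, h₁.2.1], h₁.2.2⟩
  · intro y i hyi
    rw [hkid'] at hyi
    have h₁ := h.kid_mem y i hyi.2
    exact ⟨Finset.mem_erase.2 ⟨hkidne _ _ hyi.2, h₁.1⟩, by simp [h₁.2.1, hyi.1], h₁.2.2⟩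
  · intro y hy j hj
    rw [Finset.mem_erase] at hy
    have hsp' : (H.dismantle k).sp = p + k := by simp [Heap.dismantle, hp]
    rw [hsp']
    cases hl : loc y with
    | stack j' =>
      simp only [hl, Place.stack.injEq] at hj
      subst hj
      have h₁ := h.loc_stack y hy.2 j' hl
      have h₂ : j' ≠ p := fun he => hy.1 (by rw [← h₁.2, he, hs])
      have h₃ : j' < p + k := by omega
      exact ⟨h₃, by rw [hstack j' h₃, if_pos (by omega), h₁.2]⟩
    | table r => simp [hl] at hj
    | kid x' i =>
      simp only [hl] at hj
      split_ifs at hj with hx'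
      subst hx'
      have h₁ := h.loc_kid y hy.2 x' i hl
      have h₂ := (hkid i).1 h₁.1
      simp only [Place.stack.injEq] at hj
      refine ⟨by omega, ?_⟩
      rw [hstack j (by omega), if_neg (by omega), ← h₁.2]
      congr 1
      omega
  · intro y hy r hr
    rw [Finset.mem_erase] at hy
    cases hl : loc y with
    | stack j' => simp [hl] at hr
    | table r' =>
      simp only [hl, Place.table.injEq] at hr
      subst hr
      exact h.loc_table y hy.2 r' hl
    | kid x' i =>
      simp only [hl] at hr
      split_ifs at hr
  · intro y hy x' i hi
    rw [Finset.mem_erase] at hy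
    cases hl : loc y with
    | stack j' => simp [hl] at hi
    | table r' => simp [hl] at hi
    | kid x'' i' =>
      simp only [hl] at hi
      split_ifs at hi with hx'
      simp only [Place.kid.injEq] at hi
      obtain ⟨rfl, rfl⟩ := hi
      have h₁ := h.loc_kid y hy.2 _ _ hl
      exact ⟨(hkid' _ _).2 ⟨hx', h₁.1⟩, h₁.2⟩
  · intro y i h₁ h₂
    rw [hkid'] at h₁ h₂
    exact h.next_eq y i h₁.2 h₂.2

theorem Inv.full_push (h : H.Inv n B F kid loc) {y : ℕ} {d : ℝ} (hy : y < n)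
    {x : ℕ} (hx : x ∈ F) : (H.push y d).Full x ↔ H.Full x ∧ x ≠ H.node y := by
  have h₁ := h.pos x hx
  have h₂ := h.node_spec y hy
  simp only [Full, Heap.push, Function.update_apply]
  rw [if_neg (show x ≠ H.size + 1 by omega)]
  by_cases hxy : H.item x = y
  · rw [if_pos hxy]
    constructor
    · intro he
      omega
    · rintro ⟨h₃, h₄⟩
      rw [hxy] at h₃
      exact absurd h₃.symm h₄
  · rw [if_neg hxy]
    refine ⟨fun he => ⟨he, fun hxn => hxy ?_⟩, fun he => he.1⟩
    rw [hxn]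
    exact (h₂ (by omega)).1

/-- A push makes at most one node hollow. The table has to be empty, since a root in the table
must stay full. -/
theorem Inv.push (h : H.Inv n B F kid loc) {y : ℕ} {d : ℝ} (hy : y < n)
    (htable : ∀ r < B, H.table r = 0)
    (hnode : H.node y = 0 ∨ (H.node y ∈ F ∧ d ≤ H.key (H.node y))) :
    ∃ kid' loc', (H.push y d).Inv n B (insert (H.size + 1) F) kid' loc' := by
  classical
  obtain ⟨g, hg⟩ : ∃ g, H.node y = g := ⟨_, rfl⟩
  obtain ⟨N, hN⟩ : ∃ N, H.size + 1 = N := ⟨_, rfl⟩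
  have hNF : N ∉ F := fun hF => by
    have := h.pos N hF
    omega
  have hne : ∀ x ∈ F, x ≠ N := fun x hx he => hNF (he ▸ hx)
  have hrN : (H.push y d).rank N = H.rank g - 2 := by simp [Heap.push, hN, hg]
  have hr : ∀ x, x ≠ N → (H.push y d).rank x = H.rank x := fun x hx => by
    simp [Heap.push, hN, hx]
  have hkN : (H.push y d).key N = d := by simp [Heap.push, hN]
  have hkey : ∀ x, x ≠ N → (H.push y d).key x = H.key x := fun x hx => by
    simp [Heap.push, hN, hx]
  have hsN : (H.push y d).stack H.sp = N := by simp [Heap.push, hN]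
  have hst : ∀ j, j ≠ H.sp → (H.push y d).stack j = H.stack j := fun j hj => by
    simp [Heap.push, hN, hj]
  have hfN : (H.push y d).Full N := by simp [Full, Heap.push, hN]
  have hf : ∀ x ∈ F, (H.push y d).Full x ↔ H.Full x ∧ x ≠ g := fun x hx => by
    rw [h.full_push hy hx, hg]
  -- The new node takes over all but two children of the old one.
  have hgkid : ∀ i, i + 2 < H.rank g → H.HasKid F g i := fun i hi => by
    rw [hg] at hnode
    rcases hnode with rfl | hnode
    · have := h.rank_zero
      omega
    · refine ⟨hnode.1, by omega, .inl ?_⟩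
      have := h.pos g hnode.1
      unfold Full
      rw [← hg, (h.node_spec y hy (by omega)).1]
  have hkidN : ∀ i, (H.push y d).HasKid (insert N F) N i ↔ i + 2 < H.rank g := fun i => by
    simp only [HasKid, hrN, hfN, Finset.mem_insert_self, true_and, true_or, and_true]
    omega
  have hkid : ∀ x ∈ F, ∀ i, (H.push y d).HasKid (insert N F) x i ↔
      H.HasKid F x i ∧ ¬ (x = g ∧ i + 2 < H.rank g) := fun x hx i => by
    simp only [HasKid, hr x (hne x hx), hf x hx, Finset.mem_insert, hx]
    grind
  have hkidF : ∀ x i, x ≠ N → (H.push y d).HasKid (insert N F) x i → x ∈ F :=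
    fun x i hx hxi => Finset.mem_of_mem_insert_of_ne hxi.1 hx
  have hchN : (H.push y d).child N = H.next (H.next (H.child g)) := by
    simp [Heap.push, hN, hg]
  have hch : ∀ x, x ≠ N → (H.push y d).child x = H.child x := fun x hx => by
    simp [Heap.push, hN, hx]
  refine ⟨fun x i => if x = N then kid g i else kid x i,
    fun z => if z = N then .stack H.sp else match loc z with
      | .kid x i => if x = g ∧ i + 2 < H.rank g then .kid N i else .kid x i
      | q => q, ?_⟩
  rw [hN]
  refine ⟨?_, ?_, ?_, ?_, ?_, ?_, ?_, ?_, ?_, ?_, ?_, ?_⟩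
  · intro x hx
    rw [Finset.mem_insert] at hx
    rcases hx with rfl | hx
    · exact ⟨by omega, by simp [Heap.push, hN]⟩
    · have := h.pos x hx
      exact ⟨this.1, by simp [Heap.push]; omega⟩
  · intro j hj
    by_cases hjs : j = H.sp
    · subst hjs
      rw [hsN]
      simp
    · have hj' : j < H.sp := by
        have : j < H.sp + 1 := hj
        omega
      rw [hst j hjs]
      have h₁ := h.stack_mem j hj'
      exact ⟨Finset.mem_insert_of_mem h₁.1, by simp [h₁.2, hne _ h₁.1]⟩
  · intro r hr' hne'
    exact absurd (htable r hr') hne'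
  · intro x i hxi
    by_cases hx : x = N
    · subst hx
      rw [hkidN] at hxi
      have h₁ := hgkid i hxi
      have h₂ := h.kid_mem g i h₁
      have h₃ := hne _ h₂.1
      simp only [if_true, h₃, if_false, h₂.2.1, hxi, and_self, hr _ h₃, hkN, hkey _ h₃]
      refine ⟨Finset.mem_insert_of_mem h₂.1, trivial, h₂.2.2.1, ?_⟩
      have := h.pos g h₁.1
      rw [hg] at hnode
      rcases hnode with h₄ | h₄
      · omega
      · exact h₄.2.trans h₂.2.2.2
    · have hxF := hkidF x i hx hxi
      rw [hkid x hxF] at hxi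
      have h₂ := h.kid_mem x i hxi.1
      have h₃ := hne _ h₂.1
      simp only [hx, h₃, if_false, h₂.2.1, hxi.2, hr _ h₃, hkey _ hx, hkey _ h₃]
      exact ⟨Finset.mem_insert_of_mem h₂.1, trivial, h₂.2.2⟩
  · intro z hz j hj
    by_cases hzN : z = N
    · subst hzN
      simp only [if_true, Place.stack.injEq] at hj
      subst hj
      exact ⟨Nat.lt_succ_self _, hsN⟩
    · have hzF := Finset.mem_of_mem_insert_of_ne hz hzN
      simp only [hzN, if_false] at hj
      cases hl : loc z with
      | stack j' =>
        simp only [hl, Place.stack.injEq] at hj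
        subst hj
        have h₁ := h.loc_stack z hzF j' hl
        exact ⟨Nat.lt_succ_of_lt h₁.1, by rw [hst _ h₁.1.ne, h₁.2]⟩
      | table r => simp [hl] at hj
      | kid x' i =>
        simp only [hl] at hj
        split_ifs at hj
  · intro z hz r hr'
    by_cases hzN : z = N
    · simp [hzN] at hr'
    · have hzF := Finset.mem_of_mem_insert_of_ne hz hzN
      simp only [hzN, if_false] at hr'
      cases hl : loc z with
      | stack j' => simp [hl] at hr'
      | table r =>
        simp only [hl, Place.table.injEq] at hr'
        subst hr'
        exact h.loc_table z hzF r hl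
      | kid x' i =>
        simp only [hl] at hr'
        split_ifs at hr'
  · intro z hz x i hxi
    by_cases hzN : z = N
    · simp [hzN] at hxi
    · have hzF := Finset.mem_of_mem_insert_of_ne hz hzN
      simp only [hzN, if_false] at hxi
      cases hl : loc z with
      | stack j' => simp [hl] at hxi
      | table r => simp [hl] at hxi
      | kid x' i' =>
        have h₁ := h.loc_kid z hzF x' i' hl
        simp only [hl] at hxi
        split_ifs at hxi with hc
        · cases hxi
          rw [hkidN]
          refine ⟨hc.2, ?_⟩
          simp only [if_true]
          rw [← hc.1, h₁.2]
        · cases hxi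
          rw [hkid _ h₁.1.1, if_neg (hne _ h₁.1.1)]
          exact ⟨⟨h₁.1, hc⟩, h₁.2⟩
  · intro x hx hrx
    by_cases hxN : x = N
    · subst hxN
      rw [hrN] at hrx ⊢
      simp only [if_true]
      rw [hchN]
      have h₁ := hgkid (H.rank g - 3) (by omega)
      have h₂ := h.next_iterate (k := 2) h₁.1 (by omega) (by
        rcases h₁.2.2 with h | h
        · exact .inl h
        · omega)
      rw [show H.rank g - 2 - 1 = H.rank g - 1 - 2 by omega, ← h₂]
      rfl
    · rw [hr x hxN] at hrx ⊢
      simp only [hxN, if_false]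
      rw [hch x hxN, h.child_eq x (Finset.mem_of_mem_insert_of_ne hx hxN) hrx]
  · intro x i h₁ h₂
    change H.next _ = _
    by_cases hxN : x = N
    · subst hxN
      rw [hkidN] at h₁ h₂
      simp only [if_true]
      exact h.next_eq g i (hgkid _ h₁) (hgkid _ h₂)
    · have hxF := hkidF x i hxN h₁
      rw [hkid x hxF] at h₁ h₂
      simp only [hxN, if_false]
      exact h.next_eq x i h₁.1 h₂.1
  · intro x hx
    by_cases hxN : x = N
    · simpa [Heap.push, hN, hxN] using hy
    · simpa [Heap.push, hN, hxN] using h.item_lt x (Finset.mem_of_mem_insert_of_ne hx hxN)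
  · intro v hv hv'
    by_cases hvy : v = y
    · simp [Heap.push, hN, hvy]
    · have h₁ : H.node v ≠ 0 := by simpa [Heap.push, hvy] using hv'
      have h₂ := h.node_spec v hv h₁
      have h₃ : H.node v ≠ N := by omega
      simp only [Heap.push, Function.update_of_ne hvy, hN, Function.update_of_ne h₃]
      exact ⟨h₂.1, by omega⟩
  · rw [hr 0 (by omega), h.rank_zero]

theorem dismantle_zero (H : Heap) : H.dismantle 0 = { H with sp := H.sp - 1 } := by
  have h : ∀ a b : ℕ, ¬ (a ≤ b ∧ b < a) := by omega
  simp only [Heap.dismantle, add_zero, h, if_false]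

theorem dismantle_succ (H : Heap) (j : ℕ) : H.dismantle (j + 1) =
    { H.dismantle j with
      stack := Function.update (H.dismantle j).stack (H.dismantle j).sp
        (H.next^[j] (H.child H.top))
      sp := (H.dismantle j).sp + 1 } := by
  simp only [Heap.dismantle, Heap.mk.injEq, true_and, and_true]
  refine ⟨?_, by omega⟩
  funext i
  simp only [Function.update_apply]
  split_ifs with h₁ h₂ h₃ h₄
  any_goals omega
  rw [h₂, Nat.add_sub_cancel_left]

/-- The number of roots in the table. -/
def tableCount (H : Heap) (B : ℕ) : ℕ := ((Finset.range B).filter fun r => H.table r ≠ 0).card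

open Classical in
/-- The number of hollow nodes that are alive. -/
noncomputable def hollowCount (H : Heap) (F : Finset ℕ) : ℕ := (F.filter fun x => ¬ H.Full x).card

theorem tableCount_place (hB : H.rank H.top < B)
    (htop : H.top ≠ 0) (h0 : H.table (H.rank H.top) = 0) :
    H.place.tableCount B = H.tableCount B + 1 := by
  have : (Finset.range B).filter (fun r => H.place.table r ≠ 0) =
      insert (H.rank H.top) ((Finset.range B).filter fun r => H.table r ≠ 0) := by
    ext r
    simp only [Heap.place, Finset.mem_filter, Finset.mem_range, Finset.mem_insert,
      Function.update_apply]
    by_cases hr : r = H.rank H.top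
    · simp [hr, hB, htop]
    · simp [hr]
  rw [tableCount, this, Finset.card_insert_of_notMem (by simp [h0])]
  rfl

theorem tableCount_link {r a b : ℕ} (hr : r < B) (h0 : H.table r ≠ 0) :
    (H.link r a b).tableCount B + 1 = H.tableCount B := by
  have : (Finset.range B).filter (fun i => (H.link r a b).table i ≠ 0) =
      ((Finset.range B).filter fun i => H.table i ≠ 0).erase r := by
    ext i
    simp only [Heap.link, Finset.mem_filter, Finset.mem_range, Finset.mem_erase,
      Function.update_apply]
    by_cases hi : i = r
    · simp [hi]
    · simp [hi]
  rw [tableCount, this, Finset.card_erase_add_one (by simp [h0, hr])]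
  rfl

theorem hollowCount_dismantle {k : ℕ} (ht : H.top ∈ F) (hf : ¬ H.Full H.top) :
    (H.dismantle k).hollowCount (F.erase H.top) + 1 = H.hollowCount F := by
  classical
  rw [hollowCount, hollowCount, Finset.filter_erase]
  exact Finset.card_erase_add_one (Finset.mem_filter.2 ⟨ht, hf⟩)

theorem hollowCount_dismantle_le {k : ℕ} {x : ℕ} :
    (H.dismantle k).hollowCount (F.erase x) ≤ H.hollowCount F := by
  classical
  exact Finset.card_le_card (Finset.filter_subset_filter _ (Finset.erase_subset _ _))

theorem Inv.hollowCount_push_le (h : H.Inv n B F kid loc) {y : ℕ} {d : ℝ} (hy : y < n) :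
    (H.push y d).hollowCount (insert (H.size + 1) F) ≤ H.hollowCount F + 1 := by
  classical
  rw [hollowCount, hollowCount]
  have : (insert (H.size + 1) F).filter (fun x => ¬ (H.push y d).Full x) ⊆
      insert (H.node y) (F.filter fun x => ¬ H.Full x) := by
    intro x hx
    rw [Finset.mem_filter, Finset.mem_insert] at hx
    rcases hx with ⟨rfl | hxF, hx⟩
    · simp [Full, Heap.push] at hx
    · rw [h.full_push hy hxF] at hx
      rw [Finset.mem_insert, Finset.mem_filter]
      tauto
  exact (Finset.card_le_card this).trans (Finset.card_insert_le _ _)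

/-- The state before the minimum is extracted: the table is empty, and the roots are full and have
a root with the least key on top. -/
structure Ready (B : ℕ) (H : Heap) : Prop where
  table : ∀ r < B, H.table r = 0
  full : ∀ j < H.sp, H.Full (H.stack j)
  min : ∀ j < H.sp, H.key H.top ≤ H.key (H.stack j)

theorem Inv.eq_empty (h : H.Inv n B F kid loc) (h' : H.Ready B) (hsp : H.sp = 0) : F = ∅ := by
  refine Finset.eq_empty_of_forall_notMem fun y hy => ?_
  obtain ⟨z, -, -, ⟨j, hj, -⟩ | ⟨r, hr, hr', -⟩⟩ := h.exists_root hy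
  · omega
  · exact hr' (h'.table r hr)

theorem Inv.key_top_le (h : H.Inv n B F kid loc) (h' : H.Ready B) {y : ℕ} (hy : y ∈ F) :
    H.key H.top ≤ H.key y := by
  obtain ⟨z, -, hz, ⟨j, hj, rfl⟩ | ⟨r, hr, hr', -⟩⟩ := h.exists_root hy
  · exact (h'.min j hj).trans hz
  · exact absurd (h'.table r hr) hr'

theorem Inv.top_mem (h : H.Inv n B F kid loc) (hsp : 0 < H.sp) : H.top ∈ F :=
  (h.stack_mem _ (by omega)).1

theorem Inv.rank_top_lt (h : H.Inv n B F kid loc) {k : ℕ} (hB : B = 2 * k) (hk : H.size < 2 ^ k)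
    (hsp : 0 < H.sp) : H.rank H.top < B := by
  have h₁ := h.stack_mem (H.sp - 1) (by omega)
  have h₂ := h.two_pow_rank_le h₁.1 (by simp [h₁.2])
  have h₃ := (Nat.pow_lt_pow_iff_right (by omega : 1 < 2)).1 (h₂.trans_lt hk)
  unfold Heap.top
  omega

/-- A reorganization of the heap: only hollow nodes are removed. -/
structure Shrink (H : Heap) (F : Finset ℕ) (H' : Heap) (F' : Finset ℕ) : Prop where
  size : H'.size = H.size
  node : H'.node = H.node
  item : H'.item = H.item
  key : H'.key = H.key
  subset : F' ⊆ F
  full : ∀ x ∈ F, H.Full x → x ∈ F'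

theorem Shrink.refl (H : Heap) (F : Finset ℕ) : Shrink H F H F :=
  ⟨rfl, rfl, rfl, rfl, subset_rfl, fun _ h _ => h⟩

theorem Shrink.trans {H₁ H₂ H₃ : Heap} {F₁ F₂ F₃ : Finset ℕ} (h : Shrink H₁ F₁ H₂ F₂)
    (h' : Shrink H₂ F₂ H₃ F₃) : Shrink H₁ F₁ H₃ F₃ :=
  ⟨h'.size.trans h.size, h'.node.trans h.node, h'.item.trans h.item, h'.key.trans h.key,
    h'.subset.trans h.subset, fun x hx hf => h'.full x (h.full x hx hf) (by
      unfold Full at *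
      rwa [h.node, h.item])⟩

end Heap

/-! ### The heap operations as programs

Registers of natural numbers: `0`, `1`, `2`, `3` hold `n`, `m`, the index of `e` and the answer;
`4`, `5`, `6` hold the constants `0`, `1`, `2`; `7` holds the bound `B` on the ranks; `8` and `9`
hold the size of the heap and the height of its stack; `10`, …, `15` are scratch; `16` and `17`
hold the vertex that is being scanned and the next of its edges. The real register `0` holds `c`,
`1` holds the distance of the vertex that is being scanned (and the threshold in the end), and the
others are scratch. Arrays of natural numbers: `0`, `1` are sources and targets; `2`, `3` are heads
and links of the adjacency lists; `4`, …, `10` are the fields of the heap in the order `node`,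
`item`, `rank`, `child`, `next`, `table`, `stack`. The arrays of reals are the weights, the
potential and the keys. -/

/-- The heap that is stored in the memory. -/
def Mem.heap (s : Mem) : Heap where
  size := s.nat 8
  node := s.natArr 4
  item := s.natArr 5
  rank := s.natArr 6
  child := s.natArr 7
  next := s.natArr 8
  table := s.natArr 9
  stack := s.natArr 10
  sp := s.nat 9
  key := s.realArr 2

/-- What a program may write to: the registers of natural numbers in `[natLo, natHi)`, the real
registers from `realLo` on, the arrays of natural numbers from `arrLo` on, and the arrays of reals
from `2` on. -/
structure Zone where
  natLo : ℕ
  natHi : ℕ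
  realLo : ℕ
  arrLo : ℕ

/-- The heap and the scratch registers. -/
abbrev heapZone : Zone := ⟨8, 16, 2, 4⟩

/-- The state `s'` agrees with `s` outside the zone. -/
structure Keep (z : Zone) (s s' : Mem) : Prop where
  nat : ∀ k, k < z.natLo ∨ z.natHi ≤ k → s'.nat k = s.nat k
  real : ∀ k < z.realLo, s'.real k = s.real k
  natArr : ∀ k < z.arrLo, s'.natArr k = s.natArr k
  realArr : ∀ k < 2, s'.realArr k = s.realArr k

theorem Keep.refl (z : Zone) (s : Mem) : Keep z s s := by constructor <;> intros <;> rfl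

theorem Keep.trans {z : Zone} {s₁ s₂ s₃ : Mem} (h : Keep z s₁ s₂) (h' : Keep z s₂ s₃) :
    Keep z s₁ s₃ :=
  ⟨fun k hk => (h'.nat k hk).trans (h.nat k hk), fun k hk => (h'.real k hk).trans (h.real k hk),
    fun k hk => (h'.natArr k hk).trans (h.natArr k hk),
    fun k hk => (h'.realArr k hk).trans (h.realArr k hk)⟩

theorem Keep.mono {z z' : Zone} {s s' : Mem} (h : Keep z s s') (h₁ : z'.natLo ≤ z.natLo)
    (h₂ : z.natHi ≤ z'.natHi) (h₃ : z'.realLo ≤ z.realLo) (h₄ : z'.arrLo ≤ z.arrLo) :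
    Keep z' s s' :=
  ⟨fun k hk => h.nat k (by omega), fun k hk => h.real k (by omega),
    fun k hk => h.natArr k (by omega), h.realArr⟩

/-- The constants `0`, `1`, `2` are in their registers. -/
structure Consts (s : Mem) : Prop where
  zero : s.nat 4 = 0
  one : s.nat 5 = 1
  two : s.nat 6 = 2

theorem Keep.consts {z : Zone} {s s' : Mem} (h : Keep z s s') (hz : 7 ≤ z.natLo) (hs : Consts s) :
    Consts s' :=
  ⟨(h.nat 4 (by omega)).trans hs.zero, (h.nat 5 (by omega)).trans hs.one,
    (h.nat 6 (by omega)).trans hs.two⟩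

/-- An instruction that writes only to the zone. -/
def Instr.Within (z : Zone) : Instr → Prop
  | .skip => True
  | .natConst x _ | .natCopy x _ | .natAdd x _ _ | .natSub x _ _ | .natLoad x _ _ =>
      z.natLo ≤ x ∧ x < z.natHi
  | .natStore A _ _ => z.arrLo ≤ A
  | .realCopy r _ | .realAdd r _ _ | .realSub r _ _ | .realLoad r _ _ => z.realLo ≤ r
  | .realStore F _ _ => 2 ≤ F

/-- A program that writes only to the zone. -/
def Prog.Within (z : Zone) : Prog → Prop
  | .instr i => i.Within z
  | .seq P Q => P.Within z ∧ Q.Within z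
  | .ite _ P Q => P.Within z ∧ Q.Within z
  | .loop _ P => P.Within z

theorem Instr.Within.keep {z : Zone} {i : Instr} (hi : i.Within z) (s : Mem) :
    Keep z s (i.run s) := by
  cases i <;> simp only [Instr.Within] at hi <;> constructor <;> intro k hk <;>
    simp only [Instr.run] <;> exact Function.update_of_ne (by omega) _ _

theorem Exec.keep {z : Zone} {P : Prog} {s s' : Mem} {t : ℕ} (h : Exec P s s' t) (hP : P.Within z) :
    Keep z s s' := by
  induction h with
  | instr i s => exact Instr.Within.keep hP s
  | seq _ _ ih₁ ih₂ => exact (ih₁ hP.1).trans (ih₂ hP.2)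
  | iteTrue _ _ ih => exact ih hP.1
  | iteFalse _ _ ih => exact ih hP.2
  | loopTrue _ _ _ ih₁ ih₂ => exact (ih₁ hP).trans (ih₂ hP)
  | loopFalse _ => exact .refl _ _

theorem WP.keep {z : Zone} {P : Prog} {s : Mem} {Q : Mem → ℕ → Prop} (hP : P.Within z)
    (h : WP P s Q) :
    WP P s fun s' t => Keep z s s' ∧ Q s' t := by
  obtain ⟨s', t, h₁, h₂⟩ := h
  exact ⟨s', t, h₁, h₁.keep hP, h₂⟩

theorem Keep.foldl {z : Zone} {l : List Instr} (hl : ∀ i ∈ l, i.Within z) (s : Mem) :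
    Keep z s (l.foldl (fun s i => i.run s) s) := by
  induction l generalizing s with
  | nil => exact .refl z s
  | cons i l ih =>
    exact ((hl i (by simp)).keep s).trans (ih (fun j hj => hl j (by simp [hj])) _)

/-- `push` for the vertex in register `11`, whose old node is in register `12`, and the key in the
real register `2`. -/
def pushProg : Prog := .block
  [.natAdd 8 8 5, .natStore 4 11 8, .natStore 5 8 11, .natLoad 13 6 12, .natSub 13 13 6,
    .natStore 6 8 13, .natLoad 13 7 12, .natLoad 13 8 13, .natLoad 13 8 13, .natStore 7 8 13,
    .realStore 2 8 2, .natStore 10 9 8, .natAdd 9 9 5]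

theorem wp_pushProg {s : Mem} (hs : Consts s) (h : s.nat 12 = s.natArr 4 (s.nat 11)) :
    WP pushProg s fun s' t => Keep heapZone s s' ∧ s'.heap = s.heap.push (s.nat 11) (s.real 2) ∧
      s'.nat 10 = s.nat 10 ∧ t = 14 := by
  refine WP.keep (by simp [pushProg, Prog.block, Prog.Within, Instr.Within])
    (WP.block _ _ ⟨?_, ?_, rfl⟩)
  · simp [Instr.run, Mem.heap, Heap.push, hs.one, hs.two, h]
  · simp [Instr.run]

/-- `dismantle` for the top of the stack, in register `11`, and the number of children in register
`12`. -/
def dismantleProg : Prog :=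
  .seq (.block [.natSub 9 9 5, .natLoad 13 7 11])
    (.loop (.natLt 4 12)
      (.block [.natStore 10 9 13, .natAdd 9 9 5, .natLoad 13 8 13, .natSub 12 12 5]))

theorem wp_dismantleProg {s : Mem} (hs : Consts s) (h : s.nat 11 = s.heap.top) :
    WP dismantleProg s fun s' t => s'.heap = s.heap.dismantle (s.nat 12) ∧ Keep heapZone s s' ∧
      t ≤ 6 * s.nat 12 + 4 := by
  refine WP.seq (WP.block _ _ ?_)
  have key := WP.loop (P := .block [.natStore 10 9 13, .natAdd 9 9 5, .natLoad 13 8 13,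
      .natSub 12 12 5]) (b := .natLt 4 12)
    (fun j s' => j ≤ s.nat 12 ∧ s'.nat 12 = s.nat 12 - j ∧ s'.heap = s.heap.dismantle j ∧
      s'.nat 13 = s.heap.next^[j] (s.heap.child s.heap.top) ∧ Keep heapZone s s')
    (fun j => 6 * (s.nat 12 - j)) ?_ (a := 0)
    (s := [Instr.natSub 9 9 5, Instr.natLoad 13 7 11].foldl (fun s i => i.run s) s) ?_
  · refine key.mono fun s' t ⟨j, ⟨h₁, h₂, h₃, h₄, h₅⟩, h₆, h₇⟩ => ?_
    have : j = s.nat 12 := by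
      have := (h₅.consts (by decide) hs).zero
      simp only [Test.Holds] at h₆
      omega
    subst this
    refine ⟨h₃, h₅, ?_⟩
    simp only [List.length]
    omega
  · rintro j s' ⟨h₁, h₂, h₃, h₄, h₅⟩ h₆
    have hs' := h₅.consts (by decide) hs
    simp only [Test.Holds, hs'.zero] at h₆
    refine WP.block _ _ ⟨j + 1, ⟨by omega, ?_, ?_, ?_, ?_⟩, ?_⟩
    · simp [Instr.run, hs'.one, h₂]
      omega
    · have h₇ : ∀ H : Heap, s'.heap = H → H.sp = s'.nat 9 ∧ H.stack = s'.natArr 10 :=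
        fun H hH => by subst hH; exact ⟨rfl, rfl⟩
      rw [Heap.dismantle_succ, ← h₄, (h₇ _ h₃).1, (h₇ _ h₃).2, ← h₃]
      simp [Instr.run, Mem.heap, hs'.one]
    · have h₇ : s'.natArr 8 = s.heap.next := by
        change s'.heap.next = _
        rw [h₃]; rfl
      rw [Function.iterate_succ_apply', ← h₄, ← h₇]
      simp [Instr.run]
    · exact h₅.trans (Keep.foldl (by simp [Instr.Within]) _)
    · simp only [List.length]
      omega
  · refine ⟨by omega, ?_, ?_, ?_, Keep.foldl (by simp [Instr.Within]) _⟩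
    · simp [Instr.run]
    · rw [Heap.dismantle_zero]
      simp [Instr.run, Mem.heap, hs.one]
    · simp [Instr.run, h]
      rfl

/-- The top of the stack is destroyed if it is hollow, moved to the table if its rank is free there,
and otherwise linked with the root of the same rank. -/
def consolidateStep : Prog :=
  .seq (.block [.natSub 11 9 5, .natLoad 11 10 11, .natLoad 12 5 11, .natLoad 13 4 12])
    (.ite (.natEq 13 11)
      (.seq (.block [.natLoad 12 6 11, .natLoad 13 9 12])
        (.ite (.natEq 13 4)
          (.block [.natStore 9 12 11, .natSub 9 9 5])
          (.seq (.block [.realLoad 2 2 11, .realLoad 3 2 13])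
            (.seq
              (.ite (.realLt 3 2) (.block [.natCopy 14 11, .natCopy 11 13, .natCopy 13 14])
                (.block []))
              (.block [.natLoad 14 7 11, .natStore 8 13 14, .natStore 7 11 13, .natAdd 14 12 5,
                .natStore 6 11 14, .natStore 9 12 4, .natSub 14 9 5, .natStore 10 14 11])))))
      (.seq (.block [.natLoad 12 6 11])
        (.seq (.ite (.natLt 6 12) (.block [.natCopy 12 6]) (.block [])) dismantleProg)))

theorem wp_consolidateStep {s : Mem} (hs : Consts s) :
    WP consolidateStep s fun s' t => Keep heapZone s s' ∧ t ≤ 30 ∧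
      ((s.heap.Full s.heap.top ∧ s.heap.table (s.heap.rank s.heap.top) = 0 ∧
          s'.heap = s.heap.place) ∨
        (s.heap.Full s.heap.top ∧ s.heap.table (s.heap.rank s.heap.top) ≠ 0 ∧
          ∃ a b, ((a = s.heap.top ∧ b = s.heap.table (s.heap.rank s.heap.top)) ∨
              (b = s.heap.top ∧ a = s.heap.table (s.heap.rank s.heap.top))) ∧
            s.heap.key a ≤ s.heap.key b ∧ s'.heap = s.heap.link (s.heap.rank s.heap.top) a b) ∨
        (¬ s.heap.Full s.heap.top ∧
          s'.heap = s.heap.dismantle (min (s.heap.rank s.heap.top) 2))) := by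
  refine WP.keep (by simp [consolidateStep, dismantleProg, Prog.block, Prog.Within,
    Instr.Within]) (WP.seq (WP.block _ _ (WP.ite (fun h => ?_) (fun h => ?_))))
  · have hfull : s.heap.Full s.heap.top := by
      simpa [Test.Holds, Instr.run, hs.one, Heap.Full, Heap.top, Mem.heap] using h
    refine WP.seq (WP.block _ _ (WP.ite (fun h' => WP.block _ _ ?_) (fun h' => ?_)))
    · have h0 : s.heap.table (s.heap.rank s.heap.top) = 0 := by
        simpa [Test.Holds, Instr.run, hs.one, hs.zero, Heap.top, Mem.heap] using h'
      refine ⟨by simp, .inl ⟨hfull, h0, ?_⟩⟩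
      · simp [Instr.run, Mem.heap, Heap.place, Heap.top, hs.one]
    · have h0 : s.heap.table (s.heap.rank s.heap.top) ≠ 0 := by
        simpa [Test.Holds, Instr.run, hs.one, hs.zero, Heap.top, Mem.heap] using h'
      refine WP.seq (WP.block _ _ (WP.seq (WP.ite (fun h'' => WP.block _ _ (WP.block _ _ ?_))
        (fun h'' => WP.block _ _ (WP.block _ _ ?_)))))
      · refine ⟨by simp, .inr (.inl ⟨hfull, h0, _, _, .inr ⟨rfl, rfl⟩, ?_, ?_⟩)⟩
        · simpa [Test.Holds, Instr.run, hs.one, Heap.top, Mem.heap] using h''.le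
        · simp [Instr.run, Mem.heap, Heap.link, Heap.top, hs.one, hs.zero]
      · refine ⟨by simp, .inr (.inl ⟨hfull, h0, _, _, .inl ⟨rfl, rfl⟩, ?_, ?_⟩)⟩
        · simpa [Test.Holds, Instr.run, hs.one, Heap.top, Mem.heap] using h''
        · simp [Instr.run, Mem.heap, Heap.link, Heap.top, hs.one, hs.zero]
  · have hfull : ¬ s.heap.Full s.heap.top := by
      simpa [Test.Holds, Instr.run, hs.one, Heap.Full, Heap.top, Mem.heap] using h
    refine WP.seq (WP.block _ _ (WP.seq (WP.mono (Q := fun s' t => Consts s' ∧ t ≤ 3 ∧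
      s'.heap = s.heap ∧ s'.nat 11 = s.heap.top ∧ s'.nat 12 = min (s.heap.rank s.heap.top) 2)
      (WP.ite (fun h' => WP.block _ _ ?_) (fun h' => WP.block _ _ ?_)) ?_)))
    · have h0 : 2 < s.heap.rank s.heap.top := by
        simpa [Test.Holds, Instr.run, hs.one, hs.two, Heap.top, Mem.heap] using h'
      refine ⟨⟨by simp [Instr.run, hs.zero], by simp [Instr.run, hs.one],
        by simp [Instr.run, hs.two]⟩, by simp, ?_, ?_, ?_⟩
      · simp [Instr.run, Mem.heap]
      · simp [Instr.run, Mem.heap, Heap.top, hs.one]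
      · rw [min_eq_right h0.le]
        simp [Instr.run, hs.two]
    · have h0 : s.heap.rank s.heap.top ≤ 2 := by
        simpa [Test.Holds, Instr.run, hs.one, hs.two, Heap.top, Mem.heap] using h'
      refine ⟨⟨by simp [Instr.run, hs.zero], by simp [Instr.run, hs.one],
        by simp [Instr.run, hs.two]⟩, by simp, ?_, ?_, ?_⟩
      · simp [Instr.run, Mem.heap]
      · simp [Instr.run, Mem.heap, Heap.top, hs.one]
      · rw [min_eq_left h0]
        simp [Instr.run, Mem.heap, Heap.top, hs.one]
    · rintro s' t ⟨h₁, h₂, h₃, h₄, h₅⟩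
      refine (wp_dismantleProg h₁ (by rw [h₄, h₃])).mono ?_
      rintro s'' t' ⟨h₆, h₇, h₈⟩
      refine ⟨?_, .inr (.inr ⟨hfull, ?_⟩)⟩
      · have : s'.nat 12 ≤ 2 := by omega
        simp only [List.length]
        omega
      · rw [h₆, h₃, h₅]

/-- Empty the stack, so that all the roots are in the table, full and of different ranks. -/
def consolidate : Prog := .loop (.natLt 4 9) consolidateStep

/-- Each step of the consolidation takes constant time and lowers the potential
`2 sp + tableCount + 3 hollowCount`. -/
theorem wp_consolidate {n B k : ℕ} {s : Mem} {F : Finset ℕ} {kid : ℕ → ℕ → ℕ} {loc : ℕ → Place}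
    (hs : Consts s) (h : s.heap.Inv n B F kid loc) (hB : B = 2 * k) (hk : s.heap.size < 2 ^ k) :
    WP consolidate s fun s' t => ∃ F' kid' loc', s'.heap.Inv n B F' kid' loc' ∧ s'.heap.sp = 0 ∧
      Heap.Shrink s.heap F s'.heap F' ∧ Keep heapZone s s' ∧
      t + 120 * s'.heap.hollowCount F' ≤
        40 * (2 * s.heap.sp + s.heap.tableCount B + 3 * s.heap.hollowCount F) + 1 := by
  have key := WP.loop (b := .natLt 4 9) (P := consolidateStep)
    (α := Mem × Finset ℕ)
    (fun a s' => a.1 = s' ∧ (∃ kid' loc', s'.heap.Inv n B a.2 kid' loc') ∧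
      Heap.Shrink s.heap F s'.heap a.2 ∧ Keep heapZone s s')
    (fun a => 40 * (2 * a.1.heap.sp + a.1.heap.tableCount B + 3 * a.1.heap.hollowCount a.2))
    ?_ (a := (s, F)) (s := s) ⟨rfl, ⟨kid, loc, h⟩, .refl _ _, .refl _ _⟩
  · refine key.mono ?_
    rintro s' t ⟨⟨s'', F'⟩, ⟨rfl : s'' = s', ⟨kid', loc', h₁⟩, h₂, h₃⟩, h₄, h₅⟩
    refine ⟨F', kid', loc', h₁, ?_, h₂, h₃, by dsimp only at h₁ h₂ h₅ ⊢; omega⟩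
    simp only [Test.Holds, (h₃.consts (by decide) hs).zero] at h₄
    simp only [Mem.heap]
    omega
  · rintro ⟨s₁, F₁⟩ s₂ ⟨rfl : s₁ = s₂, ⟨kid₁, loc₁, h₁⟩, h₂, h₃⟩ h₄
    dsimp only at h₁ h₂
    have hs₁ := h₃.consts (by decide) hs
    have hsp : 0 < s₁.heap.sp := by
      change 0 < s₁.nat 9
      simpa [Test.Holds, hs₁.zero] using h₄
    have hmem := h₁.top_mem hsp
    have hrank := h₁.rank_top_lt hB (by rw [h₂.size]; exact hk) hsp
    have hpos := (h₁.pos _ hmem).1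
    refine (wp_consolidateStep hs₁).mono ?_
    rintro s' t ⟨h₅, h₆, ⟨hf, h0, he⟩ | ⟨hf, h0, a, b, hab, hkey, he⟩ | ⟨hf, he⟩⟩
    · obtain ⟨loc', h₇⟩ := h₁.place hsp hrank hf h0
      refine ⟨(s', F₁), ⟨rfl, ⟨kid₁, loc', he ▸ h₇⟩, h₂.trans ?_, h₃.trans h₅⟩, ?_⟩
      · rw [he]
        exact ⟨rfl, rfl, rfl, rfl, subset_rfl, fun _ h _ => h⟩
      · have h₈ := Heap.tableCount_place hrank (by omega) h0
        have h₉ : s₁.heap.place.hollowCount F₁ = s₁.heap.hollowCount F₁ := rfl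
        have h₁₀ : s₁.heap.place.sp = s₁.heap.sp - 1 := rfl
        simp only [he]
        omega
    · obtain ⟨kid', loc', h₇⟩ := h₁.link hsp hrank hab rfl hf h0 hkey
      refine ⟨(s', F₁), ⟨rfl, ⟨kid', loc', he ▸ h₇⟩, h₂.trans ?_, h₃.trans h₅⟩, ?_⟩
      · rw [he]
        exact ⟨rfl, rfl, rfl, rfl, subset_rfl, fun _ h _ => h⟩
      · have h₈ := Heap.tableCount_link (a := a) (b := b) hrank h0
        have h₉ : (s₁.heap.link (s₁.heap.rank s₁.heap.top) a b).hollowCount F₁ =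
          s₁.heap.hollowCount F₁ := rfl
        have h₁₀ : (s₁.heap.link (s₁.heap.rank s₁.heap.top) a b).sp = s₁.heap.sp := rfl
        simp only [he]
        omega
    · obtain ⟨loc', h₇⟩ := h₁.dismantle hsp rfl (.inr ⟨hf, rfl⟩)
      refine ⟨(s', F₁.erase s₁.heap.top), ⟨rfl, ⟨kid₁, loc', he ▸ h₇⟩, h₂.trans ?_,
        h₃.trans h₅⟩, ?_⟩
      · rw [he]
        exact ⟨rfl, rfl, rfl, rfl, Finset.erase_subset _ _,
          fun x hx hfx => Finset.mem_erase.2 ⟨fun hxt => hf (hxt ▸ hfx), hx⟩⟩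
      · have h₈ := Heap.hollowCount_dismantle (k := min (s₁.heap.rank s₁.heap.top) 2) hmem hf
        have h₉ : (s₁.heap.dismantle (min (s₁.heap.rank s₁.heap.top) 2)).tableCount B =
          s₁.heap.tableCount B := rfl
        have h₁₀ : (s₁.heap.dismantle (min (s₁.heap.rank s₁.heap.top) 2)).sp =
          s₁.heap.sp - 1 + min (s₁.heap.rank s₁.heap.top) 2 := rfl
        simp only [he]
        omega

/-- `unplaceTop` for the rank in register `10`, whose root is in register `11`. -/
def unplaceTopProg : Prog := .block [.natStore 10 9 11, .natAdd 9 9 5, .natStore 9 10 4]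

/-- Move the table entry of the rank in register `10` to the stack, on top if its key is below that
of the top. -/
def scanStep : Prog :=
  .seq (.block [.natLoad 11 9 10])
    (.seq
      (.ite (.natEq 11 4) (.block [])
        (.ite (.natEq 9 4) unplaceTopProg
          (.seq (.block [.natSub 12 9 5, .natLoad 13 10 12, .realLoad 2 2 11, .realLoad 3 2 13])
            (.ite (.realLt 2 3) unplaceTopProg
              (.block [.natStore 10 9 13, .natStore 10 12 11, .natAdd 9 9 5,
                .natStore 9 10 4])))))
      (.block [.natAdd 10 10 5]))

theorem wp_scanStep {s : Mem} {r : ℕ} (hs : Consts s) (hr : s.nat 10 = r) :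
    WP scanStep s fun s' t => Keep heapZone s s' ∧ t ≤ 20 ∧ s'.nat 10 = r + 1 ∧
      ((s.heap.table r = 0 ∧ s'.heap = s.heap) ∨
        (s.heap.table r ≠ 0 ∧
          (s.heap.sp = 0 ∨ s.heap.key (s.heap.table r) < s.heap.key s.heap.top) ∧
          s'.heap = s.heap.unplaceTop r) ∨
        (s.heap.table r ≠ 0 ∧ s.heap.sp ≠ 0 ∧
          s.heap.key s.heap.top ≤ s.heap.key (s.heap.table r) ∧
          s'.heap = s.heap.unplaceBelow r)) := by
  subst hr
  refine WP.keep (by simp [scanStep, unplaceTopProg, Prog.block, Prog.Within, Instr.Within])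
    (WP.seq (WP.block _ _ (WP.seq (WP.ite (fun h => WP.block _ _ (WP.block _ _ ?_))
      (fun h => WP.ite (fun h₁ => WP.block _ _ (WP.block _ _ ?_))
        (fun h₁ => WP.seq (WP.block _ _ (WP.ite (fun h₂ => WP.block _ _ (WP.block _ _ ?_))
          (fun h₂ => WP.block _ _ (WP.block _ _ ?_))))))))))
  · refine ⟨by simp, by simp [Instr.run, hs.one], .inl ⟨?_, ?_⟩⟩
    · simpa [Test.Holds, Instr.run, hs.zero, Mem.heap] using h
    · simp [Instr.run, Mem.heap]
  · refine ⟨by simp, by simp [Instr.run, hs.one], .inr (.inl ⟨?_, .inl ?_, ?_⟩)⟩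
    · simpa [Test.Holds, Instr.run, hs.zero, Mem.heap] using h
    · simpa [Test.Holds, Instr.run, hs.zero, Mem.heap] using h₁
    · simp [Instr.run, Mem.heap, Heap.unplaceTop, hs.one, hs.zero]
  · refine ⟨by simp, by simp [Instr.run, hs.one], .inr (.inl ⟨?_, .inr ?_, ?_⟩)⟩
    · simpa [Test.Holds, Instr.run, hs.zero, Mem.heap] using h
    · simpa [Test.Holds, Instr.run, hs.one, Mem.heap, Heap.top] using h₂
    · simp [Instr.run, Mem.heap, Heap.unplaceTop, hs.one, hs.zero]
  · refine ⟨by simp, by simp [Instr.run, hs.one], .inr (.inr ⟨?_, ?_, ?_, ?_⟩)⟩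
    · simpa [Test.Holds, Instr.run, hs.zero, Mem.heap] using h
    · simpa [Test.Holds, Instr.run, hs.zero, Mem.heap] using h₁
    · simpa [Test.Holds, Instr.run, hs.one, Mem.heap, Heap.top] using h₂
    · simp [Instr.run, Mem.heap, Heap.unplaceBelow, Heap.top, hs.one, hs.zero]

/-- Move the roots from the table back to the stack, with a minimal one on top. -/
def scan : Prog := .seq (.block [.natConst 10 0]) (.loop (.natLt 10 7) scanStep)

/-- After the ranks below `r` have been scanned, the roots on the stack are full and there is a
minimal one on top. -/
structure ScanInv (r : ℕ) (H : Heap) : Prop where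
  table : ∀ i < r, H.table i = 0
  full : ∀ j < H.sp, H.Full (H.stack j)
  min : ∀ j < H.sp, H.key H.top ≤ H.key (H.stack j)
  sp_le : H.sp ≤ r

theorem ScanInv.skip {r : ℕ} {H : Heap} (h : ScanInv r H) (h0 : H.table r = 0) :
    ScanInv (r + 1) H := by
  refine ⟨fun i hi => ?_, h.full, h.min, h.sp_le.trans (by omega)⟩
  rcases Nat.lt_succ_iff_lt_or_eq.1 hi with hi | rfl
  exacts [h.table i hi, h0]

theorem ScanInv.unplaceTop {r : ℕ} {H : Heap} (h : ScanInv r H) (hf : H.Full (H.table r))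
    (hkey : H.sp = 0 ∨ H.key (H.table r) < H.key H.top) : ScanInv (r + 1) (H.unplaceTop r) := by
  have htop : (H.unplaceTop r).top = H.table r := by simp [Heap.top, Heap.unplaceTop]
  have hst : ∀ j, (H.unplaceTop r).stack j = if j = H.sp then H.table r else H.stack j :=
    fun j => by simp [Heap.unplaceTop, Function.update_apply]
  refine ⟨fun i hi => ?_, fun j (hj : j < H.sp + 1) => ?_, fun j (hj : j < H.sp + 1) => ?_,
    Nat.succ_le_succ h.sp_le⟩
  · have := h.table i
    simp only [Heap.unplaceTop, Function.update_apply]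
    split_ifs
    · rfl
    · exact this (by omega)
  · rw [hst]
    split_ifs
    exacts [hf, h.full j (by omega)]
  · rw [htop, hst]
    split_ifs
    · exact le_rfl
    · have := h.min j (by omega)
      rcases hkey with h₁ | h₁
      · omega
      · exact h₁.le.trans this

theorem ScanInv.unplaceBelow {r : ℕ} {H : Heap} (h : ScanInv r H) (hf : H.Full (H.table r))
    (hsp : H.sp ≠ 0) (hkey : H.key H.top ≤ H.key (H.table r)) :
    ScanInv (r + 1) (H.unplaceBelow r) := by
  have hst : ∀ j, (H.unplaceBelow r).stack j =
      if j = H.sp - 1 then H.table r else if j = H.sp then H.top else H.stack j :=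
    fun j => by simp [Heap.unplaceBelow, Function.update_apply]
  have htop : (H.unplaceBelow r).top = H.top := by
    change (H.unplaceBelow r).stack (H.sp + 1 - 1) = _
    rw [hst, if_neg (by omega), if_pos (by omega)]
  refine ⟨fun i hi => ?_, fun j (hj : j < H.sp + 1) => ?_, fun j (hj : j < H.sp + 1) => ?_,
    Nat.succ_le_succ h.sp_le⟩
  · have := h.table i
    simp only [Heap.unplaceBelow, Function.update_apply]
    split_ifs
    · rfl
    · exact this (by omega)
  · rw [hst]
    split_ifs
    exacts [hf, h.full _ (by omega), h.full j (by omega)]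
  · rw [htop, hst]
    split_ifs
    exacts [hkey, le_rfl, h.min j (by omega)]

theorem wp_scan {n B : ℕ} {s : Mem} {F : Finset ℕ} {kid : ℕ → ℕ → ℕ} {loc : ℕ → Place}
    (hs : Consts s) (h : s.heap.Inv n B F kid loc) (hB : s.nat 7 = B) (hsp : s.heap.sp = 0) :
    WP scan s fun s' t => ∃ loc', s'.heap.Inv n B F kid loc' ∧ s'.heap.Ready B ∧
      s'.heap.sp ≤ B ∧ Heap.Shrink s.heap F s'.heap F ∧ Keep heapZone s s' ∧
      s'.heap.hollowCount F = s.heap.hollowCount F ∧ t ≤ 21 * B + 3 := by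
  refine WP.seq (WP.block _ _ ?_)
  have key := WP.loop (b := .natLt 10 7) (P := scanStep)
    (fun r s' => s'.nat 10 = r ∧ r ≤ B ∧ (∃ loc', s'.heap.Inv n B F kid loc') ∧
      ScanInv r s'.heap ∧ Heap.Shrink s.heap F s'.heap F ∧ Keep heapZone s s' ∧
      s'.heap.hollowCount F = s.heap.hollowCount F)
    (fun r => 21 * (B - r))
    ?_ (a := 0) (s := [Instr.natConst 10 0].foldl (fun s i => i.run s) s) ?_
  · refine key.mono ?_
    rintro s' t ⟨r, ⟨h₁, h₂, ⟨loc', h₃⟩, h₄, h₅, h₆, h₇⟩, h₈, h₉⟩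
    have hr : r = B := by
      have := h₆.nat 7 (by decide)
      simp only [Test.Holds] at h₈
      omega
    subst hr
    refine ⟨loc', h₃, ⟨h₄.table, h₄.full, h₄.min⟩, h₄.sp_le, h₅, h₆, h₇, ?_⟩
    simp only [List.length]
    omega
  · rintro r s₁ ⟨h₁, h₂, ⟨loc₁, h₃⟩, h₄, h₅, h₆, h₇⟩ h₈
    have hr : r < B := by
      have := h₆.nat 7 (by decide)
      simp only [Test.Holds] at h₈
      omega
    refine (wp_scanStep (h₆.consts (by decide) hs) h₁).mono ?_
    rintro s' t ⟨g₁, g₂, g₃, ⟨h0, he⟩ | ⟨h0, hkey, he⟩ | ⟨h0, hsp', hkey, he⟩⟩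
    · exact ⟨r + 1, ⟨g₃, hr, ⟨loc₁, he ▸ h₃⟩, he ▸ h₄.skip h0, he ▸ h₅, h₆.trans g₁, he ▸ h₇⟩,
        by omega⟩
    · have hf := (h₃.table_mem r hr h0).2.2.2
      obtain ⟨loc', h₉⟩ := h₃.unplaceTop hr h0
      refine ⟨r + 1, ⟨g₃, hr, ⟨loc', he ▸ h₉⟩, he ▸ h₄.unplaceTop hf hkey, ?_, h₆.trans g₁, ?_⟩,
        by omega⟩
      · rw [he]
        exact h₅.trans ⟨rfl, rfl, rfl, rfl, subset_rfl, fun _ h _ => h⟩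
      · rw [he]
        exact h₇
    · have hf := (h₃.table_mem r hr h0).2.2.2
      obtain ⟨loc', h₉⟩ := h₃.unplaceBelow (by omega) hr h0
      refine ⟨r + 1, ⟨g₃, hr, ⟨loc', he ▸ h₉⟩, he ▸ h₄.unplaceBelow hf hsp' hkey, ?_,
        h₆.trans g₁, ?_⟩, by omega⟩
      · rw [he]
        exact h₅.trans ⟨rfl, rfl, rfl, rfl, subset_rfl, fun _ h _ => h⟩
      · rw [he]
        exact h₇
  · have hH : ([Instr.natConst 10 0].foldl (fun s i => i.run s) s).heap = s.heap := by
      simp [Instr.run, Mem.heap]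
    refine ⟨by simp [Instr.run], by omega, ⟨loc, hH ▸ h⟩, ?_, hH ▸ .refl _ _,
      Keep.foldl (by simp [Instr.Within]) _, by rw [hH]⟩
    rw [hH]
    constructor <;> intros <;> omega

/-- Preparing the next extraction takes amortized time `O(B)`: the potential that is released pays
for the consolidation, and the scan visits each rank once. -/
theorem wp_extract {n B k : ℕ} {s : Mem} {F : Finset ℕ} {kid : ℕ → ℕ → ℕ} {loc : ℕ → Place}
    (hs : Consts s) (h : s.heap.Inv n B F kid loc) (hB : B = 2 * k) (hk : s.heap.size < 2 ^ k)
    (hB' : s.nat 7 = B) :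
    WP (.seq consolidate scan) s fun s' t => ∃ F' kid' loc', s'.heap.Inv n B F' kid' loc' ∧
      s'.heap.Ready B ∧ s'.heap.sp ≤ B ∧ Heap.Shrink s.heap F s'.heap F' ∧ Keep heapZone s s' ∧
      t + 120 * s'.heap.hollowCount F' ≤
        40 * (2 * s.heap.sp + s.heap.tableCount B + 3 * s.heap.hollowCount F) + 21 * B + 4 := by
  refine WP.seq ((wp_consolidate hs h hB hk).mono ?_)
  rintro s₁ t₁ ⟨F₁, kid₁, loc₁, h₁, h₂, h₃, h₄, h₅⟩
  refine (wp_scan (h₄.consts (by decide) hs) h₁ ((h₄.nat 7 (by decide)).trans hB') h₂).mono ?_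
  rintro s₂ t₂ ⟨loc₂, g₁, g₂, g₃, g₄, g₅, g₆, g₇⟩
  exact ⟨F₁, kid₁, loc₂, g₁, g₂, g₃, h₃.trans g₄, h₄.trans g₅, by omega⟩

/-! ### The search for shortest paths -/

/-- The graph as it is stored: `n` vertices and `m` edges with nonnegative lengths. -/
structure Network where
  n : ℕ
  m : ℕ
  src : ℕ → ℕ
  tgt : ℕ → ℕ
  len : ℕ → ℝ
  src_lt : ∀ i < m, src i < n
  tgt_lt : ∀ i < m, tgt i < n
  len_nonneg : ∀ i < m, 0 ≤ len i

/-- There is a path of length `d` from `v` to `x`. -/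
inductive Network.Reach (N : Network) (v : ℕ) : ℕ → ℝ → Prop
  | refl : N.Reach v v 0
  | step {d : ℝ} {i : ℕ} : i < N.m → N.Reach v (N.src i) d → N.Reach v (N.tgt i) (d + N.len i)

/-- `i + 1` for the last edge `i` among the first `k` that has the source `x`, and `0` if there is
none. -/
def lastEdge (src : ℕ → ℕ) (x : ℕ) : ℕ → ℕ
  | 0 => 0
  | k + 1 => if src k = x then k + 1 else lastEdge src x k

theorem lastEdge_eq_zero {src : ℕ → ℕ} {x k : ℕ} (h : lastEdge src x k = 0) :
    ∀ i < k, src i ≠ x := by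
  induction k with
  | zero => omega
  | succ k ih =>
    intro i hi
    rw [lastEdge] at h
    split_ifs at h with hk
    rcases Nat.lt_succ_iff_lt_or_eq.1 hi with hi | rfl
    exacts [ih h i hi, hk]

theorem lastEdge_eq_succ {src : ℕ → ℕ} {x k i : ℕ} (h : lastEdge src x k = i + 1) :
    i < k ∧ src i = x ∧ ∀ j, i < j → j < k → src j ≠ x := by
  induction k with
  | zero => simp [lastEdge] at h
  | succ k ih =>
    rw [lastEdge] at h
    split_ifs at h with hk
    · obtain rfl : k = i := by omega
      exact ⟨by omega, hk, fun j _ _ => by omega⟩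
    · obtain ⟨h₁, h₂, h₃⟩ := ih h
      refine ⟨by omega, h₂, fun j hj hjk => ?_⟩
      rcases Nat.lt_succ_iff_lt_or_eq.1 hjk with hj' | rfl
      exacts [h₃ j hj hj', hk]

/-- The vertex `x` has been extracted from the heap. -/
def Settled (H : Heap) (F : Finset ℕ) (x : ℕ) : Prop := H.node x ≠ 0 ∧ H.node x ∉ F

open Classical in
/-- The number of vertices that are not settled. -/
noncomputable def unsettled (N : Network) (H : Heap) (F : Finset ℕ) : ℕ :=
  ((Finset.range N.n).filter fun x => ¬ Settled H F x).card

open Classical in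
/-- The number of edges that have not been relaxed, when `u` is being scanned and the edges from
`u` with an index below `k` are left. -/
noncomputable def pending (N : Network) (H : Heap) (F : Finset ℕ) (u k : ℕ) : ℕ :=
  ((Finset.range N.m).filter fun i => ¬ Settled H F (N.src i) ∨ (N.src i = u ∧ i < k)).card

/-- The invariant of Dijkstra's algorithm. The tentative distance of a vertex is the key of its
current node. The vertex `u` is being scanned, and its edges with an index below `k` are left. -/
structure Search (N : Network) (v : ℕ) (H : Heap) (F : Finset ℕ) (u k : ℕ) : Prop where
  source : H.node v ≠ 0 ∧ H.key (H.node v) ≤ 0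
  reach : ∀ x < N.n, H.node x ≠ 0 → N.Reach v x (H.key (H.node x))
  relaxed : ∀ i < N.m, Settled H F (N.src i) → ¬ (N.src i = u ∧ i < k) →
    H.node (N.tgt i) ≠ 0 ∧ H.key (H.node (N.tgt i)) ≤ H.key (H.node (N.src i)) + N.len i
  order : ∀ x < N.n, Settled H F x → ∀ y ∈ F, H.key (H.node x) ≤ H.key y
  current : 0 < k → Settled H F u ∧ ∀ x < N.n, Settled H F x → H.key (H.node x) ≤ H.key (H.node u)
  /-- Each edge is relaxed once and creates at most one node. -/
  count : H.size + pending N H F u k ≤ N.m + 1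

section Search

variable {N : Network} {v B : ℕ} {H H' : Heap} {F F' : Finset ℕ} {kid : ℕ → ℕ → ℕ}
  {loc : ℕ → Place} {u k : ℕ}

theorem pending_congr (h : ∀ x < N.n, (Settled H' F' x ↔ Settled H F x)) :
    pending N H' F' u k = pending N H F u k := by
  classical
  rw [pending, pending]
  congr 1
  refine Finset.filter_congr fun i hi => ?_
  rw [h _ (N.src_lt i (Finset.mem_range.1 hi))]

theorem unsettled_congr (h : ∀ x < N.n, (Settled H' F' x ↔ Settled H F x)) :
    unsettled N H' F' = unsettled N H F := by
  classical
  rw [unsettled, unsettled]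
  congr 1
  refine Finset.filter_congr fun i hi => ?_
  rw [h _ (Finset.mem_range.1 hi)]

theorem settled_shrink (hi : H.Inv N.n B F kid loc) (hs : Heap.Shrink H F H' F') :
    ∀ x < N.n, (Settled H' F' x ↔ Settled H F x) := by
  intro x hx
  unfold Settled
  rw [hs.node]
  refine and_congr_right fun h0 => not_congr ⟨fun h => hs.subset h, fun h => hs.full _ h ?_⟩
  unfold Heap.Full
  rw [(hi.node_spec x hx h0).1]

theorem Search.shrink (h : Search N v H F u k) (hi : H.Inv N.n B F kid loc) (hu : u < N.n)
    (hs : Heap.Shrink H F H' F') : Search N v H' F' u k := by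
  have hset := settled_shrink hi hs
  refine ⟨?_, ?_, ?_, ?_, ?_, ?_⟩
  · rw [hs.node, hs.key]
    exact h.source
  · rw [hs.node, hs.key]
    exact h.reach
  · intro i hi'
    rw [hset _ (N.src_lt i hi'), hs.node, hs.key]
    exact h.relaxed i hi'
  · intro x hx
    rw [hset x hx, hs.node, hs.key]
    exact fun hsx y hy => h.order x hx hsx y (hs.subset hy)
  · intro hk
    rw [hset u hu, hs.node, hs.key]
    refine ⟨(h.current hk).1, fun x hx => ?_⟩
    rw [hset x hx]
    exact (h.current hk).2 x hx
  · rw [hs.size, pending_congr hset]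
    exact h.count

theorem settled_dismantle (hi : H.Inv N.n B F kid loc) (hsp : 0 < H.sp) (hf : H.Full H.top)
    {j : ℕ} : ∀ x < N.n, (Settled (H.dismantle j) (F.erase H.top) x ↔
      Settled H F x ∨ x = H.item H.top) := by
  intro x hx
  have ht := hi.top_mem hsp
  have h0 := hi.pos _ ht
  unfold Settled
  change H.node x ≠ 0 ∧ H.node x ∉ F.erase H.top ↔ _
  have hiff : x = H.item H.top ↔ H.node x = H.top := by
    constructor
    · rintro rfl
      exact hf
    · intro he
      rw [← he, (hi.node_spec x hx (by omega)).1]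
  rw [hiff, Finset.mem_erase]
  by_cases he : H.node x = H.top
  · simp only [he, ht, or_true, iff_true]
    exact ⟨by omega, by simp⟩
  · simp [he]

/-- Settling the vertex of a minimal node preserves the invariant. Its edges stay pending until they
are scanned. -/
theorem Search.settle (h : Search N v H F u 0) (hi : H.Inv N.n B F kid loc) (hr : H.Ready B)
    (hsp : 0 < H.sp) (j : ℕ) :
    Search N v (H.dismantle j) (F.erase H.top) (H.item H.top) N.m ∧
      pending N (H.dismantle j) (F.erase H.top) (H.item H.top) N.m = pending N H F u 0 ∧
      unsettled N (H.dismantle j) (F.erase H.top) + 1 = unsettled N H F := by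
  classical
  have ht := hi.top_mem hsp
  have hf : H.Full H.top := hr.full _ (by omega)
  have hmin := fun y (hy : y ∈ F) => hi.key_top_le hr hy
  have hu := hi.item_lt _ ht
  have hset := settled_dismantle hi hsp hf (j := j)
  have hnot : ¬ Settled H F (H.item H.top) := fun hs => hs.2 (hf.symm ▸ ht)
  have hpend : pending N (H.dismantle j) (F.erase H.top) (H.item H.top) N.m =
      pending N H F u 0 := by
    rw [pending, pending]
    congr 1
    refine Finset.filter_congr fun i hi' => ?_
    rw [Finset.mem_range] at hi'
    rw [hset _ (N.src_lt i hi')]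
    by_cases he : N.src i = H.item H.top
    · simp [he, hi', hnot]
    · simp [he]
  refine ⟨⟨h.source, h.reach, ?_, ?_, ?_, ?_⟩, hpend, ?_⟩
  · intro i hi' hs hne
    rw [hset _ (N.src_lt i hi')] at hs
    exact h.relaxed i hi' (hs.resolve_right fun he => hne ⟨he, hi'⟩) (by omega)
  · intro x hx hs y hy
    have hyF := Finset.mem_of_mem_erase hy
    rcases (hset x hx).1 hs with hs | rfl
    · exact h.order x hx hs y hyF
    · change H.key (H.node _) ≤ _
      rw [show H.node (H.item H.top) = H.top from hf]
      exact hmin y hyF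
  · intro _
    refine ⟨(hset _ hu).2 (.inr rfl), fun x hx hs => ?_⟩
    change H.key (H.node x) ≤ H.key (H.node (H.item H.top))
    rcases (hset x hx).1 hs with hs | rfl
    · exact h.order x hx hs _ (hf.symm ▸ ht)
    · exact le_rfl
  · rw [hpend]
    exact h.count
  · rw [unsettled, unsettled]
    have : (Finset.range N.n).filter (fun x => ¬ Settled (H.dismantle j) (F.erase H.top) x) =
        ((Finset.range N.n).filter fun x => ¬ Settled H F x).erase (H.item H.top) := by
      ext x
      simp only [Finset.mem_filter, Finset.mem_range, Finset.mem_erase]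
      constructor
      · rintro ⟨hx, hs⟩
        rw [hset x hx] at hs
        tauto
      · rintro ⟨hne, hx, hs⟩
        rw [hset x hx]
        tauto
    rw [this, Finset.card_erase_add_one (by simp [hu, hnot])]

/-- The edge `i` is the last one from `u` below `k`, so relaxing it lowers the number of pending
edges by one. -/
theorem pending_relax {i : ℕ} (hsu : Settled H F u) (hm : k ≤ N.m) (hi : i < k)
    (hsrc : N.src i = u) (hlast : ∀ j, i < j → j < k → N.src j ≠ u) :
    pending N H F u i + 1 = pending N H F u k := by
  classical
  rw [pending, pending]
  have : (Finset.range N.m).filter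
        (fun j => ¬ Settled H F (N.src j) ∨ (N.src j = u ∧ j < i)) =
      ((Finset.range N.m).filter
        fun j => ¬ Settled H F (N.src j) ∨ (N.src j = u ∧ j < k)).erase i := by
    ext j
    simp only [Finset.mem_filter, Finset.mem_range, Finset.mem_erase]
    have h₁ := hlast j
    have h₂ : j = i → Settled H F (N.src j) := fun he => by rw [he, hsrc]; exact hsu
    by_cases h₃ : N.src j = u
    · by_cases h₄ : j = i
      · subst h₄
        simp [h₂ rfl]
      · simp only [h₃, true_and]
        have : j < i ↔ j < k := by
          constructor
          · omega
          · intro hjk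
            by_contra hji
            exact h₁ (by omega) hjk h₃
        tauto
    · have : j ≠ i := fun he => h₃ (he ▸ hsrc)
      tauto
  rw [this, Finset.card_erase_add_one]
  simp only [Finset.mem_filter, Finset.mem_range]
  exact ⟨by omega, .inr ⟨hsrc, hi⟩⟩

theorem pending_zero (hlast : ∀ j < k, N.src j ≠ u) : pending N H F u 0 = pending N H F u k := by
  classical
  rw [pending, pending]
  congr 1
  refine Finset.filter_congr fun j _ => ?_
  have := hlast j
  simp
  tauto

/-- No edge of `u` is left. -/
theorem Search.finish (h : Search N v H F u k) (hlast : ∀ j < k, N.src j ≠ u) :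
    Search N v H F u 0 :=
  ⟨h.source, h.reach, fun i hi hs _ => h.relaxed i hi hs fun he => hlast i he.2 he.1, h.order,
    by omega, by rw [pending_zero hlast]; exact h.count⟩

/-- Relaxing an edge that does not improve the tentative distance. -/
theorem Search.relax_of_le (h : Search N v H F u k) {i : ℕ} (hm : k ≤ N.m) (hi : i < k)
    (hsrc : N.src i = u) (hlast : ∀ j, i < j → j < k → N.src j ≠ u)
    (hle : H.node (N.tgt i) ≠ 0 ∧ H.key (H.node (N.tgt i)) ≤ H.key (H.node u) + N.len i) :
    Search N v H F u i := by
  have hc := h.current (by omega)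
  refine ⟨h.source, h.reach, fun j hj hs hne => ?_, h.order, fun _ => hc, ?_⟩
  · by_cases hji : j = i
    · subst hji
      rw [hsrc]
      exact hle
    · exact h.relaxed j hj hs fun he => by
        have := hlast j
        grind
  · have := pending_relax hc.1 hm hi hsrc hlast
    have := h.count
    omega

/-- An edge that improves a tentative distance leads to a vertex that is not settled, so its node
may be replaced. -/
theorem Search.node_mem (h : Search N v H F u k) {i : ℕ} (hm : k ≤ N.m) (hi : i < k)
    (hlt : H.node (N.tgt i) ≠ 0 → H.key (H.node u) + N.len i < H.key (H.node (N.tgt i))) :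
    H.node (N.tgt i) = 0 ∨ H.node (N.tgt i) ∈ F := by
  -- Settled vertices are at most as far away as `u`.
  by_contra! hcon
  have h₁ := (h.current (by omega)).2 _ (N.tgt_lt i (by omega)) hcon
  have h₂ := hlt hcon.1
  have h₃ := N.len_nonneg i (by omega)
  linarith

theorem settled_push (hi : H.Inv N.n B F kid loc) {y : ℕ} {d : ℝ}
    (hnode : H.node y = 0 ∨ H.node y ∈ F) :
    ∀ x < N.n, (Settled (H.push y d) (insert (H.size + 1) F) x ↔ Settled H F x) ∧
      (Settled H F x → (H.push y d).node x = H.node x ∧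
        (H.push y d).key (H.node x) = H.key (H.node x)) := by
  intro x hx
  have h₁ := hi.node_spec x hx
  simp only [Settled, Heap.push, Function.update_apply, Finset.mem_insert]
  by_cases hxy : x = y
  · subst hxy
    simp only [if_true]
    tauto
  · simp only [hxy, if_false]
    constructor
    · refine and_congr_right fun h0 => ?_
      have := h₁ h0
      have : H.node x ≠ H.size + 1 := by omega
      tauto
    · rintro ⟨h0, -⟩
      have := h₁ h0
      rw [if_neg (by omega)]
      simp

/-- Relaxing an edge that improves the tentative distance. -/
theorem Search.relax_push (h : Search N v H F u k) (hinv : H.Inv N.n B F kid loc) {i : ℕ}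
    (hm : k ≤ N.m) (hi : i < k) (hv : v < N.n)
    (hsrc : N.src i = u) (hlast : ∀ j, i < j → j < k → N.src j ≠ u)
    (hlt : H.node (N.tgt i) ≠ 0 → H.key (H.node u) + N.len i < H.key (H.node (N.tgt i))) :
    Search N v (H.push (N.tgt i) (H.key (H.node u) + N.len i)) (insert (H.size + 1) F) u i := by
  have hc := h.current (by omega)
  have hu : u < N.n := hsrc ▸ N.src_lt i (by omega)
  have hset := settled_push hinv (d := H.key (H.node u) + N.len i) (h.node_mem hm hi hlt)
  have hlen := N.len_nonneg i (by omega)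
  -- Tentative distances only decrease.
  have hdec : ∀ x < N.n, H.node x ≠ 0 →
      (H.push (N.tgt i) (H.key (H.node u) + N.len i)).node x ≠ 0 ∧
      (H.push (N.tgt i) (H.key (H.node u) + N.len i)).key
        ((H.push (N.tgt i) (H.key (H.node u) + N.len i)).node x) ≤ H.key (H.node x) := by
    intro x hx h0
    have h₁ := hinv.node_spec x hx h0
    simp only [Heap.push, Function.update_apply]
    by_cases hxy : x = N.tgt i
    · subst hxy
      simpa using (hlt h0).le
    · rw [if_neg hxy, if_neg (by omega)]
      exact ⟨h0, le_rfl⟩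
  have hnew : (H.push (N.tgt i) (H.key (H.node u) + N.len i)).node (N.tgt i) = H.size + 1 ∧
      (H.push (N.tgt i) (H.key (H.node u) + N.len i)).key (H.size + 1) =
        H.key (H.node u) + N.len i := by simp [Heap.push]
  have hold : ∀ y ∈ F, (H.push (N.tgt i) (H.key (H.node u) + N.len i)).key y = H.key y := by
    intro y hy
    have := hinv.pos y hy
    simp only [Heap.push]
    exact Function.update_of_ne (by omega) _ _
  have hsize : (H.push (N.tgt i) (H.key (H.node u) + N.len i)).size = H.size + 1 := rfl
  have hother : ∀ x < N.n, x ≠ N.tgt i →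
      (H.push (N.tgt i) (H.key (H.node u) + N.len i)).node x = H.node x ∧
      (H.node x ≠ 0 → (H.push (N.tgt i) (H.key (H.node u) + N.len i)).key (H.node x) =
        H.key (H.node x)) := by
    intro x hx hne
    refine ⟨by simp [Heap.push, hne], fun h0 => ?_⟩
    have h₁ := hinv.node_spec x hx h0
    simp only [Heap.push]
    exact Function.update_of_ne (by omega) _ _
  generalize hP : H.push (N.tgt i) (H.key (H.node u) + N.len i) = P at *
  refine ⟨?_, ?_, ?_, ?_, ?_, ?_⟩
  · have := hdec v hv h.source.1
    exact ⟨this.1, this.2.trans h.source.2⟩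
  · intro x hx h0
    by_cases hxy : x = N.tgt i
    · subst hxy
      rw [hnew.1, hnew.2, ← hsrc]
      exact .step (by omega) (h.reach _ (hsrc ▸ hu) (hsrc ▸ hc.1.1))
    · have h₁ := hother x hx hxy
      rw [h₁.1] at h0 ⊢
      rw [h₁.2 h0]
      exact h.reach x hx h0
  · intro j hj hs hne
    have h₁ := hset _ (N.src_lt j hj)
    rw [h₁.1] at hs
    have h₂ := h₁.2 hs
    rw [h₂.1, h₂.2]
    by_cases hji : j = i
    · subst hji
      rw [hnew.1, hnew.2, hsrc]
      exact ⟨by omega, le_rfl⟩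
    · have h₃ := h.relaxed j hj hs fun he => by
        have := hlast j
        grind
      have h₄ := hdec _ (N.tgt_lt j hj) h₃.1
      exact ⟨h₄.1, h₄.2.trans h₃.2⟩
  · intro x hx hs y hy
    have h₁ := hset x hx
    rw [h₁.1] at hs
    have h₂ := h₁.2 hs
    rw [h₂.1, h₂.2]
    rcases Finset.mem_insert.1 hy with rfl | hy
    · rw [hnew.2]
      have := hc.2 x hx hs
      linarith
    · rw [hold y hy]
      exact h.order x hx hs y hy
  · intro _
    have h₂ := (hset u hu).2 hc.1
    refine ⟨(hset u hu).1.2 hc.1, fun x hx hs => ?_⟩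
    rw [(hset x hx).1] at hs
    have h₃ := (hset x hx).2 hs
    rw [h₂.1, h₂.2, h₃.1, h₃.2]
    exact hc.2 x hx hs
  · rw [pending_congr fun x hx => (hset x hx).1, hsize]
    have := pending_relax hc.1 hm hi hsrc hlast
    have := h.count
    omega

/-- When the heap is empty, the keys of the current nodes are the distances from `v`. -/
theorem Search.dist_le (h : Search N v H ∅ u 0) {x : ℕ} {d : ℝ} (hd : N.Reach v x d) :
    H.node x ≠ 0 ∧ H.key (H.node x) ≤ d := by
  induction hd with
  | refl => exact h.source
  | step hi _ ih =>
    have := h.relaxed _ hi ⟨ih.1, by simp⟩ (by omega)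
    exact ⟨this.1, this.2.trans (by linarith [ih.2])⟩

end Search

/-! ### The search as a program -/

/-- The heap, the scratch registers and the registers of the scan. -/
abbrev searchZone : Zone := ⟨8, 18, 1, 4⟩

theorem Keep.search {s s' : Mem} (h : Keep heapZone s s') : Keep searchZone s s' :=
  h.mono (by decide) (by decide) (by decide) (by decide)

/-- The memory stores the network. The length of an edge is its weight for the potential. -/
structure Given (N : Network) (s : Mem) : Prop where
  n : s.nat 0 = N.n
  m : s.nat 1 = N.m
  src : s.natArr 0 = N.src
  tgt : s.natArr 1 = N.tgt
  len : ∀ i, s.realArr 0 i + s.realArr 1 (N.tgt i) - s.realArr 1 (N.src i) = N.len i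

/-- The memory stores the network, its adjacency lists and the bound `B`. -/
structure Loaded (N : Network) (B : ℕ) (s : Mem) : Prop extends Given N s where
  consts : Consts s
  head : ∀ x < N.n, s.natArr 2 x = lastEdge N.src x N.m
  next : ∀ i < N.m, s.natArr 3 i = lastEdge N.src (N.src i) i
  bound : s.nat 7 = B

theorem Keep.given {N : Network} {z : Zone} {s s' : Mem} (h : Keep z s s') (h₁ : 2 ≤ z.natLo)
    (h₂ : 2 ≤ z.arrLo) (hs : Given N s) : Given N s' where
  n := (h.nat 0 (by omega)).trans hs.n
  m := (h.nat 1 (by omega)).trans hs.m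
  src := (h.natArr 0 (by omega)).trans hs.src
  tgt := (h.natArr 1 (by omega)).trans hs.tgt
  len := by rw [h.realArr 0 (by decide), h.realArr 1 (by decide)]; exact hs.len

theorem Keep.loaded {N : Network} {B : ℕ} {s s' : Mem} (h : Keep searchZone s s')
    (hs : Loaded N B s) : Loaded N B s' where
  toGiven := h.given (by decide) (by decide) hs.toGiven
  consts := h.consts (by decide) hs.consts
  head := by rw [h.natArr 2 (by decide)]; exact hs.head
  next := by rw [h.natArr 3 (by decide)]; exact hs.next
  bound := (h.nat 7 (by decide)).trans hs.bound

/-- Relax the edge whose index is one less than register `17`. -/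
def relaxStep : Prog :=
  .seq (.block [.natSub 10 17 5, .natLoad 11 1 10, .realLoad 2 0 10, .realLoad 3 1 11,
      .realAdd 2 2 3, .realLoad 3 1 16, .realSub 2 2 3, .realAdd 2 1 2, .natLoad 12 4 11,
      .realLoad 3 2 12])
    (.seq (.ite (.natEq 12 4) pushProg (.ite (.realLt 2 3) pushProg (.block [])))
      (.block [.natLoad 17 3 10]))

theorem wp_relaxStep {N : Network} {B : ℕ} {s : Mem} {i : ℕ} (hs : Loaded N B s)
    (hp : s.nat 17 = i + 1) (hsrc : N.src i = s.nat 16) :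
    WP relaxStep s fun s' t => Keep searchZone s s' ∧ t ≤ 30 ∧ s'.nat 16 = s.nat 16 ∧
      s'.real 1 = s.real 1 ∧ s'.nat 17 = s.natArr 3 i ∧
      ((s.heap.node (N.tgt i) ≠ 0 ∧
          s.heap.key (s.heap.node (N.tgt i)) ≤ s.real 1 + N.len i ∧ s'.heap = s.heap) ∨
        ((s.heap.node (N.tgt i) ≠ 0 →
            s.real 1 + N.len i < s.heap.key (s.heap.node (N.tgt i))) ∧
          s'.heap = s.heap.push (N.tgt i) (s.real 1 + N.len i))) := by
  refine WP.keep (by simp [relaxStep, pushProg, Prog.block, Prog.Within, Instr.Within]) ?_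
  have hc := hs.consts
  have hlen := hs.len i
  rw [hsrc] at hlen
  have ht := hs.tgt
  refine WP.seq (WP.block _ _ ?_)
  set s₁ := List.foldl (fun s i => Instr.run i s) s [.natSub 10 17 5, .natLoad 11 1 10,
    .realLoad 2 0 10, .realLoad 3 1 11, .realAdd 2 2 3, .realLoad 3 1 16, .realSub 2 2 3,
    .realAdd 2 1 2, .natLoad 12 4 11, .realLoad 3 2 12] with hs₁
  have h10 : s₁.nat 10 = i := by simp [hs₁, Instr.run, hc.one, hp]
  have h11 : s₁.nat 11 = N.tgt i := by simp [hs₁, Instr.run, hc.one, hp, ht]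
  have h12 : s₁.nat 12 = s.heap.node (N.tgt i) := by
    simp [hs₁, Instr.run, hc.one, hp, ht, Mem.heap]
  have hr2 : s₁.real 2 = s.real 1 + N.len i := by
    simp [hs₁, Instr.run, hc.one, hp, ht, ← hlen]
  have hr3 : s₁.real 3 = s.heap.key (s.heap.node (N.tgt i)) := by
    simp [hs₁, Instr.run, hc.one, hp, ht, Mem.heap]
  have hheap : s₁.heap = s.heap := by simp [hs₁, Instr.run, Mem.heap]
  have hkeep : Keep heapZone s s₁ := Keep.foldl (by simp [Instr.Within]) _
  have hc₁ : Consts s₁ := hkeep.consts (by decide) hc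
  clear_value s₁
  have hpush : (s.heap.node (N.tgt i) ≠ 0 →
      s.real 1 + N.len i < s.heap.key (s.heap.node (N.tgt i))) →
      WP pushProg s₁ fun s' t => Keep heapZone s s' ∧ s'.nat 10 = i ∧ t ≤ 14 ∧
        ((s.heap.node (N.tgt i) ≠ 0 →
            s.real 1 + N.len i < s.heap.key (s.heap.node (N.tgt i))) ∧
          s'.heap = s.heap.push (N.tgt i) (s.real 1 + N.len i)) := fun h => by
    refine (wp_pushProg hc₁ ?_).mono ?_
    · rw [h12, h11, ← hheap]
      rfl
    · rintro s' t ⟨g₁, g₂, g₃, rfl⟩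
      exact ⟨hkeep.trans g₁, g₃.trans h10, le_rfl, h, by rw [g₂, hheap, h11, hr2]⟩
  refine WP.seq (WP.mono (Q := fun s' t => Keep heapZone s s' ∧ s'.nat 10 = i ∧ t ≤ 16 ∧
    ((s.heap.node (N.tgt i) ≠ 0 ∧
          s.heap.key (s.heap.node (N.tgt i)) ≤ s.real 1 + N.len i ∧ s'.heap = s.heap) ∨
        ((s.heap.node (N.tgt i) ≠ 0 →
            s.real 1 + N.len i < s.heap.key (s.heap.node (N.tgt i))) ∧
          s'.heap = s.heap.push (N.tgt i) (s.real 1 + N.len i))))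
    (WP.ite (fun h => ?_) (fun h => WP.ite (fun h' => ?_) (fun h' => ?_))) ?_)
  · simp only [Test.Holds, h12, hc₁.zero] at h
    exact (hpush fun h0 => absurd h h0).mono fun s' t ⟨g₁, g₂, g₃, g₄⟩ =>
      ⟨g₁, g₂, by omega, .inr g₄⟩
  · simp only [Test.Holds, hr2, hr3] at h'
    exact (hpush fun _ => h').mono fun s' t ⟨g₁, g₂, g₃, g₄⟩ => ⟨g₁, g₂, by omega, .inr g₄⟩
  · simp only [Test.Holds, h12, hc₁.zero] at h
    simp only [Test.Holds, hr2, hr3, not_lt] at h'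
    exact WP.block _ _ ⟨hkeep, h10, by simp, .inl ⟨h, h', hheap⟩⟩
  · rintro s' t ⟨g₁, g₂, g₃, g₄⟩
    have g₅ := g₁.nat 16 (by decide)
    have g₆ := g₁.real 1 (by decide)
    have g₇ := g₁.natArr 3 (by decide)
    refine WP.block _ _ ⟨?_, ?_, ?_, ?_, ?_⟩
    · simp only [List.length]
      omega
    · simpa [Instr.run] using g₅
    · simpa [Instr.run] using g₆
    · simp [Instr.run, g₇, g₂]
    · simpa [Instr.run, Mem.heap] using g₄

/-- Relax the edges in the adjacency list that is left in register `17`. -/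
def relaxAll : Prog := .loop (.natLt 4 17) relaxStep

/-- Each edge that is scanned pays for the node that it may create: one more root and one more
hollow node, which are charged when the heap is consolidated. -/
theorem wp_relaxAll {N : Network} {v B u : ℕ} {s : Mem} {F : Finset ℕ} {kid : ℕ → ℕ → ℕ}
    {loc : ℕ → Place} (hs : Loaded N B s) (hv : v < N.n) (hu : u < N.n)
    (h : s.heap.Inv N.n B F kid loc) (ht : ∀ r < B, s.heap.table r = 0)
    (hS : Search N v s.heap F u N.m) (h16 : s.nat 16 = u)
    (h17 : s.nat 17 = lastEdge N.src u N.m) (hr : s.real 1 = s.heap.key (s.heap.node u)) :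
    WP relaxAll s fun s' t => ∃ F' kid' loc', s'.heap.Inv N.n B F' kid' loc' ∧
      (∀ r < B, s'.heap.table r = 0) ∧ Search N v s'.heap F' u 0 ∧ Keep searchZone s s' ∧
      unsettled N s'.heap F' = unsettled N s.heap F ∧
      t + 80 * s'.heap.sp + 120 * s'.heap.hollowCount F' + 240 * pending N s'.heap F' u 0 ≤
        80 * s.heap.sp + 120 * s.heap.hollowCount F + 240 * pending N s.heap F u N.m + 1 := by
  have key := WP.loop (b := .natLt 4 17) (P := relaxStep) (α := Mem × Finset ℕ × ℕ)
    (fun a s' => a.1 = s' ∧ a.2.2 ≤ N.m ∧ (∃ kid' loc', s'.heap.Inv N.n B a.2.1 kid' loc') ∧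
      (∀ r < B, s'.heap.table r = 0) ∧ Search N v s'.heap a.2.1 u a.2.2 ∧ Keep searchZone s s' ∧
      unsettled N s'.heap a.2.1 = unsettled N s.heap F ∧ s'.nat 16 = u ∧
      s'.nat 17 = lastEdge N.src u a.2.2 ∧
      (0 < a.2.2 → s'.real 1 = s'.heap.key (s'.heap.node u)))
    (fun a => 80 * a.1.heap.sp + 120 * a.1.heap.hollowCount a.2.1 +
      240 * pending N a.1.heap a.2.1 u a.2.2)
    ?_ (a := (s, F, N.m)) (s := s)
    ⟨rfl, le_rfl, ⟨kid, loc, h⟩, ht, hS, .refl _ _, rfl, h16, h17, fun _ => hr⟩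
  · refine key.mono ?_
    rintro s' t ⟨⟨s'', F', k⟩, ⟨rfl : s'' = s', -, ⟨kid', loc', h₁⟩, h₂, h₃, h₄, h₅, -, h₆, -⟩,
      h₇, h₈⟩
    dsimp only at h₁ h₃ h₅ h₆ h₈
    have h₉ : lastEdge N.src u k = 0 := by
      simp only [Test.Holds, (h₄.loaded hs).consts.zero] at h₇
      omega
    have h₁₀ := lastEdge_eq_zero h₉
    refine ⟨F', kid', loc', h₁, h₂, h₃.finish h₁₀, h₄, h₅, ?_⟩
    rw [pending_zero h₁₀]
    omega
  · rintro ⟨s₁, F₁, k⟩ s₂ ⟨rfl : s₁ = s₂, hk, ⟨kid₁, loc₁, h₁⟩, h₂, h₃, h₄, h₅, h₆, h₇, h₈⟩ hb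
    dsimp only at hk h₁ h₃ h₅ h₇ h₈
    have hL := h₄.loaded hs
    obtain ⟨i, hi⟩ : ∃ i, s₁.nat 17 = i + 1 :=
      Nat.exists_eq_add_one.2 (by simpa [Test.Holds, hL.consts.zero] using hb)
    obtain ⟨hik, hsrc, hlast⟩ := lastEdge_eq_succ (h₇.symm.trans hi)
    have hkey := h₈ (by omega)
    have hcur := h₃.current (by omega)
    have hpend := pending_relax hcur.1 hk hik hsrc hlast
    refine (wp_relaxStep hL hi (hsrc.trans h₆.symm)).mono ?_
    rintro s' t ⟨g₁, g₂, g₃, g₄, g₅, ⟨g₆, g₇, he⟩ | ⟨g₆, he⟩⟩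
    · rw [hkey] at g₇
      refine ⟨(s', F₁, i), ⟨rfl, by dsimp only; omega, ⟨kid₁, loc₁, he ▸ h₁⟩, he ▸ h₂,
        he ▸ h₃.relax_of_le hk hik hsrc hlast ⟨g₆, g₇⟩, h₄.trans g₁, he ▸ h₅, g₃.trans h₆, ?_, ?_⟩,
        ?_⟩
      · rw [g₅, hL.next i (by omega), hsrc]
      · intro _
        rw [g₄, he, hkey]
      · simp only [he]
        omega
    · rw [hkey] at g₆ he
      have hnode := h₃.node_mem hk hik g₆
      obtain ⟨kid', loc', h₉⟩ := h₁.push (d := s₁.heap.key (s₁.heap.node u) + N.len i)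
        (N.tgt_lt i (by omega)) h₂ (by
          by_cases h0 : s₁.heap.node (N.tgt i) = 0
          · exact .inl h0
          · exact .inr ⟨hnode.resolve_left h0, (g₆ h0).le⟩)
      have hset := settled_push h₁ (d := s₁.heap.key (s₁.heap.node u) + N.len i) hnode
      have hpend' := pending_congr (N := N) (u := u) (k := i) fun x hx => (hset x hx).1
      have hhol := h₁.hollowCount_push_le (d := s₁.heap.key (s₁.heap.node u) + N.len i)
        (N.tgt_lt i (by omega))
      have hsp : (s₁.heap.push (N.tgt i) (s₁.heap.key (s₁.heap.node u) + N.len i)).sp =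
        s₁.heap.sp + 1 := rfl
      have huns := unsettled_congr (N := N) fun x hx => (hset x hx).1
      have hcu := (hset u hu).2 hcur.1
      refine ⟨(s', insert (s₁.heap.size + 1) F₁, i), ⟨rfl, by dsimp only; omega,
        ⟨kid', loc', he ▸ h₉⟩, ?_, ?_, h₄.trans g₁, ?_, g₃.trans h₆, ?_, ?_⟩, ?_⟩
      · rw [he]
        exact h₂
      · rw [he]
        exact h₃.relax_push h₁ hk hik hv hsrc hlast g₆
      · rw [he]
        exact huns.trans h₅
      · rw [g₅, hL.next i (by omega), hsrc]
      · intro _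
        rw [g₄, he, hkey, hcu.1, hcu.2]
      · simp only [he]
        omega

/-- Extract the top of the stack, and prepare the scan of its vertex. -/
def settleProg : Prog :=
  .seq (.block [.natSub 11 9 5, .natLoad 11 10 11, .natLoad 16 5 11, .realLoad 1 2 11,
      .natLoad 17 2 16, .natLoad 12 6 11])
    dismantleProg

theorem wp_settleProg {s : Mem} (hs : Consts s) :
    WP settleProg s fun s' t => Keep searchZone s s' ∧
      s'.heap = s.heap.dismantle (s.heap.rank s.heap.top) ∧
      s'.nat 16 = s.heap.item s.heap.top ∧ s'.nat 17 = s.natArr 2 (s.heap.item s.heap.top) ∧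
      s'.real 1 = s.heap.key s.heap.top ∧ t ≤ 6 * s.heap.rank s.heap.top + 11 := by
  refine WP.keep (by simp [settleProg, dismantleProg, Prog.block, Prog.Within, Instr.Within])
    (WP.seq (WP.block _ _ ?_))
  set s₁ := List.foldl (fun s i => Instr.run i s) s [.natSub 11 9 5, .natLoad 11 10 11,
    .natLoad 16 5 11, .realLoad 1 2 11, .natLoad 17 2 16, .natLoad 12 6 11] with hs₁
  have h11 : s₁.nat 11 = s.heap.top := by simp [hs₁, Instr.run, hs.one, Mem.heap, Heap.top]
  have h12 : s₁.nat 12 = s.heap.rank s.heap.top := by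
    simp [hs₁, Instr.run, hs.one, Mem.heap, Heap.top]
  have h16 : s₁.nat 16 = s.heap.item s.heap.top := by
    simp [hs₁, Instr.run, hs.one, Mem.heap, Heap.top]
  have h17 : s₁.nat 17 = s.natArr 2 (s.heap.item s.heap.top) := by
    simp [hs₁, Instr.run, hs.one, Mem.heap, Heap.top]
  have hr1 : s₁.real 1 = s.heap.key s.heap.top := by
    simp [hs₁, Instr.run, hs.one, Mem.heap, Heap.top]
  have hheap : s₁.heap = s.heap := by simp [hs₁, Instr.run, Mem.heap]
  have hc₁ : Consts s₁ :=
    (Keep.foldl (z := searchZone) (by simp [Instr.Within]) _).consts (by decide) hs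
  clear_value s₁
  refine (wp_dismantleProg hc₁ (by rw [h11, hheap])).mono ?_
  rintro s' t ⟨g₁, g₂, g₃⟩
  refine ⟨by rw [g₁, hheap, h12], (g₂.nat 16 (by decide)).trans h16,
    (g₂.nat 17 (by decide)).trans h17, (g₂.real 1 (by decide)).trans hr1, ?_⟩
  simp only [List.length]
  omega

/-- Dijkstra's algorithm: settle a nearest vertex, relax its edges and reorganize the heap. -/
def searchLoop : Prog :=
  .loop (.natLt 4 9) (.seq settleProg (.seq relaxAll (.seq consolidate scan)))

/-- The running time is amortized: constant time for each pending edge and time `O(B)` for each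
unsettled vertex. -/
theorem wp_searchLoop {N : Network} {v B k : ℕ} {s : Mem} {F : Finset ℕ} {kid : ℕ → ℕ → ℕ}
    {loc : ℕ → Place} (hs : Loaded N B s) (hv : v < N.n) (hB : B = 2 * k) (hk : N.m + 1 < 2 ^ k)
    (h : s.heap.Inv N.n B F kid loc) (hR : s.heap.Ready B) (hsp : s.heap.sp ≤ B)
    (hS : Search N v s.heap F v 0) :
    WP searchLoop s fun s' t => Keep searchZone s s' ∧ Search N v s'.heap ∅ v 0 ∧
      t ≤ 120 * s.heap.hollowCount F + 240 * pending N s.heap F v 0 +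
        (200 * B + 40) * unsettled N s.heap F + 1 := by
  -- Without a scan in progress it does not matter which vertex was scanned last.
  have hp0 : ∀ (H : Heap) (F : Finset ℕ) (u : ℕ), pending N H F u 0 = pending N H F v 0 := by
    intro H F u
    classical
    simp [pending]
  have hS0 : ∀ {H : Heap} {F : Finset ℕ} {u : ℕ}, Search N v H F u 0 → Search N v H F v 0 :=
    fun {H F u} h => ⟨h.source, h.reach, fun i hi hs _ => h.relaxed i hi hs (by omega), h.order,
      by omega, by rw [← hp0 H F u]; exact h.count⟩
  have key := WP.loop (b := .natLt 4 9)
    (P := .seq settleProg (.seq relaxAll (.seq consolidate scan))) (α := Mem × Finset ℕ)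
    (fun a s' => a.1 = s' ∧ (∃ kid' loc', s'.heap.Inv N.n B a.2 kid' loc') ∧ s'.heap.Ready B ∧
      s'.heap.sp ≤ B ∧ Search N v s'.heap a.2 v 0 ∧ Keep searchZone s s')
    (fun a => 120 * a.1.heap.hollowCount a.2 + 240 * pending N a.1.heap a.2 v 0 +
      (200 * B + 40) * unsettled N a.1.heap a.2)
    ?_ (a := (s, F)) (s := s) ⟨rfl, ⟨kid, loc, h⟩, hR, hsp, hS, .refl _ _⟩
  · refine key.mono ?_
    rintro s' t ⟨⟨s'', F'⟩, ⟨rfl : s'' = s', ⟨kid', loc', h₁⟩, h₂, h₃, h₄, h₅⟩, h₆, h₇⟩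
    dsimp only at h₁ h₄ h₇
    have hsp' : s''.heap.sp = 0 := by
      simp only [Test.Holds, (h₅.loaded hs).consts.zero] at h₆
      simp only [Mem.heap]
      omega
    obtain rfl := h₁.eq_empty h₂ hsp'
    exact ⟨h₅, h₄, by omega⟩
  · rintro ⟨s₁, F₁⟩ s₂ ⟨rfl : s₁ = s₂, ⟨kid₁, loc₁, h₁⟩, h₂, h₃, h₄, h₅⟩ hb
    dsimp only at h₁ h₄
    have hL := h₅.loaded hs
    have hsp₁ : 0 < s₁.heap.sp := by
      change 0 < s₁.nat 9
      simpa [Test.Holds, hL.consts.zero] using hb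
    have hfull : s₁.heap.Full s₁.heap.top := h₂.full _ (by omega)
    have hsize : s₁.heap.size < 2 ^ k := by
      have := h₄.count
      omega
    have hrank := h₁.rank_top_lt hB hsize hsp₁
    have hu := h₁.item_lt _ (h₁.top_mem hsp₁)
    refine WP.seq ((wp_settleProg hL.consts).mono ?_)
    rintro s₂ t₂ ⟨a₁, a₂, a₃, a₄, a₅, a₆⟩
    have hL₂ := a₁.loaded hL
    obtain ⟨b₁, b₂, b₃⟩ := h₄.settle h₁ h₂ hsp₁ (s₁.heap.rank s₁.heap.top)
    obtain ⟨loc₂, b₄⟩ := h₁.dismantle hsp₁ rfl (.inl ⟨hfull, rfl⟩)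
    have b₅ := Heap.hollowCount_dismantle_le (H := s₁.heap) (F := F₁)
      (k := s₁.heap.rank s₁.heap.top) (x := s₁.heap.top)
    have b₆ : s₂.heap.sp = s₁.heap.sp - 1 + s₁.heap.rank s₁.heap.top := by rw [a₂]; rfl
    have b₇ : s₂.heap.key (s₂.heap.node (s₁.heap.item s₁.heap.top)) = s₁.heap.key s₁.heap.top := by
      rw [a₂]
      change s₁.heap.key (s₁.heap.node _) = _
      rw [show s₁.heap.node (s₁.heap.item s₁.heap.top) = s₁.heap.top from hfull]
    have b₈ : ∀ r < B, s₂.heap.table r = 0 := by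
      rw [a₂]
      exact h₂.table
    rw [← a₂] at b₁ b₂ b₃ b₄ b₅
    rw [hL.head _ hu] at a₄
    refine WP.seq ((wp_relaxAll hL₂ hv hu b₄ b₈ b₁ a₃ a₄ (a₅.trans b₇.symm)).mono ?_)
    rintro s₃ t₃ ⟨F₃, kid₃, loc₃, c₁, c₂, c₃, c₄, c₅, c₆⟩
    have hL₃ := c₄.loaded hL₂
    have c₇ : s₃.heap.tableCount B = 0 := by
      rw [Heap.tableCount, Finset.card_eq_zero, Finset.filter_eq_empty_iff]
      intro r hr
      simpa using c₂ r (Finset.mem_range.1 hr)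
    have c₈ : s₃.heap.size < 2 ^ k := by
      have := c₃.count
      omega
    refine (wp_extract hL₃.consts c₁ hB c₈ hL₃.bound).mono ?_
    rintro s₄ t₄ ⟨F₄, kid₄, loc₄, d₁, d₂, d₃, d₄, d₅, d₆⟩
    have d₇ := settled_shrink c₁ d₄
    refine ⟨(s₄, F₄), ⟨rfl, ⟨kid₄, loc₄, d₁⟩, d₂, d₃, hS0 (c₃.shrink c₁ hu d₄),
      ((h₅.trans a₁).trans c₄).trans d₅.search⟩, ?_⟩
    dsimp only
    rw [unsettled_congr d₇, c₅, ← b₃, ← hp0 _ _ (s₁.heap.item s₁.heap.top), pending_congr d₇,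
      Nat.mul_succ]
    rw [hp0 s₁.heap, hp0 s₃.heap] at *
    omega

/-! ### Initialization -/

/-- A loop that counts in register `10` up to the content `M` of register `b`. -/
theorem WP.count {P : Prog} {b M K : ℕ} (I : ℕ → Mem → Prop) {s : Mem}
    (hI : ∀ i s, I i s → s.nat 10 = i ∧ s.nat b = M)
    (step : ∀ i s, i < M → I i s → WP P s fun s' t => I (i + 1) s' ∧ t + 1 ≤ K) (h : I 0 s) :
    WP (.loop (.natLt 10 b) P) s fun s' t => I M s' ∧ t ≤ K * M + 1 := by
  refine (WP.loop (b := .natLt 10 b) (P := P) (fun i s' => I i s' ∧ i ≤ M) (fun i => K * (M - i))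
    ?_ (a := 0) (s := s) ⟨h, Nat.zero_le _⟩).mono ?_
  · rintro i s₁ ⟨h₁, h₂⟩ h₃
    have hi : i < M := by
      have := hI i s₁ h₁
      simp only [Test.Holds] at h₃
      omega
    refine (step i s₁ hi h₁).mono fun s' t ⟨g₁, g₂⟩ => ⟨i + 1, ⟨g₁, hi⟩, ?_⟩
    obtain ⟨j, rfl⟩ : ∃ j, M = i + 1 + j := ⟨M - (i + 1), by omega⟩
    rw [show i + 1 + j - (i + 1) = j by omega, show i + 1 + j - i = j + 1 by omega, Nat.mul_succ]
    omega
  · rintro s' t ⟨i, ⟨h₁, h₂⟩, h₃, h₄⟩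
    have := hI i s' h₁
    simp only [Test.Holds] at h₃
    obtain rfl : i = M := by omega
    exact ⟨h₁, by simp at h₄; omega⟩

/-- Everything but the input and the answer. -/
abbrev initZone : Zone := ⟨4, 18, 1, 2⟩

theorem Heap.Inv.empty {n B : ℕ} {H : Heap} (hsp : H.sp = 0)
    (ht : ∀ r < B, H.table r = 0) (hn : ∀ v < n, H.node v = 0) (hr : H.rank 0 = 0) :
    H.Inv n B ∅ (fun _ _ => 0) (fun _ => .stack 0) where
  pos := by simp
  stack_mem := by omega
  table_mem := fun r hr h0 => absurd (ht r hr) h0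
  kid_mem := by simp [Heap.HasKid]
  loc_stack := by simp
  loc_table := by simp
  loc_kid := by simp
  child_eq := by simp
  next_eq := by simp [Heap.HasKid]
  item_lt := by simp
  node_spec := fun v hv h0 => absurd (hn v hv) h0
  rank_zero := hr

theorem pending_le (N : Network) (H : Heap) (F : Finset ℕ) (u k : ℕ) :
    pending N H F u k ≤ N.m := by
  classical
  rw [pending]
  exact (Finset.card_filter_le _ _).trans (by simp)

theorem unsettled_le (N : Network) (H : Heap) (F : Finset ℕ) : unsettled N H F ≤ N.n := by
  classical
  rw [unsettled]
  exact (Finset.card_filter_le _ _).trans (by simp)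

/-- The search starts with the vertex `v` at distance `0` in the heap. -/
theorem Search.start {N : Network} {v B : ℕ} {H : Heap} (hv : v < N.n) (hsize : H.size = 0)
    (hsp : H.sp = 0) (ht : ∀ r < B, H.table r = 0) (hn : ∀ v < N.n, H.node v = 0)
    (hr : H.rank 0 = 0) :
    (∃ kid loc, (H.push v 0).Inv N.n B {1} kid loc) ∧ (H.push v 0).Ready B ∧
      (H.push v 0).sp = 1 ∧ Search N v (H.push v 0) {1} v 0 ∧
      (H.push v 0).hollowCount {1} = 0 := by
  classical
  have hinv := (Heap.Inv.empty hsp ht hn hr).push (d := 0) hv ht (.inl (hn v hv))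
  have hsp' : (H.push v 0).sp = 1 := by simp [Heap.push, hsp]
  have hst : (H.push v 0).stack 0 = 1 := by simp [Heap.push, hsp, hsize]
  have hnode : ∀ x < N.n, (H.push v 0).node x = if x = v then 1 else 0 := fun x hx => by
    simp only [Heap.push, Function.update_apply, hsize, hn x hx]
  have hkey : (H.push v 0).key 1 = 0 := by simp [Heap.push, hsize]
  have hfull : (H.push v 0).Full 1 := by simp [Heap.Full, Heap.push, hsize]
  have hset : ∀ x < N.n, ¬ Settled (H.push v 0) {1} x := fun x hx h => by
    unfold Settled at h
    rw [hnode x hx] at h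
    split_ifs at h <;> simp at h
  refine ⟨by simpa [hsize] using hinv, ⟨ht, fun j hj => ?_, fun j hj => ?_⟩, hsp',
    ⟨?_, ?_, fun i hi hs => absurd hs (hset _ (N.src_lt i hi)),
      fun x hx hs => absurd hs (hset x hx), by omega, ?_⟩, ?_⟩
  · obtain rfl : j = 0 := by omega
    rwa [hst]
  · obtain rfl : j = 0 := by omega
    simp [Heap.top, hsp']
  · simp [hnode v hv, hkey]
  · intro x hx h0
    rw [hnode x hx] at h0 ⊢
    by_cases hxv : x = v
    · rw [if_pos hxv, hkey, hxv]
      exact .refl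
    · exact absurd (if_neg hxv) h0
  · have h₁ : (H.push v 0).size = 1 := by simp [Heap.push, hsize]
    have h₂ : pending N (H.push v 0) {1} v 0 ≤ N.m := pending_le ..
    omega
  · simp [Heap.hollowCount, Finset.filter_singleton, hfull]

/-- Load the constants, and clear the current nodes and the heads of the adjacency lists. -/
def clearProg : Prog :=
  .seq (.block [.natConst 4 0, .natConst 5 1, .natConst 6 2, .natConst 10 0])
    (.loop (.natLt 10 0) (.block [.natStore 4 10 4, .natStore 2 10 4, .natAdd 10 10 5]))

theorem wp_clearProg {N : Network} {s : Mem} (hs : Given N s) :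
    WP clearProg s fun s' t => Keep initZone s s' ∧ Consts s' ∧
      (∀ x < N.n, s'.natArr 4 x = 0 ∧ s'.natArr 2 x = 0) ∧ t ≤ 5 * N.n + 6 := by
  refine WP.keep (by simp [clearProg, Prog.block, Prog.Within, Instr.Within])
    (WP.seq (WP.block _ _ ((WP.count (K := 5) (M := N.n)
      (fun i s' => s'.nat 10 = i ∧ s'.nat 0 = N.n ∧ Consts s' ∧
        ∀ x < i, s'.natArr 4 x = 0 ∧ s'.natArr 2 x = 0)
      (fun i s' h => ⟨h.1, h.2.1⟩) ?_ ?_).mono ?_)))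
  · rintro i s₁ hi ⟨h₁, h₂, h₃, h₄⟩
    refine WP.block _ _ ⟨⟨?_, ?_, ⟨?_, ?_, ?_⟩, ?_⟩, by simp⟩
    · simp [Instr.run, h₁, h₃.one]
    · simp [Instr.run, h₂]
    · simp [Instr.run, h₃.zero]
    · simp [Instr.run, h₃.one]
    · simp [Instr.run, h₃.two]
    · intro x hx
      have := h₄ x
      by_cases hxi : x = i
      · simp [Instr.run, h₁, hxi, h₃.zero]
      · simpa [Instr.run, h₁, hxi] using this (by omega)
  · exact ⟨by simp [Instr.run], by simp [Instr.run, hs.n],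
      ⟨by simp [Instr.run], by simp [Instr.run], by simp [Instr.run]⟩, by omega⟩
  · rintro s' t ⟨⟨-, -, h₃, h₄⟩, h₅⟩
    exact ⟨h₃, h₄, by simp only [List.length]; omega⟩

/-- Build the adjacency lists. -/
def adjacencyProg : Prog :=
  .seq (.block [.natConst 10 0])
    (.loop (.natLt 10 1) (.block [.natLoad 11 0 10, .natLoad 12 2 11, .natStore 3 10 12,
      .natAdd 10 10 5, .natStore 2 11 10]))

theorem wp_adjacencyProg {N : Network} {s : Mem} (hs : Given N s) (hc : Consts s)
    (h0 : ∀ x < N.n, s.natArr 4 x = 0 ∧ s.natArr 2 x = 0) :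
    WP adjacencyProg s fun s' t => Keep initZone s s' ∧ Consts s' ∧
      (∀ x < N.n, s'.natArr 4 x = 0) ∧ (∀ x < N.n, s'.natArr 2 x = lastEdge N.src x N.m) ∧
      (∀ i < N.m, s'.natArr 3 i = lastEdge N.src (N.src i) i) ∧ t ≤ 7 * N.m + 3 := by
  refine WP.keep (by simp [adjacencyProg, Prog.block, Prog.Within, Instr.Within])
    (WP.seq (WP.block _ _ ((WP.count (K := 7) (M := N.m)
      (fun i s' => s'.nat 10 = i ∧ s'.nat 1 = N.m ∧ Consts s' ∧ s'.natArr 0 = N.src ∧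
        (∀ x < N.n, s'.natArr 4 x = 0) ∧ (∀ x < N.n, s'.natArr 2 x = lastEdge N.src x i) ∧
        ∀ j < i, s'.natArr 3 j = lastEdge N.src (N.src j) j)
      (fun i s' h => ⟨h.1, h.2.1⟩) ?_ ?_).mono ?_)))
  · rintro i s₁ hi ⟨h₁, h₂, h₃, h₄, h₅, h₆, h₇⟩
    refine WP.block _ _ ⟨⟨?_, ?_, ⟨?_, ?_, ?_⟩, ?_, ?_, ?_, ?_⟩, by simp⟩
    · simp [Instr.run, h₁, h₃.one]
    · simp [Instr.run, h₂]
    · simp [Instr.run, h₃.zero]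
    · simp [Instr.run, h₃.one]
    · simp [Instr.run, h₃.two]
    · simp [Instr.run, h₄]
    · simpa [Instr.run] using h₅
    · intro x hx
      rw [lastEdge]
      by_cases hxi : N.src i = x
      · subst hxi
        simp [Instr.run, h₁, h₄, h₃.one]
      · rw [if_neg hxi]
        simpa [Instr.run, h₁, h₄, Ne.symm hxi] using h₆ x hx
    · intro j hj
      by_cases hji : j = i
      · subst hji
        simpa [Instr.run, h₁, h₄] using h₆ _ (N.src_lt j hi)
      · simpa [Instr.run, h₁, hji] using h₇ j (by omega)
  · refine ⟨by simp [Instr.run], by simp [Instr.run, hs.m],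
      ⟨by simp [Instr.run, hc.zero], by simp [Instr.run, hc.one], by simp [Instr.run, hc.two]⟩,
      by simp [Instr.run, hs.src], ?_, ?_, by omega⟩
    · simpa [Instr.run] using fun x hx => (h0 x hx).1
    · simpa [Instr.run, lastEdge] using fun x hx => (h0 x hx).2
  · rintro s' t ⟨⟨-, -, h₃, -, h₄, h₅, h₆⟩, h₇⟩
    exact ⟨h₃, h₄, h₅, h₆, by simp only [List.length]; omega⟩

/-- Compute the bound `B = 2 k` on the ranks, for the least power `2 ^ k` above `m + 1`. -/
def boundProg : Prog :=
  .seq (.block [.natConst 7 0, .natConst 11 1, .natAdd 12 1 5])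
    (.loop (.natLe 11 12) (.block [.natAdd 11 11 11, .natAdd 7 7 6]))

theorem wp_boundProg {N : Network} {s : Mem} (hs : Given N s) (hc : Consts s) :
    WP boundProg s fun s' t => Keep initZone s s' ∧ Consts s' ∧ s'.natArr = s.natArr ∧
      (∃ k, s'.nat 7 = 2 * k ∧ N.m + 1 < 2 ^ k ∧ 2 ^ k ≤ 2 * (N.m + 1)) ∧
      t ≤ 4 * N.m + 20 := by
  refine WP.keep (by simp [boundProg, Prog.block, Prog.Within, Instr.Within])
    (WP.seq (WP.block _ _ ((WP.loop (α := ℕ)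
      (fun k s' => s'.nat 11 = 2 ^ k ∧ s'.nat 12 = N.m + 1 ∧ Consts s' ∧ s'.natArr = s.natArr ∧
        s'.nat 7 = 2 * k ∧ 2 ^ k ≤ 2 * (N.m + 1))
      (fun k => 4 * (N.m + 2 - k)) ?_ (a := 0) ?_).mono ?_)))
  · rintro k s₁ ⟨h₁, h₂, h₃, h₄, h₅, h₆⟩ hb
    have hk : 2 ^ k ≤ N.m + 1 := by
      simp only [Test.Holds] at hb
      omega
    have : k < 2 ^ k := Nat.lt_two_pow_self
    refine WP.block _ _ ⟨k + 1, ⟨?_, ?_, ⟨?_, ?_, ?_⟩, ?_, ?_, ?_⟩, ?_⟩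
    · simp [Instr.run, h₁, pow_succ]
      omega
    · simp [Instr.run, h₂]
    · simp [Instr.run, h₃.zero]
    · simp [Instr.run, h₃.one]
    · simp [Instr.run, h₃.two]
    · simp [Instr.run, h₄]
    · simp [Instr.run, h₅, h₃.two]
      omega
    · rw [pow_succ]
      omega
    · simp only [List.length]
      omega
  · exact ⟨by simp [Instr.run], by simp [Instr.run, hs.m, hc.one],
      ⟨by simp [Instr.run, hc.zero], by simp [Instr.run, hc.one], by simp [Instr.run, hc.two]⟩,
      by simp [Instr.run], by simp [Instr.run], by omega⟩
  · rintro s' t ⟨k, ⟨h₁, h₂, h₃, h₄, h₅, h₆⟩, h₇, h₈⟩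
    simp only [Test.Holds] at h₇
    exact ⟨h₃, h₄, ⟨k, h₅, by omega, h₆⟩, by simp only [List.length]; omega⟩

/-- Clear the ranks below `B` of the table. -/
def clearTableProg : Prog :=
  .seq (.block [.natConst 10 0])
    (.loop (.natLt 10 7) (.block [.natStore 9 10 4, .natAdd 10 10 5]))

theorem wp_clearTableProg {s : Mem} (hc : Consts s) :
    WP clearTableProg s fun s' t => Keep heapZone s s' ∧ s'.natArr 4 = s.natArr 4 ∧
      (∀ r < s.nat 7, s'.natArr 9 r = 0) ∧ t ≤ 4 * s.nat 7 + 3 := by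
  refine WP.keep (by simp [clearTableProg, Prog.block, Prog.Within, Instr.Within])
    (WP.seq (WP.block _ _ ((WP.count (K := 4) (M := s.nat 7)
      (fun i s' => s'.nat 10 = i ∧ s'.nat 7 = s.nat 7 ∧ Consts s' ∧ s'.natArr 4 = s.natArr 4 ∧
        ∀ r < i, s'.natArr 9 r = 0)
      (fun i s' h => ⟨h.1, h.2.1⟩) ?_ ?_).mono ?_)))
  · rintro i s₁ hi ⟨h₁, h₂, h₃, h₄, h₅⟩
    refine WP.block _ _ ⟨⟨?_, ?_, ⟨?_, ?_, ?_⟩, ?_, ?_⟩, by simp⟩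
    · simp [Instr.run, h₁, h₃.one]
    · simp [Instr.run, h₂]
    · simp [Instr.run, h₃.zero]
    · simp [Instr.run, h₃.one]
    · simp [Instr.run, h₃.two]
    · simp [Instr.run, h₄]
    · intro r hr
      by_cases hri : r = i
      · simp [Instr.run, h₁, hri, h₃.zero]
      · simpa [Instr.run, h₁, hri] using h₅ r (by omega)
  · exact ⟨by simp [Instr.run], by simp [Instr.run],
      ⟨by simp [Instr.run, hc.zero], by simp [Instr.run, hc.one], by simp [Instr.run, hc.two]⟩,
      by simp [Instr.run], by omega⟩
  · rintro s' t ⟨⟨-, -, -, h₄, h₅⟩, h₆⟩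
    exact ⟨h₄, h₅, by simp only [List.length]; omega⟩

/-- Insert the target of the edge `e` into the empty heap. -/
def startProg : Prog :=
  .seq (.block [.natStore 6 4 4, .natLoad 11 1 2, .realSub 2 2 2, .natConst 8 0, .natConst 9 0,
    .natLoad 12 4 11]) pushProg

theorem wp_startProg {s : Mem} (hc : Consts s) :
    WP startProg s fun s' t => Keep heapZone s s' ∧ (∃ H : Heap, H.size = 0 ∧ H.sp = 0 ∧
      H.rank 0 = 0 ∧ H.table = s.natArr 9 ∧ H.node = s.natArr 4 ∧
      s'.heap = H.push (s.natArr 1 (s.nat 2)) 0) ∧ t ≤ 25 := by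
  refine WP.keep (by simp [startProg, pushProg, Prog.block, Prog.Within, Instr.Within])
    (WP.seq (WP.block _ _ ((wp_pushProg ?_ ?_).mono ?_)))
  · exact (Keep.foldl (z := heapZone) (by simp [Instr.Within]) _).consts (by decide) hc
  · simp [Instr.run]
  · rintro s' t ⟨g₁, g₂, g₃, g₄⟩
    refine ⟨⟨(List.foldl (fun s i => Instr.run i s) s [.natStore 6 4 4, .natLoad 11 1 2,
      .realSub 2 2 2, .natConst 8 0, .natConst 9 0, .natLoad 12 4 11]).heap, ?_, ?_, ?_, ?_, ?_,
      g₂.trans ?_⟩, by simp only [List.length]; omega⟩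
    · simp [Instr.run, Mem.heap]
    · simp [Instr.run, Mem.heap]
    · simp [Instr.run, Mem.heap, hc.zero]
    · simp [Instr.run, Mem.heap]
    · simp [Instr.run, Mem.heap]
    · simp [Instr.run]

/-- Compute the distances from the target of the edge `e`. -/
def searchProg : Prog :=
  .seq clearProg (.seq adjacencyProg (.seq boundProg (.seq clearTableProg
    (.seq startProg searchLoop))))

theorem Keep.init {s s' : Mem} (h : Keep searchZone s s') : Keep initZone s s' :=
  h.mono (by decide) (by decide) (by decide) (by decide)

/-- The search computes the distances from `v`. The number `2 ^ k` is the power of two in the bound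
`B = 2 k` on the ranks. -/
theorem wp_searchProg {N : Network} {s : Mem} (hs : Given N s) {v : ℕ} (hv : v < N.n)
    (hv' : N.tgt (s.nat 2) = v) :
    WP searchProg s fun s' t => Keep initZone s s' ∧ Consts s' ∧
      (∀ x < N.n, s'.heap.node x ≠ 0 → N.Reach v x (s'.heap.key (s'.heap.node x))) ∧
      (∀ x d, N.Reach v x d → s'.heap.node x ≠ 0 ∧ s'.heap.key (s'.heap.node x) ≤ d) ∧
      ∃ k, 2 ^ k ≤ 2 * (N.m + 1) ∧ t ≤ 260 * N.m + (400 * k + 45) * N.n + 8 * k + 80 := by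
  refine WP.seq ((wp_clearProg hs).mono ?_)
  rintro s₁ t₁ ⟨a₁, a₂, a₃, a₄⟩
  have hs₁ := a₁.given (by decide) (by decide) hs
  refine WP.seq ((wp_adjacencyProg hs₁ a₂ a₃).mono ?_)
  rintro s₂ t₂ ⟨b₁, b₂, b₃, b₄, b₅, b₆⟩
  have hs₂ := b₁.given (by decide) (by decide) hs₁
  refine WP.seq ((wp_boundProg hs₂ b₂).mono ?_)
  rintro s₃ t₃ ⟨c₁, c₂, c₃, ⟨k, c₄, c₅, c₆⟩, c₇⟩
  have hs₃ := c₁.given (by decide) (by decide) hs₂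
  refine WP.seq ((wp_clearTableProg c₂).mono ?_)
  rintro s₄ t₄ ⟨d₁, d₂, d₃, d₄⟩
  have hs₄ := d₁.given (by decide) (by decide) hs₃
  have hc₄ := d₁.consts (by decide) c₂
  refine WP.seq ((wp_startProg hc₄).mono ?_)
  rintro s₅ t₅ ⟨e₁, ⟨H, e₂, e₃, e₄, e₅, e₆, e₇⟩, e₈⟩
  have hkeep : Keep initZone s s₅ :=
    (((a₁.trans b₁).trans c₁).trans d₁.search.init).trans e₁.search.init
  have hkeep' : Keep initZone s s₄ := ((a₁.trans b₁).trans c₁).trans d₁.search.init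
  have hL : Loaded N (2 * k) s₅ :=
    { toGiven := hkeep.given (by decide) (by decide) hs
      consts := e₁.consts (by decide) hc₄
      head := by
        rw [e₁.natArr 2 (by decide), d₁.natArr 2 (by decide), c₃]
        exact b₄
      next := by
        rw [e₁.natArr 3 (by decide), d₁.natArr 3 (by decide), c₃]
        exact b₅
      bound := (e₁.nat 7 (by decide)).trans ((d₁.nat 7 (by decide)).trans c₄) }
  rw [hs₄.tgt, hkeep'.nat 2 (by decide), hv'] at e₇
  obtain ⟨⟨kid, loc, f₁⟩, f₂, f₃, f₄, f₅⟩ := Search.start (N := N) (B := 2 * k) hv e₂ e₃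
    (by rw [e₅, ← c₄]; exact d₃) (by rw [e₆, d₂, c₃]; exact b₃) e₄
  rw [← e₇] at f₁ f₂ f₃ f₄ f₅
  have hk : 0 < k := Nat.pos_of_ne_zero fun h => by
    rw [h] at c₅
    simp at c₅
  refine (wp_searchLoop hL hv rfl c₅ f₁ f₂ (by omega) f₄).mono ?_
  rintro s₆ t₆ ⟨g₁, g₂, g₃⟩
  refine ⟨hkeep.trans g₁.init, (g₁.loaded hL).consts, g₂.reach, fun x d hd => g₂.dist_le hd, k, c₆,
    ?_⟩
  have h₁ : pending N s₅.heap {1} v 0 ≤ N.m := pending_le ..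
  have h₂ : unsettled N s₅.heap {1} ≤ N.n := unsettled_le ..
  have h₃ := Nat.mul_le_mul_left (200 * (2 * k) + 40) h₂
  have h₄ : (400 * k + 45) * N.n = (200 * (2 * k) + 40) * N.n + 5 * N.n := by ring
  rw [f₅] at g₃
  rw [c₄] at d₄
  omega

/-! ### The answer and the new potential -/

/-- Raise the potential of the vertex in register `10`. -/
def raiseStep : Prog :=
  .seq (.block [.natLoad 12 4 10])
    (.seq (.ite (.natEq 12 4) (.block [])
        (.seq (.block [.realLoad 2 2 12, .realSub 2 1 2])
          (.ite (.realLt 4 2) (.block [.realLoad 3 1 10, .realAdd 3 3 2, .realStore 1 10 3])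
            (.block []))))
      (.block [.natAdd 10 10 5]))

/-- The amount by which the potential of the vertex `x` is raised for the threshold `L`, where
the distance of `x` is the key of its current node. -/
noncomputable def raise (H : Heap) (L : ℝ) (x : ℕ) : ℝ :=
  if H.node x = 0 then 0 else max 0 (L - H.key (H.node x))

theorem wp_raiseStep {s : Mem} (hs : Consts s) (h4 : s.real 4 = 0) :
    WP raiseStep s fun s' t => t ≤ 13 ∧ s'.heap = s.heap ∧ Consts s' ∧ s'.real 4 = 0 ∧
      s'.real 1 = s.real 1 ∧ s'.nat 0 = s.nat 0 ∧ s'.nat 1 = s.nat 1 ∧ s'.nat 3 = s.nat 3 ∧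
      s'.natArr = s.natArr ∧ s'.realArr 0 = s.realArr 0 ∧ s'.nat 10 = s.nat 10 + 1 ∧
      s'.realArr 1 = Function.update (s.realArr 1) (s.nat 10)
        (s.realArr 1 (s.nat 10) + raise s.heap (s.real 1) (s.nat 10)) := by
  have hcs : ∀ s' : Mem, s'.nat 4 = s.nat 4 → s'.nat 5 = s.nat 5 → s'.nat 6 = s.nat 6 →
      Consts s' := fun s' h₁ h₂ h₃ => ⟨h₁.trans hs.zero, h₂.trans hs.one, h₃.trans hs.two⟩
  refine WP.seq (WP.block _ _ (WP.seq (WP.ite (fun h => WP.block _ _ (WP.block _ _ ?_))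
    (fun h => WP.seq (WP.block _ _ (WP.ite (fun h' => WP.block _ _ (WP.block _ _ ?_))
      (fun h' => WP.block _ _ (WP.block _ _ ?_))))))))
  · have hn : s.heap.node (s.nat 10) = 0 := by
      simpa [Test.Holds, Instr.run, hs.zero, Mem.heap] using h
    rw [raise, if_pos hn]
    refine ⟨by simp, by simp [Instr.run, Mem.heap], hcs _ ?_ ?_ ?_, ?_, ?_, ?_, ?_, ?_,
      ?_, ?_, ?_, ?_⟩
      <;> simp [Instr.run, h4, hs.one]
  · have hn : s.heap.node (s.nat 10) ≠ 0 := by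
      simpa [Test.Holds, Instr.run, hs.zero, Mem.heap] using h
    have hlt : s.heap.key (s.heap.node (s.nat 10)) < s.real 1 := by
      simpa [Test.Holds, Instr.run, h4, Mem.heap] using h'
    rw [raise, if_neg hn, max_eq_right (by linarith)]
    refine ⟨by simp, by simp [Instr.run, Mem.heap], hcs _ ?_ ?_ ?_, ?_, ?_, ?_, ?_, ?_,
      ?_, ?_, ?_, ?_⟩
      <;> simp [Instr.run, h4, hs.one, Mem.heap]
  · have hn : s.heap.node (s.nat 10) ≠ 0 := by
      simpa [Test.Holds, Instr.run, hs.zero, Mem.heap] using h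
    have hlt : s.real 1 ≤ s.heap.key (s.heap.node (s.nat 10)) := by
      simpa [Test.Holds, Instr.run, h4, Mem.heap] using h'
    rw [raise, if_neg hn, max_eq_left (by linarith)]
    refine ⟨by simp, by simp [Instr.run, Mem.heap], hcs _ ?_ ?_ ?_, ?_, ?_, ?_, ?_, ?_,
      ?_, ?_, ?_, ?_⟩
      <;> simp [Instr.run, h4, hs.one]

/-- Accept: store the new weight and raise the potential. -/
def acceptProg : Prog :=
  .seq (.block [.natConst 3 1, .realStore 0 2 0, .natConst 10 0, .realSub 4 4 4])
    (.loop (.natLt 10 0) raiseStep)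

theorem wp_acceptProg {s : Mem} (hs : Consts s) :
    WP acceptProg s fun s' t => t ≤ 14 * s.nat 0 + 6 ∧ s'.nat 0 = s.nat 0 ∧ s'.nat 1 = s.nat 1 ∧
      s'.nat 3 = 1 ∧ s'.natArr = s.natArr ∧
      s'.realArr 0 = Function.update (s.realArr 0) (s.nat 2) (s.real 0) ∧
      ∀ x < s.nat 0, s'.realArr 1 x = s.realArr 1 x + raise s.heap (s.real 1) x := by
  refine WP.seq (WP.block _ _ ((WP.count (K := 14) (M := s.nat 0)
    (fun i s' => s'.nat 10 = i ∧ s'.nat 0 = s.nat 0 ∧ s'.heap = s.heap ∧ Consts s' ∧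
      s'.real 4 = 0 ∧ s'.real 1 = s.real 1 ∧ s'.nat 1 = s.nat 1 ∧ s'.nat 3 = 1 ∧
      s'.natArr = s.natArr ∧
      s'.realArr 0 = Function.update (s.realArr 0) (s.nat 2) (s.real 0) ∧
      ∀ x, s'.realArr 1 x =
        if x < i then s.realArr 1 x + raise s.heap (s.real 1) x else s.realArr 1 x)
    (fun i s' h => ⟨h.1, h.2.1⟩) ?_ ?_).mono ?_))
  · rintro i s₁ hi ⟨h₁, h₂, h₃, h₄, h₅, h₆, h₇, h₈, h₉, h₁₀, h₁₁⟩
    refine (wp_raiseStep h₄ h₅).mono ?_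
    rintro s' t ⟨g₀, g₁, g₂, g₃, g₄, g₅, g₆, g₇, g₈, g₉, g₁₀, g₁₁⟩
    refine ⟨⟨by omega, by omega, g₁.trans h₃, g₂, g₃, g₄.trans h₆, g₆.trans h₇, g₇.trans h₈,
      g₈.trans h₉, g₉.trans h₁₀, fun x => ?_⟩, by omega⟩
    rw [g₁₁, h₁, h₃, h₆, Function.update_apply, h₁₁, h₁₁]
    by_cases hx : x = i
    · subst hx
      simp
    · have : x < i + 1 ↔ x < i := by omega
      simp [hx, this]
  · exact ⟨by simp [Instr.run], by simp [Instr.run], by simp [Instr.run, Mem.heap],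
      ⟨by simp [Instr.run, hs.zero], by simp [Instr.run, hs.one], by simp [Instr.run, hs.two]⟩,
      by simp [Instr.run], by simp [Instr.run], by simp [Instr.run], by simp [Instr.run],
      by simp [Instr.run], by simp [Instr.run], by simp [Instr.run]⟩
  · rintro s' t ⟨⟨-, h₂, -, -, -, -, h₇, h₈, h₉, h₁₀, h₁₁⟩, ht⟩
    refine ⟨by simp only [List.length]; omega, h₂, h₇, h₈, h₉, h₁₀, fun x hx => ?_⟩
    rw [h₁₁, if_pos hx]

/-- Reject if the distance of the source of `e` is below the threshold `L = φ u - φ v - c`, which is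
`-w'_φ(u,v)`. -/
def decideProg : Prog :=
  .seq (.block [.natLoad 11 0 2, .natLoad 12 1 2, .realLoad 2 1 11, .realLoad 3 1 12,
      .realSub 1 2 3, .realSub 1 1 0, .natLoad 12 4 11, .realLoad 2 2 12])
    (.ite (.natEq 12 4) acceptProg
      (.ite (.realLt 2 1) (.block [.natConst 3 0]) acceptProg))

theorem wp_decideProg {s : Mem} (hs : Consts s) {u v : ℕ} {L : ℝ}
    (hu : s.natArr 0 (s.nat 2) = u) (hv : s.natArr 1 (s.nat 2) = v)
    (hL : s.realArr 1 u - s.realArr 1 v - s.real 0 = L) :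
    WP decideProg s fun s' t => t ≤ 14 * s.nat 0 + 20 ∧ s'.nat 0 = s.nat 0 ∧
      s'.nat 1 = s.nat 1 ∧ s'.natArr = s.natArr ∧
      ((s.heap.node u ≠ 0 ∧ s.heap.key (s.heap.node u) < L ∧ s'.nat 3 = 0 ∧
          s'.realArr = s.realArr) ∨
        (¬ (s.heap.node u ≠ 0 ∧ s.heap.key (s.heap.node u) < L) ∧ s'.nat 3 = 1 ∧
          s'.realArr 0 = Function.update (s.realArr 0) (s.nat 2) (s.real 0) ∧
          ∀ x < s.nat 0, s'.realArr 1 x = s.realArr 1 x + raise s.heap L x)) := by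
  refine WP.seq (WP.block _ _ ?_)
  set s₁ := List.foldl (fun s i => Instr.run i s) s [.natLoad 11 0 2, .natLoad 12 1 2,
    .realLoad 2 1 11, .realLoad 3 1 12, .realSub 1 2 3, .realSub 1 1 0, .natLoad 12 4 11,
    .realLoad 2 2 12] with hs₁
  have h0 : s₁.nat 0 = s.nat 0 := by simp [hs₁, Instr.run]
  have h1 : s₁.nat 1 = s.nat 1 := by simp [hs₁, Instr.run]
  have h2 : s₁.nat 2 = s.nat 2 := by simp [hs₁, Instr.run]
  have hc₁ : Consts s₁ := ⟨by simp [hs₁, Instr.run, hs.zero], by simp [hs₁, Instr.run, hs.one],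
    by simp [hs₁, Instr.run, hs.two]⟩
  have h12 : s₁.nat 12 = s.heap.node u := by simp [hs₁, Instr.run, Mem.heap, hu]
  have hr0 : s₁.real 0 = s.real 0 := by simp [hs₁, Instr.run]
  have hr1 : s₁.real 1 = L := by simp [hs₁, Instr.run, hu, hv, hL]
  have hr2 : s₁.real 2 = s.heap.key (s.heap.node u) := by simp [hs₁, Instr.run, Mem.heap, hu]
  have hA : s₁.natArr = s.natArr := by simp [hs₁, Instr.run]
  have hF : s₁.realArr = s.realArr := by simp [hs₁, Instr.run]
  have hH : s₁.heap = s.heap := by simp [hs₁, Instr.run, Mem.heap]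
  clear_value s₁
  have hacc : ¬ (s.heap.node u ≠ 0 ∧ s.heap.key (s.heap.node u) < L) →
      WP acceptProg s₁ fun s' t => t ≤ 14 * s.nat 0 + 6 ∧ s'.nat 0 = s.nat 0 ∧
        s'.nat 1 = s.nat 1 ∧ s'.natArr = s.natArr ∧
        (¬ (s.heap.node u ≠ 0 ∧ s.heap.key (s.heap.node u) < L) ∧ s'.nat 3 = 1 ∧
          s'.realArr 0 = Function.update (s.realArr 0) (s.nat 2) (s.real 0) ∧
          ∀ x < s.nat 0, s'.realArr 1 x = s.realArr 1 x + raise s.heap L x) := fun h => by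
    have := wp_acceptProg hc₁
    rw [h0, h1, h2, hr0, hr1, hA, hF, hH] at this
    exact this.mono fun s' t ⟨g₁, g₂, g₃, g₄, g₅, g₆, g₇⟩ => ⟨g₁, g₂, g₃, g₅, h, g₄, g₆, g₇⟩
  refine WP.ite (fun h => ?_) (fun h => WP.ite (fun h' => WP.block _ _ ?_) (fun h' => ?_))
  · simp only [Test.Holds, h12, hc₁.zero] at h
    refine (hacc fun hc => hc.1 h).mono fun s' t ⟨g₁, g₂, g₃, g₄, g₅⟩ =>
      ⟨by simp only [List.length]; omega, g₂, g₃, g₄, .inr g₅⟩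
  · simp only [Test.Holds, h12, hc₁.zero] at h
    simp only [Test.Holds, hr1, hr2] at h'
    refine ⟨by simp, ?_, ?_, ?_, .inl ⟨h, h', ?_, ?_⟩⟩
    · simp [Instr.run, h0]
    · simp [Instr.run, h1]
    · simp [Instr.run, hA]
    · simp [Instr.run]
    · simp [Instr.run, hF]
  · simp only [Test.Holds, hr1, hr2] at h'
    refine (hacc fun hc => h' hc.2).mono fun s' t ⟨g₁, g₂, g₃, g₄, g₅⟩ =>
      ⟨by simp only [List.length]; omega, g₂, g₃, g₄, .inr g₅⟩

/-! ### Paths, potentials and consistency -/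

section Graph

variable {V : Type*} {G : Digraph V}

theorem updateWeight_self (w : Edge G → ℝ) (e : Edge G) (c : ℝ) : updateWeight w e c e = c := by
  simp [updateWeight]

theorem updateWeight_of_ne (w : Edge G → ℝ) {e f : Edge G} (c : ℝ) (h : f ≠ e) :
    updateWeight w e c f = w f := by
  simp [updateWeight, h]

theorem Path.weight_potWeight (w : Edge G → ℝ) (φ : V → ℝ) {a b : V} (P : Path G a b) :
    P.weight (potWeight w φ) = P.weight w + φ b - φ a := by
  induction P with
  | single a => simp [Path.weight]
  | cons h P ih =>
    simp only [Path.weight, ih, potWeight]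
    ring

theorem Path.weight_nonneg {w : Edge G → ℝ} (hw : ∀ e, 0 ≤ w e) {a b : V} (P : Path G a b) :
    0 ≤ P.weight w := by
  induction P with
  | single a => simp [Path.weight]
  | cons h P ih => exact add_nonneg (hw _) ih

/-- Potentials cancel along a cycle. -/
theorem Feasible.consistent {w : Edge G → ℝ} {φ : V → ℝ} (h : Feasible G w φ) :
    Consistent G w := fun a P => by
  have h₁ := P.weight_potWeight w φ
  have h₂ := P.weight_nonneg h
  linarith

theorem Path.exists_snoc (w : Edge G → ℝ) {a b d : V} (P : Path G a b) (h : G.Adj b d) :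
    ∃ Q : Path G a d, Q.weight w = P.weight w + w ⟨(b, d), h⟩ := by
  induction P with
  | single a => exact ⟨.cons h (.single d), by simp [Path.weight]⟩
  | cons h' P ih =>
    obtain ⟨Q, hQ⟩ := ih h
    exact ⟨.cons h' Q, by simp only [Path.weight, hQ]; ring⟩

/-- If a path uses the edge `e`, the part after the last use does not. So it has the same weight for
`w` and `w'`, which is at most the weight of the whole path. -/
theorem Path.avoid {w w' : Edge G → ℝ} (hw : ∀ e, 0 ≤ w e) (e : Edge G)
    (hw' : ∀ f, f ≠ e → w' f = w f) {a b : V} (P : Path G a b) :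
    P.weight w' = P.weight w ∨ ∃ Q : Path G e.1.2 b, Q.weight w' ≤ P.weight w := by
  induction P with
  | single a => exact .inl rfl
  | @cons x y z h P ih =>
    rcases ih with ih | ⟨Q, hQ⟩
    · by_cases he : (⟨(x, y), h⟩ : Edge G) = e
      · subst he
        exact .inr ⟨P, by simp only [Path.weight, ih]; linarith [hw ⟨(x, y), h⟩]⟩
      · exact .inl (by simp only [Path.weight, ih, hw' _ he])
    · exact .inr ⟨Q, by simp only [Path.weight]; linarith [hw ⟨(x, y), h⟩]⟩

/-- A short path from the target to the source of `e` closes a negative cycle. -/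
theorem not_consistent_update {w : Edge G → ℝ} {φ : V → ℝ} (h : Feasible G w φ) {e : Edge G}
    {c : ℝ} (P : Path G e.1.2 e.1.1)
    (hP : P.weight (potWeight w φ) < -potWeight (updateWeight w e c) φ e) :
    ¬ Consistent G (updateWeight w e c) := fun hc => by
  have hw' : ∀ f, f ≠ e → potWeight (updateWeight w e c) φ f = potWeight w φ f := fun f hf => by
    rw [potWeight, updateWeight_of_ne w c hf, potWeight]
  obtain ⟨Q, hQ⟩ : ∃ Q : Path G e.1.2 e.1.1,
      Q.weight (potWeight (updateWeight w e c) φ) ≤ P.weight (potWeight w φ) := by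
    rcases P.avoid h e hw' with h₁ | h₁
    exacts [⟨P, h₁.le⟩, h₁]
  have h₁ := hc _ (.cons e.2 Q)
  have h₂ := Path.weight_potWeight (updateWeight w e c) φ (.cons e.2 Q)
  have h₃ : (Path.cons e.2 Q).weight (potWeight (updateWeight w e c) φ) =
      potWeight (updateWeight w e c) φ e + Q.weight (potWeight (updateWeight w e c) φ) := rfl
  linarith

end Graph

section Store

variable {n m : ℕ} {G : Digraph (Fin n)} {ord : Fin m ≃ Edge G} {w : Edge G → ℝ} {φ : Fin n → ℝ}
  {s : Mem}

/-- The stored graph with the edge lengths `w_φ`. -/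
def Stores.network (hs : Stores G ord w φ s) (hφ : Feasible G w φ) : Network where
  n := n
  m := m
  src := s.natArr 0
  tgt := s.natArr 1
  len i := s.realArr 0 i + s.realArr 1 (s.natArr 1 i) - s.realArr 1 (s.natArr 0 i)
  src_lt i hi := by rw [hs.source ⟨i, hi⟩]; exact Fin.is_lt _
  tgt_lt i hi := by rw [hs.target ⟨i, hi⟩]; exact Fin.is_lt _
  len_nonneg i hi := by
    rw [hs.source ⟨i, hi⟩, hs.target ⟨i, hi⟩, hs.weight ⟨i, hi⟩, hs.potential, hs.potential]
    exact hφ _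

theorem Stores.len_eq (hs : Stores G ord w φ s) (hφ : Feasible G w φ) (i : Fin m) :
    (hs.network hφ).len i = potWeight w φ (ord i) := by
  simp only [Stores.network, hs.source, hs.target, hs.weight, hs.potential, potWeight]

theorem Stores.exists_path (hs : Stores G ord w φ s) (hφ : Feasible G w φ) {v : Fin n} {x : ℕ}
    {d : ℝ} (h : (hs.network hφ).Reach v x d) :
    ∃ (hx : x < n) (P : Path G v ⟨x, hx⟩), P.weight (potWeight w φ) = d := by
  induction h with
  | refl => exact ⟨v.2, .single v, rfl⟩
  | @step d i hi _ ih =>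
    obtain ⟨hx, P, hP⟩ := ih
    have h₁ : (ord ⟨i, hi⟩).1.1 = ⟨(hs.network hφ).src i, hx⟩ :=
      (Fin.ext (hs.source ⟨i, hi⟩)).symm
    have hy : (hs.network hφ).tgt i < n := (hs.network hφ).tgt_lt i hi
    have h₂ : (ord ⟨i, hi⟩).1.2 = ⟨(hs.network hφ).tgt i, hy⟩ :=
      (Fin.ext (hs.target ⟨i, hi⟩)).symm
    refine ⟨hy, ?_⟩
    rw [hs.len_eq hφ ⟨i, hi⟩]
    -- The endpoints of the path are rewritten by substitution.
    revert h₁ h₂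
    generalize ord ⟨i, hi⟩ = f
    obtain ⟨⟨a, b⟩, hf⟩ := f
    rintro rfl rfl
    obtain ⟨Q, hQ⟩ := P.exists_snoc (potWeight w φ) hf
    exact ⟨Q, by rw [hQ, hP]⟩

theorem Stores.reach_path (hs : Stores G ord w φ s) (hφ : Feasible G w φ) {v a b : Fin n}
    {d : ℝ} (h : (hs.network hφ).Reach v a d) (P : Path G a b) :
    (hs.network hφ).Reach v b (d + P.weight (potWeight w φ)) := by
  induction P generalizing d with
  | single a => simpa [Path.weight] using h
  | @cons x y z hxy P ih =>
    obtain ⟨i, hi⟩ := ord.surjective ⟨(x, y), hxy⟩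
    have h₁ : (hs.network hφ).src i = x := (hs.source i).trans (by rw [hi])
    have h₂ : (hs.network hφ).tgt i = y := (hs.target i).trans (by rw [hi])
    have h₃ := hs.len_eq hφ i
    rw [hi] at h₃
    have h₄ := Network.Reach.step (N := hs.network hφ) (v := v) (d := d) i.2 (h₁.symm ▸ h)
    rw [h₂, h₃] at h₄
    have h₅ := ih h₄
    rwa [add_assoc] at h₅

end Store

/-- The bound `O(m + n k)` with `k = O(log m)` is `O(m + n log n)`: here `m ≤ n ^ 2`, and there is
an edge, so that `m` pays for the constants even if `n = 1` and `log n = 0`. -/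
theorem time_bound {n m k t : ℕ} (hn : 0 < n) (hm : 0 < m) (hmn : m ≤ n ^ 2)
    (hk : 2 ^ k ≤ 2 * (m + 1)) (ht : t ≤ 260 * m + (400 * k + 60) * n + 8 * k + 120) :
    (t : ℝ) ≤ 3000 * ((m : ℝ) + (n : ℝ) * Real.log (n : ℝ)) := by
  have hn' : (1 : ℝ) ≤ n := by exact_mod_cast hn
  have hm' : (1 : ℝ) ≤ m := by exact_mod_cast hm
  have hlog : 0 ≤ Real.log n := Real.log_nonneg hn'
  have hlog2 := Real.log_two_gt_d9
  have hk' : (k : ℝ) ≤ 2 + 3 * Real.log n := by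
    have h₁ : 2 ^ k ≤ 2 ^ 2 * n ^ 2 := by
      have : 2 * (m + 1) ≤ 4 * m := by omega
      calc 2 ^ k ≤ 4 * m := hk.trans this
        _ ≤ 2 ^ 2 * n ^ 2 := by omega
    have h₂ : ((2 : ℝ) ^ k) ≤ 2 ^ 2 * (n : ℝ) ^ 2 := by exact_mod_cast h₁
    have h₃ := Real.log_le_log (by positivity) h₂
    rw [Real.log_mul (by positivity) (by positivity), Real.log_pow, Real.log_pow, Real.log_pow]
      at h₃
    push_cast at h₃
    by_contra! hcon
    nlinarith
  have hnlog : (n : ℝ) ≤ m + 2 * (n * Real.log n) := by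
    rcases Nat.lt_or_ge n 2 with h | h
    · obtain rfl : n = 1 := by omega
      simpa using hm'
    · have h₁ : Real.log 2 ≤ Real.log n := Real.log_le_log (by norm_num) (by exact_mod_cast h)
      nlinarith
  have hlogn : Real.log n ≤ n * Real.log n := by nlinarith
  have hkn : (k : ℝ) * n ≤ 2 * n + 3 * (n * Real.log n) := by nlinarith
  have ht' : (t : ℝ) ≤ 260 * m + (400 * k + 60) * n + 8 * k + 120 := by exact_mod_cast ht
  nlinarith

/-! ### Correctness of the update -/

/-- The keys of the current nodes in `H` are the distances from `v`, and the vertices without a node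
are those that cannot be reached. -/
structure Heap.Solves (H : Heap) (N : Network) (v : ℕ) : Prop where
  reach : ∀ x < N.n, H.node x ≠ 0 → N.Reach v x (H.key (H.node x))
  le : ∀ x d, N.Reach v x d → H.node x ≠ 0 ∧ H.key (H.node x) ≤ d

section Correct

variable {n m : ℕ} {G : Digraph (Fin n)} {ord : Fin m ≃ Edge G} {w : Edge G → ℝ} {φ : Fin n → ℝ}
  {s : Mem} {H : Heap} {c : ℝ} {e : Edge G}

theorem Stores.key_le (hs : Stores G ord w φ s) (hφ : Feasible G w φ) {v x : Fin n}
    (hH : H.Solves (hs.network hφ) v) (P : Path G v x) :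
    H.node x ≠ 0 ∧ H.key (H.node x) ≤ P.weight (potWeight w φ) := by
  have h := hH.le _ _ (hs.reach_path hφ .refl P)
  rwa [zero_add] at h

theorem Stores.dist_eq_key (hs : Stores G ord w φ s) (hφ : Feasible G w φ) {v x : Fin n}
    (hH : H.Solves (hs.network hφ) v) (hx : H.node x ≠ 0) :
    dist G (potWeight w φ) v x = (H.key (H.node x) : ℝ) := by
  refine le_antisymm ?_ (le_iInf fun P => EReal.coe_le_coe_iff.2 (hs.key_le hφ hH P).2)
  obtain ⟨_, P, hP⟩ := hs.exists_path hφ (hH.reach x x.2 hx)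
  exact hP ▸ iInf_le (fun P : Path G v x => ((P.weight (potWeight w φ) : ℝ) : EReal)) P

theorem Stores.dist_eq_top (hs : Stores G ord w φ s) (hφ : Feasible G w φ) {v x : Fin n}
    (hH : H.Solves (hs.network hφ) v) (hx : H.node x = 0) :
    dist G (potWeight w φ) v x = ⊤ :=
  iInf_eq_top.2 fun P => absurd hx (hs.key_le hφ hH P).1

theorem Stores.raisedPotential_eq (hs : Stores G ord w φ s) (hφ : Feasible G w φ)
    (hH : H.Solves (hs.network hφ) e.1.2) (x : Fin n) :
    raisedPotential G w φ e c x = φ x + raise H (-potWeight (updateWeight w e c) φ e) x := by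
  rw [raisedPotential, raise]
  split_ifs with hx
  · rw [hs.dist_eq_top hφ hH hx]
    simp
  · rw [hs.dist_eq_key hφ hH hx, ← EReal.coe_sub, ← EReal.coe_zero,
      ← EReal.coe_strictMono.monotone.map_max, EReal.toReal_coe]

/-- Raising by `max 0 (L - D x)` keeps the edges other than `e` nonnegative since `D` satisfies the
triangle inequality. For `e = (u, v)` it works since `D v = 0` and `L ≤ D u`: `v` is raised enough
and `u` is not raised. -/
theorem Stores.feasible_raisedPotential (hs : Stores G ord w φ s) (hφ : Feasible G w φ)
    (hH : H.Solves (hs.network hφ) e.1.2)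
    (hL : ¬ (H.node e.1.1 ≠ 0 ∧
      H.key (H.node e.1.1) < -potWeight (updateWeight w e c) φ e)) :
    Feasible G (updateWeight w e c) (raisedPotential G w φ e c) := by
  intro f
  set L := -potWeight (updateWeight w e c) φ e with hLdef
  have hL' : L = φ e.1.1 - φ e.1.2 - c := by
    rw [hLdef, potWeight, updateWeight_self]
    ring
  rw [potWeight, hs.raisedPotential_eq hφ hH, hs.raisedPotential_eq hφ hH]
  by_cases hf : f = e
  · subst hf
    rw [updateWeight_self]
    have hu : raise H L f.1.1 = 0 := by
      rw [raise]
      split_ifs with h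
      · rfl
      · exact max_eq_left (sub_nonpos.2 (not_lt.1 fun h' => hL ⟨h, h'⟩))
    have hv : L ≤ raise H L f.1.2 := by
      obtain ⟨h₁, h₂⟩ := hH.le _ _ .refl
      rw [raise, if_neg h₁]
      exact le_max_of_le_right (by linarith)
    rw [hu]
    linarith
  · have h₁ : updateWeight w e c f = w f := by simp [updateWeight, hf]
    have h₂ : 0 ≤ w f + φ f.1.2 - φ f.1.1 := hφ f
    have h₃ : raise H L f.1.1 ≤ raise H L f.1.2 + (w f + φ f.1.2 - φ f.1.1) := by
      have h₀ : 0 ≤ raise H L f.1.2 := by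
        rw [raise]
        split_ifs
        exacts [le_rfl, le_max_left _ _]
      by_cases hx : H.node f.1.1 = 0
      · rw [raise, if_pos hx]
        linarith
      · obtain ⟨_, P, hP⟩ := hs.exists_path hφ (hH.reach _ f.1.1.2 hx)
        obtain ⟨Q, hQ⟩ := P.exists_snoc (potWeight w φ) f.2
        obtain ⟨h₅, h₆⟩ := hs.key_le hφ hH Q
        have h₇ : L - H.key (H.node f.1.2) ≤ raise H L f.1.2 := by
          rw [raise, if_neg h₅]
          exact le_max_right _ _
        have h₈ : potWeight w φ ⟨(f.1.1, f.1.2), f.2⟩ = w f + φ f.1.2 - φ f.1.1 := rfl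
        rw [raise, if_neg hx]
        refine max_le (by linarith) ?_
        linarith
    rw [h₁]
    linarith

theorem card_edge_le (ord : Fin m ≃ Edge G) : m ≤ n ^ 2 := by
  have h := Fintype.card_le_of_injective (fun i => (ord i).1)
    (Subtype.val_injective.comp ord.injective)
  simpa [sq] using h

end Correct

/-- Dijkstra's algorithm from the target of the changed edge, the test of its source and the update
of the potential. -/
def checkProg : Prog := .seq searchProg decideProg

theorem wp_checkProg {n m : ℕ} {G : Digraph (Fin n)} {ord : Fin m ≃ Edge G} {w : Edge G → ℝ}
    {φ : Fin n → ℝ} {e : Edge G} {c : ℝ} {s : Mem} (hφ : Feasible G w φ)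
    (hs : Stores G ord w φ s) (hq : HoldsQuery ord e c s) :
    WP checkProg s fun s' t =>
      (t : ℝ) ≤ 3000 * ((m : ℝ) + (n : ℝ) * Real.log (n : ℝ)) ∧
      ((¬ Consistent G (updateWeight w e c) ∧ s'.answer = 0 ∧ Stores G ord w φ s') ∨
        (Feasible G (updateWeight w e c) (raisedPotential G w φ e c) ∧ s'.answer = 1 ∧
          Stores G ord (updateWeight w e c) (raisedPotential G w φ e c) s')) := by
  have hm : 0 < m := Fin.pos (ord.symm e)
  have hn : 0 < n := Fin.pos e.1.1
  have hsrc : s.natArr 0 (s.nat 2) = e.1.1 := by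
    rw [hq.edge, hs.source, Equiv.apply_symm_apply]
  have htgt : s.natArr 1 (s.nat 2) = e.1.2 := by
    rw [hq.edge, hs.target, Equiv.apply_symm_apply]
  have hgiven : Given (hs.network hφ) s :=
    ⟨hs.numVertices, hs.numEdges, rfl, rfl, fun _ => rfl⟩
  refine WP.seq ((wp_searchProg hgiven (v := e.1.2) e.1.2.2 htgt).mono ?_)
  rintro s₁ t₁ ⟨hk, hc, h₁, h₂, k, h₃, h₄⟩
  have hH : s₁.heap.Solves (hs.network hφ) e.1.2 := ⟨h₁, h₂⟩
  have hr0 : s₁.nat 0 = n := (hk.nat 0 (.inl (by decide))).trans hs.numVertices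
  have hr1 : s₁.nat 1 = m := (hk.nat 1 (.inl (by decide))).trans hs.numEdges
  have hr2 : s₁.nat 2 = s.nat 2 := hk.nat 2 (.inl (by decide))
  have hreal : s₁.real 0 = c := (hk.real 0 (by decide)).trans hq.newWeight
  have ha0 : s₁.natArr 0 = s.natArr 0 := hk.natArr 0 (by decide)
  have ha1 : s₁.natArr 1 = s.natArr 1 := hk.natArr 1 (by decide)
  have hw : s₁.realArr 0 = s.realArr 0 := hk.realArr 0 (by decide)
  have hp : s₁.realArr 1 = s.realArr 1 := hk.realArr 1 (by decide)
  have hL : s₁.realArr 1 e.1.1 - s₁.realArr 1 e.1.2 - s₁.real 0 =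
      -potWeight (updateWeight w e c) φ e := by
    rw [hp, hs.potential, hs.potential, hreal, potWeight, updateWeight_self]
    ring
  refine (wp_decideProg hc (u := e.1.1) (v := e.1.2) (by rw [ha0, hr2, hsrc])
    (by rw [ha1, hr2, htgt]) hL).mono ?_
  rintro s₂ t₂ ⟨h₅, h₆, h₇, h₈, h₉⟩
  have hsrc₂ : ∀ i : Fin m, s₂.natArr 0 i = (ord i).1.1 := fun i => by rw [h₈, ha0, hs.source]
  have htgt₂ : ∀ i : Fin m, s₂.natArr 1 i = (ord i).1.2 := fun i => by rw [h₈, ha1, hs.target]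
  refine ⟨time_bound hn hm (card_edge_le ord) h₃ ?_, h₉.imp ?_ ?_⟩
  · change t₁ ≤ 260 * m + (400 * k + 45) * n + 8 * k + 80 at h₄
    rw [hr0] at h₅
    have : (400 * k + 60) * n = (400 * k + 45) * n + 15 * n := by ring
    omega
  · rintro ⟨g₁, g₂, g₃, g₄⟩
    refine ⟨?_, g₃, ⟨h₆.trans hr0, h₇.trans hr1, hsrc₂, htgt₂, fun i => ?_, fun x => ?_⟩⟩
    · obtain ⟨_, P, hP⟩ := hs.exists_path hφ (h₁ _ e.1.1.2 g₁)
      exact not_consistent_update hφ P (hP ▸ g₂)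
    · rw [g₄, hw, hs.weight]
    · rw [g₄, hp, hs.potential]
  · rintro ⟨g₁, g₂, g₃, g₄⟩
    refine ⟨hs.feasible_raisedPotential hφ hH g₁, g₂,
      ⟨h₆.trans hr0, h₇.trans hr1, hsrc₂, htgt₂, fun i => ?_, fun x => ?_⟩⟩
    · rw [g₃, hw, hr2, hreal, hq.edge]
      by_cases hi : ord i = e
      · rw [hi, updateWeight_self, ← hi, Equiv.symm_apply_apply, Function.update_self]
      · have hi' : (i : ℕ) ≠ ord.symm e := fun h => hi (by rw [Fin.ext h, Equiv.apply_symm_apply])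
        rw [Function.update_of_ne hi', updateWeight_of_ne w c hi, hs.weight]
    · rw [g₄ x (by rw [hr0]; exact x.2), hp, hs.potential, hs.raisedPotential_eq hφ hH]

end NegWeights

theorem mainTheorem5 :
    ∃ (P : NegWeights.Prog) (C : ℝ),
      ∀ (n m : ℕ) (G : Digraph (Fin n)) (ord : Fin m ≃ NegWeights.Edge G) (W : Set ℝ)
        (w : NegWeights.Edge G → ℝ) (φ : Fin n → ℝ) (e : NegWeights.Edge G) (c : ℝ)
        (s : NegWeights.Mem),
        w ∈ NegWeights.ConsistentWeights G W →
        NegWeights.Feasible G w φ →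
        c ∈ W →
        NegWeights.Stores G ord w φ s →
        NegWeights.HoldsQuery ord e c s →
        ∃ (s' : NegWeights.Mem) (t : ℕ),
          NegWeights.Exec P s s' t ∧
          (t : ℝ) ≤ C * ((m : ℝ) + (n : ℝ) * Real.log (n : ℝ)) ∧
          (NegWeights.updateWeight w e c ∈ NegWeights.ConsistentWeights G W →
            s'.answer = 1 ∧
            NegWeights.Stores G ord (NegWeights.updateWeight w e c)
              (NegWeights.raisedPotential G w φ e c) s' ∧
            NegWeights.Feasible G (NegWeights.updateWeight w e c)
              (NegWeights.raisedPotential G w φ e c)) ∧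
          (NegWeights.updateWeight w e c ∉ NegWeights.ConsistentWeights G W →
            s'.answer = 0 ∧ NegWeights.Stores G ord w φ s') := by
  refine ⟨NegWeights.checkProg, 3000, fun n m G ord W w φ e c s hw hφ hc hs hq => ?_⟩
  obtain ⟨s', t, h₁, h₂, ⟨h₃, h₄, h₅⟩ | ⟨h₃, h₄, h₅⟩⟩ := NegWeights.wp_checkProg hφ hs hq
  · exact ⟨s', t, h₁, h₂, fun h => absurd h.2 h₃, fun _ => ⟨h₄, h₅⟩⟩
  · have hW : ∀ f, NegWeights.updateWeight w e c f ∈ W := fun f => by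
      by_cases hf : f = e
      · rwa [hf, NegWeights.updateWeight_self]
      · rw [NegWeights.updateWeight_of_ne w c hf]
        exact hw.1 f
    exact ⟨s', t, h₁, h₂, fun _ => ⟨h₄, h₅, h₃⟩, fun h => absurd ⟨hW, h₃.consistent⟩ h⟩
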